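/- **Theorem 2 (Existence of a solution for the partial Riemann problem).** Let $\Omega\subset\mathbb R^m$ be an open convex cone and $F:\Omega\to\mathbb R^m$ a flux of class $C^2$ such that the system $$\partial_t W+\partial_x F(W)=0\qquad(1)$$ is strictly hyperbolic: for each $W\in\Omega$ the Jacobian $dF(W)$ has real eigenvalues $\lambda_1(W)<\dots<\lambda_m(W)$, with eigenvectors $R_1(W),\dots,R_m(W)$ depending continuously on $W$. Assume that each field $j$ is either genuinely nonlinear, $d\lambda_j(W)\cdot R_j(W)=1$ for all $W\in\Omega$, or linearly degenerate, $d\lambda_j(W)\cdot R_j(W)=0$ for all $W\in\Omega$. Let $0\le p\le m$, let $W_0\in\Omega$, let $\Omega_0\subset\Omega$ be an open neighbourhood of $W_0$, and let $\Phi:\Omega_0\to\Theta$ be a $C^1$ diffeomorphism onto an open neighbourhood $\Theta$ of $0$ in $\mathbb R^m$. Put $\mathcal M_r=\{X\in\Omega_0:\Phi_1(X)=\dots=\Phi_p(X)=0\}$ and assume $W_0\in\mathcal M_r$. Let $\xi_k$, $k>p$, be the vectors with $d\Phi(W_0)\cdot\xi_k=e_k$ ($k$-th canonical basis vector), and assume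 that $R_1(W_0),\dots,R_p(W_0),\xi_{p+1},\dots,\xi_m$ is a basis of $\mathbb R^m$. Then there are $\delta>0$, a neighbourhood $V\subset\Omega$ of $W_0$ and, for $j=1,\dots,m$, wave curves $(\epsilon,W)\mapsto\chi_j(\epsilon;W)\in\Omega$ ($|\epsilon|<\delta$, $W\in V$), of class $C^1$ in $\epsilon$, with $\chi_j(0;W)=W$ and $\partial_\epsilon\chi_j(0;W)=R_j(W)$, such that: * if the $j$-th field is genuinely nonlinear and $\epsilon>0$, then $\partial_\epsilon\chi_j(\epsilon;W)=R_j(\chi_j(\epsilon;W))$ ($j$-rarefaction); * if the $j$-th field is genuinely nonlinear and $\epsilon<0$, then $W$ and $W'=\chi_j(\epsilon;W)$ are the left and right states of a Lax $j$-shock of some speed $\sigma=\sigma_j(\epsilon;W)$: $F(W')-F(W)=\sigma(W'-W)$, $\lambda_j(W')<\sigma<\lambda_j(W)$, $\lambda_i(W)<\sigma$ for $i<j$ and $\sigma<\lambda_i(W')$ for $i>j$; * if the $j$-th field is linearly degenerate, then $\partial_\epsilon\chi_j(\epsilon;W)=R_j(\chi_j(\epsilon;W))$ for all $\epsilon$,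 and $W'=\chi_j(\epsilon;W)$ satisfies $\lambda_j(W')=\lambda_j(W)$ and $F(W')-F(W)=\lambda_j(W)(W'-W)$ ($j$-contact discontinuity); and there is a neighbourhood $\Omega_1\subset\Omega_0$ of $W_0$ such that for every $W_l\in\Omega_1$ there are $\epsilon_1,\dots,\epsilon_p\in(-\delta,\delta)$ and states $W^0,\dots,W^p\in V$ with $$W^0=W_l,\qquad W^j=\chi_j(\epsilon_j;W^{j-1})\ (1\le j\le p),\qquad W^p\in\mathcal M_r,$$ and a function $U:\mathbb R\to\Omega$ with the following properties. Let $\mu_j^-=\mu_j^+=\sigma_j(\epsilon_j;W^{j-1})$ if the $j$-th wave is a shock, and $\mu_j^-=\lambda_j(W^{j-1})$, $\mu_j^+=\lambda_j(W^j)$ otherwise. Then $\mu_1^-\le\mu_1^+<\mu_2^-\le\dots\le\mu_p^+$, and $U(\xi)=W^0$ for $\xi<\mu_1^-$, $U(\xi)=\chi_j(\xi-\mu_j^-;W^{j-1})$ for $\mu_j^-<\xi<\mu_j^+$, $U(\xi)=W^j$ for $\mu_j^+<\xi<\mu_{j+1}^-$, and $U(\xi)=W^p$ for $\xi>\mu_p^+$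 (if $p=0$, $U\equiv W_l$). The self-similar function $W(x,t)=U(x/t)$, $t>0$, is a measurable entropy solution with values in a compact subset of $\Omega$ of the partial Riemann problem $P(W_l,\mathcal M_r)$, that is of the Cauchy problem for (1) with $W(x,0)=W_l$ for $x<0$ and $W(x,0)\in\mathcal M_r$ for $x>0$ (here $W(x,0)=W^p$ for $x>0$): for every $\varphi\in C^1_c(\mathbb R^2)$, $$\int_0^\infty\!\!\int_{\mathbb R}\bigl(W\,\partial_t\varphi+F(W)\,\partial_x\varphi\bigr)\,dx\,dt+\int_{\mathbb R}W(x,0)\,\varphi(x,0)\,dx=0,$$ and, for every $\varphi\ge0$ in $C^1_c(\mathbb R^2)$ and every pair of $C^1$ functions $\eta,q:\Omega\to\mathbb R$ with $\eta$ convex and $dq=d\eta\,dF$, $$\int_0^\infty\!\!\int_{\mathbb R}\bigl(\eta(W)\,\partial_t\varphi+q(W)\,\partial_x\varphi\bigr)\,dx\,dt+\int_{\mathbb R}\eta(W(x,0))\,\varphi(x,0)\,dx\ge0.$$ -/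

import Mathlib

open Set Filter Topology MeasureTheory

namespace PartialRiemann

/-- The space `ℝ^m` of states. -/
abbrev State (m : ℕ) := EuclideanSpace ℝ (Fin m)

/-- A strictly hyperbolic system of conservation laws `∂ₜ W + ∂ₓ F(W) = 0` in one space dimension,
with states in an open convex cone `Ω ⊆ ℝ^m`: the Jacobian `dF(W)` has the `m` distinct real
eigenvalues `lam 0 W < lam 1 W < ⋯`, with a continuous choice `R j W` of eigenvectors
(fields are numbered from `0`). -/
structure HyperbolicSystem (m : ℕ) where
  Ω : Set (State m)
  F : State m → State m
  lam : Fin m → State m → ℝ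
  R : Fin m → State m → State m
  isOpen : IsOpen Ω
  convex : Convex ℝ Ω
  cone : ∀ W ∈ Ω, ∀ c : ℝ, 0 < c → c • W ∈ Ω
  flux_smooth : ContDiffOn ℝ 2 F Ω
  lam_strictMono : ∀ W ∈ Ω, StrictMono fun j => lam j W
  R_ne_zero : ∀ j, ∀ W ∈ Ω, R j W ≠ 0
  eigen : ∀ j, ∀ W ∈ Ω, fderiv ℝ F W (R j W) = lam j W • R j W
  R_continuous : ∀ j, ContinuousOn (R j) Ω

namespace HyperbolicSystem

variable {m : ℕ} (S : HyperbolicSystem m)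

/-- The `j`-th field is genuinely nonlinear (with the usual normalization of `R j`). -/
def GenuinelyNonlinear (j : Fin m) : Prop :=
  ∀ W ∈ S.Ω, fderiv ℝ (S.lam j) W (S.R j W) = 1

/-- The `j`-th field is linearly degenerate. -/
def LinearlyDegenerate (j : Fin m) : Prop :=
  ∀ W ∈ S.Ω, fderiv ℝ (S.lam j) W (S.R j W) = 0

/-- Rankine–Hugoniot relation for a discontinuity of speed `s` between `u` (left) and
`v` (right). -/
def RankineHugoniot (u v : State m) (s : ℝ) : Prop :=
  S.F v - S.F u = s • (v - u)

/-- A `j`-shock of speed `s` from `u` (left) to `v` (right), admissible in the sense of Lax. -/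
structure IsLaxShock (j : Fin m) (u v : State m) (s : ℝ) : Prop where
  jump : S.RankineHugoniot u v s
  right_lt : S.lam j v < s
  lt_left : s < S.lam j u
  lower_lt : ∀ i, i < j → S.lam i u < s
  lt_upper : ∀ i, j < i → s < S.lam i v

/-- A `j`-contact discontinuity from `u` (left) to `v` (right): it moves with the common
characteristic speed of both sides. -/
structure IsContact (j : Fin m) (u v : State m) : Prop where
  jump : S.RankineHugoniot u v (S.lam j u)
  speed_eq : S.lam j v = S.lam j u

/-- `χ ε W` is the `j`-wave curve issued from `W`, for `W ∈ V` and `|ε| < δ`; `s ε W` is the speed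
of the shock between `W` and `χ ε W` (used only when the field is genuinely nonlinear
and `ε < 0`). -/
structure IsWaveCurve (j : Fin m) (V : Set (State m)) (δ : ℝ)
    (χ : ℝ → State m → State m) (s : ℝ → State m → ℝ) : Prop where
  mem : ∀ W ∈ V, ∀ ε ∈ Ioo (-δ) δ, χ ε W ∈ S.Ω
  zero : ∀ W ∈ V, χ 0 W = W
  regular : ∀ W ∈ V, ContDiffOn ℝ 1 (fun ε => χ ε W) (Ioo (-δ) δ)
  tangent : ∀ W ∈ V, HasDerivAt (fun ε => χ ε W) (S.R j W) 0
  rarefaction : S.GenuinelyNonlinear j → ∀ W ∈ V, ∀ ε ∈ Ioo 0 δ,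
    HasDerivAt (fun e => χ e W) (S.R j (χ ε W)) ε
  shock : S.GenuinelyNonlinear j → ∀ W ∈ V, ∀ ε ∈ Ioo (-δ) 0,
    S.IsLaxShock j W (χ ε W) (s ε W)
  contact_curve : S.LinearlyDegenerate j → ∀ W ∈ V, ∀ ε ∈ Ioo (-δ) δ,
    HasDerivAt (fun e => χ e W) (S.R j (χ ε W)) ε
  contact : S.LinearlyDegenerate j → ∀ W ∈ V, ∀ ε ∈ Ioo (-δ) δ,
    S.IsContact j W (χ ε W)

open Classical in
/-- Smallest speed of the `j`-wave of parameter `ε` issued from the left state `u`, where `c` is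
the speed of the corresponding shock. -/
noncomputable def speedMin (j : Fin m) (ε c : ℝ) (u : State m) : ℝ :=
  if S.GenuinelyNonlinear j ∧ ε < 0 then c else S.lam j u

open Classical in
/-- Largest speed of the `j`-wave of parameter `ε` with right state `v`, where `c` is the speed
of the corresponding shock. For a contact discontinuity `lam j` takes the same value on
both sides. -/
noncomputable def speedMax (j : Fin m) (ε c : ℝ) (v : State m) : ℝ :=
  if S.GenuinelyNonlinear j ∧ ε < 0 then c else S.lam j v

/-- The self-similar profile `U` is the superposition of `p` waves of speeds in
`[μmin j, μmax j]`, ordered from left to right and separating the `p + 1` states `w`: outside the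
waves `U` is equal to one of the states, and inside the `j`-th wave (nonempty only for a
rarefaction) it follows the wave curve `χ j`. -/
structure IsSuperposition {p : ℕ} (χ : Fin p → ℝ → State m → State m) (w : Fin (p + 1) → State m)
    (μmin μmax : Fin p → ℝ) (U : ℝ → State m) : Prop where
  le : ∀ j, μmin j ≤ μmax j
  lt : ∀ i j, i < j → μmax i < μmin j
  const : ∀ (i : Fin (p + 1)) (ξ : ℝ), (∀ j : Fin p, j.val < i.val → μmax j < ξ) →
    (∀ j : Fin p, i.val ≤ j.val → ξ < μmin j) → U ξ = w i
  fan : ∀ (j : Fin p), ∀ ξ ∈ Ioo (μmin j) (μmax j), U ξ = χ j (ξ - μmin j) (w j.castSucc)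

/-- A convex entropy `η` of class `C¹` on `Ω` together with its entropy flux `q`. -/
structure IsEntropyPair (η q : State m → ℝ) : Prop where
  entropy_smooth : ContDiffOn ℝ 1 η S.Ω
  flux_smooth : ContDiffOn ℝ 1 q S.Ω
  convex : ConvexOn ℝ S.Ω η
  compat : ∀ W ∈ S.Ω, fderiv ℝ q W = (fderiv ℝ η W).comp (fderiv ℝ S.F W)

/-- `W x t`, for `x ∈ ℝ` and `t ≥ 0`, is a bounded weak entropy solution of the Cauchy problem
for `∂ₜ W + ∂ₓ F(W) = 0` with initial datum `W · 0`: the conservation law, and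
`∂ₜ η(W) + ∂ₓ q(W) ≤ 0` for every convex entropy pair, hold in the sense of distributions, with
the initial datum included. A point `z` of the space-time plane is `(x, t)`. -/
structure IsEntropySolution (W : ℝ → ℝ → State m) : Prop where
  measurable : Measurable fun z : ℝ × ℝ => W z.1 z.2
  bounded : ∃ K : Set (State m), IsCompact K ∧ K ⊆ S.Ω ∧ ∀ x t, 0 ≤ t → W x t ∈ K
  weak : ∀ φ : ℝ × ℝ → ℝ, ContDiff ℝ 1 φ → HasCompactSupport φ →
    (∫ z in {z : ℝ × ℝ | 0 < z.2},
        (fderiv ℝ φ z (0, 1) • W z.1 z.2 + fderiv ℝ φ z (1, 0) • S.F (W z.1 z.2)))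
      + ∫ x, φ (x, 0) • W x 0 = 0
  entropy : ∀ η q : State m → ℝ, S.IsEntropyPair η q →
    ∀ φ : ℝ × ℝ → ℝ, ContDiff ℝ 1 φ → HasCompactSupport φ → (∀ z, 0 ≤ φ z) →
    0 ≤ (∫ z in {z : ℝ × ℝ | 0 < z.2},
        (fderiv ℝ φ z (0, 1) * η (W z.1 z.2) + fderiv ℝ φ z (1, 0) * q (W z.1 z.2)))
      + ∫ x, φ (x, 0) * η (W x 0)

/-- `W` is an entropy solution of the partial Riemann problem between the state `Wl` and the
set `M` of states. -/
structure SolvesPartialRiemann (Wl : State m) (M : Set (State m)) (W : ℝ → ℝ → State m) :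
    Prop where
  entropySolution : S.IsEntropySolution W
  left : ∀ x, x < 0 → W x 0 = Wl
  right : ∀ x, 0 < x → W x 0 ∈ M

end HyperbolicSystem

/-- The local manifold of codimension `p` on which the first `p` components of the chart `Φ`
vanish. -/
def boundaryManifold {m : ℕ} (Φ : OpenPartialHomeomorph (State m) (State m)) (p : ℕ) :
    Set (State m) :=
  {X | X ∈ Φ.source ∧ ∀ i : Fin m, i.val < p → Φ X i = 0}

end PartialRiemann

/-! Wave curves. Dividing the Rankine–Hugoniot relation F(W + e v) - F(W) = c e v by e leaves
`fluxQuotient` = c v, an equation that is C¹ up to e = 0, where it becomes the eigenvalue equation.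
Because the eigenvalue is simple, the implicit function theorem solves it for (v, c) as C¹ functions
of (e, W) (`exists_jump_curve`). At e = 0 this recovers the eigenvalue and the eigendirection, so
`lam j` and a rescaling of `R j` are C¹ although only continuity of `R j` is given. Differentiating
in e yields ∂c/∂e = (1/2) dλ·R at the base point. In a genuinely nonlinear field the shock speed
thus grows at rate about 1/2 while the characteristic speed of the right state grows at rate about
1; for e < 0 this gives the Lax inequalities, and with the convexity of η the entropy inequality
(`IsEntropyPair.shock_inequality`). Rarefactions and contacts follow integral curves of `R j`. All
of this is gathered in `exists_isWaveCurve`.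

Strengths. Following p curves from W with parameters t has derivative W + ∑ t j • R j W₀ at the base
point. Transversality makes the first p components of dΦ(W₀) surjective on the span of these R j,
and a strictly differentiable map with surjective derivative is open at the point
(`eventually_exists_successive_states`). The curves χ inherit from R only continuous control in W,
so the argument runs on reparametrized curves y, strictly differentiable at (0, W₀), and the
parameters are translated back by τ.

Weak solution. A jump of speed s contributes ∫ φ(s t, t) dt times s[g] - [f] (`hasAction_jump`), and
a fan is a continuum of infinitesimal jumps, each satisfying Rankine–Hugoniot (`hasAction_fan`). The
waves have strictly ordered speeds, so at each ξ at most one of them is unfinished; hence F, η and q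
of the profile are sums over the waves and the weak forms add up (`superposition_cases`,
`isEntropySolution_superposition`). -/

namespace PartialRiemann

/-! ### Differentiation under the integral sign. -/

section ParametricIntegral

variable {X E : Type*} [NormedAddCommGroup X] [NormedSpace ℝ X] [FiniteDimensional ℝ X]
  [NormedAddCommGroup E] [NormedSpace ℝ E]

theorem hasFDerivAt_intervalIntegral_of_contDiff {f : X → ℝ → E}
    (hf : ContDiff ℝ 1 (Function.uncurry f)) (a b : ℝ) (x₀ : X) :
    HasFDerivAt (fun x => ∫ t in a..b, f x t)
      (∫ t in a..b, (fderiv ℝ (Function.uncurry f) (x₀, t)).comp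
        (ContinuousLinearMap.inl ℝ X ℝ)) x₀ := by
  have hcont : Continuous fun z : X × ℝ => (fderiv ℝ (Function.uncurry f) z).comp
      (ContinuousLinearMap.inl ℝ X ℝ) :=
    (hf.continuous_fderiv one_ne_zero).clm_comp continuous_const
  have : ProperSpace X := FiniteDimensional.proper ℝ X
  obtain ⟨C, hC⟩ := ((isCompact_closedBall x₀ 1).prod (isCompact_uIcc (a := a) (b := b))).exists_bound_of_continuousOn
    hcont.continuousOn
  have hfc : Continuous (Function.uncurry f) := hf.continuous
  refine intervalIntegral.hasFDerivAt_integral_of_dominated_of_fderiv_le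
    (bound := fun _ => C) (s := Metric.closedBall x₀ 1)
    (F' := fun x t => (fderiv ℝ (Function.uncurry f) (x, t)).comp
        (ContinuousLinearMap.inl ℝ X ℝ))
    (Metric.closedBall_mem_nhds x₀ one_pos) ?_ ?_ ?_ ?_ ?_ ?_
  · refine Eventually.of_forall fun x => ?_
    exact (hfc.comp (Continuous.prodMk_right x)).aestronglyMeasurable
  · exact (hfc.comp (Continuous.prodMk_right x₀)).intervalIntegrable _ _
  · exact (hcont.comp (Continuous.prodMk_right x₀)).aestronglyMeasurable
  · refine Eventually.of_forall fun t ht x hx => hC (x, t) ⟨hx, uIoc_subset_uIcc ht⟩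
  · exact intervalIntegrable_const
  · refine Eventually.of_forall fun t _ x _ => ?_
    have h1 : HasFDerivAt (Function.uncurry f) _ (x, t) :=
      (hf.differentiable one_ne_zero (x, t)).hasFDerivAt
    exact HasFDerivAt.comp (g := Function.uncurry f) (f := fun e : X => (e, t)) x h1
      (hasFDerivAt_prodMk_left x t)

theorem contDiff_one_intervalIntegral {f : X → ℝ → E}
    (hf : ContDiff ℝ 1 (Function.uncurry f)) (a b : ℝ) :
    ContDiff ℝ 1 fun x => ∫ t in a..b, f x t := by
  have hcont : Continuous fun z : X × ℝ => (fderiv ℝ (Function.uncurry f) z).comp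
      (ContinuousLinearMap.inl ℝ X ℝ) :=
    (hf.continuous_fderiv one_ne_zero).clm_comp continuous_const
  have hd := hasFDerivAt_intervalIntegral_of_contDiff hf a b
  rw [contDiff_one_iff_fderiv]
  refine ⟨fun x => (hd x).differentiableAt, ?_⟩
  rw [funext fun x => (hd x).fderiv]
  exact intervalIntegral.continuous_parametric_intervalIntegral_of_continuous'
    (f := fun x t => (fderiv ℝ (Function.uncurry f) (x, t)).comp
      (ContinuousLinearMap.inl ℝ X ℝ)) hcont a b

end ParametricIntegral

/-! ### The averaged Jacobian of the flux. -/

section AveragedJacobian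

variable {E : Type*} [NormedAddCommGroup E] [NormedSpace ℝ E]

/-- The difference quotient `(F (W + e v) - F W) / e`, extended to `e = 0` by `dF(W) v`, as a
function of `((e, W), v)`. -/
noncomputable def fluxQuotient (F : E → E) (z : (ℝ × E) × E) : E :=
  ∫ t in (0 : ℝ)..1, fderiv ℝ F (z.1.2 + (t * z.1.1) • z.2) z.2

/-- One order of smoothness is lost, since the integrand contains the Jacobian; this is why the flux
has to be C². -/
theorem contDiff_fluxQuotient [FiniteDimensional ℝ E] {F : E → E} (hF : ContDiff ℝ 2 F) :
    ContDiff ℝ 1 (fluxQuotient F) := by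
  have h1 : ContDiff ℝ 1 (fderiv ℝ F) := hF.fderiv_right (by norm_num)
  refine contDiff_one_intervalIntegral (f := fun (z : (ℝ × E) × E) (t : ℝ) =>
    fderiv ℝ F (z.1.2 + (t * z.1.1) • z.2) z.2) ?_ 0 1
  unfold Function.uncurry
  fun_prop

theorem fluxQuotient_zero (F : E → E) [CompleteSpace E] (W v : E) :
    fluxQuotient F ((0, W), v) = fderiv ℝ F W v := by
  simp [fluxQuotient]

theorem smul_fluxQuotient [CompleteSpace E] {F : E → E} (hF : ContDiff ℝ 2 F) (e : ℝ) (W v : E) :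
    e • fluxQuotient F ((e, W), v) = F (W + e • v) - F W := by
  have hd : ∀ t ∈ uIcc (0 : ℝ) 1, HasDerivAt (fun t : ℝ => F (W + (t * e) • v))
      (e • fderiv ℝ F (W + (t * e) • v) v) t := by
    intro t _
    have h1 : HasDerivAt (fun t : ℝ => W + (t * e) • v) (e • v) t := by
      simpa using (((hasDerivAt_id t).mul_const e).smul_const v).const_add W
    exact (((hF.differentiable (by norm_num)) (W + (t * e) • v)).hasFDerivAt.comp_hasDerivAt t
      h1).congr_deriv (by simp)
  have hc : Continuous fun t : ℝ => e • fderiv ℝ F (W + (t * e) • v) v := by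
    have := hF.continuous_fderiv (by norm_num)
    fun_prop
  have := intervalIntegral.integral_eq_sub_of_hasDerivAt hd (hc.intervalIntegrable _ _)
  simp only [one_mul, zero_mul, zero_smul, add_zero] at this
  rw [← this, fluxQuotient, intervalIntegral.integral_smul]

/-- The factor 1/2 is ∫₀¹ t dt: the integrand is h(t e), whose derivative in e at 0 is t h'(0). It
becomes the ratio between the growth of the shock speed and that of the characteristic speed. -/
theorem hasDerivAt_fluxQuotient_zero [FiniteDimensional ℝ E] {F : E → E} (hF : ContDiff ℝ 2 F)
    (W v : E) :
    HasDerivAt (fun e : ℝ => fluxQuotient F ((e, W), v))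
      ((1 / 2 : ℝ) • deriv (fun s : ℝ => fderiv ℝ F (W + s • v) v) 0) 0 := by
  have h1 : ContDiff ℝ 1 (fderiv ℝ F) := hF.fderiv_right (by norm_num)
  set h : ℝ → E := fun s => fderiv ℝ F (W + s • v) v with hh
  have hh1 : ContDiff ℝ 1 h := by fun_prop
  have hu : ContDiff ℝ 1 (Function.uncurry fun (e t : ℝ) => h (t * e)) := by
    unfold Function.uncurry
    fun_prop
  have key := hasFDerivAt_intervalIntegral_of_contDiff hu 0 1 0
  have key2 := key.hasDerivAt
  refine key2.congr_deriv ?_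
  have : CompleteSpace E := FiniteDimensional.complete ℝ E
  rw [ContinuousLinearMap.intervalIntegral_apply]
  · have hval : ∀ t : ℝ, ((fderiv ℝ (Function.uncurry fun (e t : ℝ) => h (t * e)) (0, t)).comp
        (ContinuousLinearMap.inl ℝ ℝ ℝ)) 1 = t • deriv h 0 := by
      intro t
      have hd1 : HasFDerivAt (Function.uncurry fun (e t : ℝ) => h (t * e)) _ (0, t) :=
        (hu.differentiable one_ne_zero (0, t)).hasFDerivAt
      have hd2 := (HasFDerivAt.comp (g := Function.uncurry fun (e t : ℝ) => h (t * e))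
        (f := fun e : ℝ => (e, t)) (0 : ℝ) hd1 (hasFDerivAt_prodMk_left (0 : ℝ) t)).hasDerivAt
      have hd3 : HasDerivAt (fun e : ℝ => h (t * e)) (t • deriv h 0) 0 := by
        have h4 : HasDerivAt h (deriv h 0) (t * 0) := by
          rw [mul_zero]; exact (hh1.differentiable one_ne_zero 0).hasDerivAt
        exact (h4.scomp (0 : ℝ) ((hasDerivAt_id (0 : ℝ)).const_mul t)).congr_deriv (by simp)
      exact hd2.unique hd3
    simp_rw [hval]
    rw [intervalIntegral.integral_smul_const]
    simp
  · refine Continuous.intervalIntegrable ?_ _ _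
    have := hu.continuous_fderiv one_ne_zero
    fun_prop

end AveragedJacobian

end PartialRiemann

namespace PartialRiemann

/-! ### Discontinuities bifurcating from a simple eigenvalue. -/

section SimpleEigenvalue

variable {E : Type*} [NormedAddCommGroup E] [NormedSpace ℝ E]

/-- `lam` is a simple eigenvalue of `L`, with eigenvector `r` and left eigenvector `l`,
normalized by `l r = 1`. -/
structure IsSimpleEigen (L : E →L[ℝ] E) (lam : ℝ) (r : E) (l : E →L[ℝ] ℝ) : Prop where
  eigen : L r = lam • r
  left_eigen : ∀ x, l (L x) = lam * l x
  norm : l r = 1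
  simple : ∀ x, L x = lam • x → l x = 0 → x = 0

/-- The equation satisfied by the direction `v` and the speed `c` of a discontinuity between
`W` and `W + e v`. -/
noncomputable def jumpEquation (F : E → E) (l : E →L[ℝ] ℝ) (z : (ℝ × E) × (E × ℝ)) : E × ℝ :=
  (fluxQuotient F (z.1, z.2.1) - z.2.2 • z.2.1, l z.2.1)

variable [FiniteDimensional ℝ E]

theorem contDiff_jumpEquation {F : E → E} (hF : ContDiff ℝ 2 F) (l : E →L[ℝ] ℝ) :
    ContDiff ℝ 1 (jumpEquation F l) := by
  have := contDiff_fluxQuotient hF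
  unfold jumpEquation
  fun_prop

/-- The partial derivative is (x, k) ↦ (dF x - λ x - k r, l x). On its kernel, l applied to the
first component gives k = 0; then x is an eigenvector with l x = 0, which simplicity excludes unless
x = 0. In finite dimension injectivity is enough. -/
theorem isInvertible_fderiv_jumpEquation {F : E → E} (hF : ContDiff ℝ 2 F) {W₀ r : E} {lam : ℝ}
    {l : E →L[ℝ] ℝ} (h : IsSimpleEigen (fderiv ℝ F W₀) lam r l) :
    (fderiv ℝ (jumpEquation F l) ((0, W₀), (r, lam)) ∘L .inr ℝ (ℝ × E) (E × ℝ)).IsInvertible := by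
  have : CompleteSpace E := FiniteDimensional.complete ℝ E
  set T := fderiv ℝ (jumpEquation F l) ((0, W₀), (r, lam)) ∘L .inr ℝ (ℝ × E) (E × ℝ) with hT
  have h1 : HasFDerivAt (jumpEquation F l) _ ((0, W₀), (r, lam)) :=
    ((contDiff_jumpEquation hF l).differentiable one_ne_zero _).hasFDerivAt
  have h2 : HasFDerivAt (fun u : E × ℝ => jumpEquation F l ((0, W₀), u)) T (r, lam) :=
    HasFDerivAt.comp (g := jumpEquation F l) (f := fun u : E × ℝ => (((0, W₀) : ℝ × E), u)) _ h1
      (hasFDerivAt_prodMk_right _ _)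
  have h3 : HasFDerivAt (fun u : E × ℝ => jumpEquation F l ((0, W₀), u))
      (((fderiv ℝ F W₀ ∘L .fst ℝ E ℝ) - (lam • ContinuousLinearMap.fst ℝ E ℝ +
        (ContinuousLinearMap.snd ℝ E ℝ).smulRight r)).prod (l ∘L .fst ℝ E ℝ)) (r, lam) := by
    simp only [jumpEquation, fluxQuotient_zero]
    refine HasFDerivAt.prodMk (HasFDerivAt.sub ?_ ?_) ?_
    · exact ((fderiv ℝ F W₀) ∘L .fst ℝ E ℝ).hasFDerivAt
    · exact (hasFDerivAt_snd (𝕜 := ℝ) (p := (r, lam))).fun_smul (hasFDerivAt_fst (𝕜 := ℝ))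
    · exact (l ∘L .fst ℝ E ℝ).hasFDerivAt
  have hTapp : ∀ u : E × ℝ, T u = (fderiv ℝ F W₀ u.1 - (lam • u.1 + u.2 • r), l u.1) := by
    intro u
    rw [h2.unique h3]
    simp
  have hinj : Function.Injective T := by
    rw [injective_iff_map_eq_zero]
    rintro ⟨x, c⟩ hx
    rw [hTapp] at hx
    simp only [Prod.mk_eq_zero] at hx
    obtain ⟨hx1, hx2⟩ := hx
    have hc : c = 0 := by
      have := congrArg l hx1
      simpa [h.left_eigen, h.norm, hx2] using this
    subst hc
    have hx0 : x = 0 := h.simple x (by simpa [sub_eq_zero] using hx1) hx2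
    simp [hx0]
  have hker : LinearMap.ker (T : (E × ℝ) →ₗ[ℝ] (E × ℝ)) = ⊥ :=
    LinearMap.ker_eq_bot.mpr hinj
  have hsurj : Function.Surjective T :=
    LinearMap.surjective_of_injective (f := (T : (E × ℝ) →ₗ[ℝ] (E × ℝ))) hinj
  exact ⟨ContinuousLinearEquiv.ofBijective T hker (LinearMap.range_eq_top.mpr hsurj), by
    ext <;> rfl⟩

/-- The direction `v` and the speed `c` of the discontinuities of small strength `e` with left
state `W` near `W₀`, as functions of `(e, W)`. -/
theorem exists_jump_curve {F : E → E} (hF : ContDiff ℝ 2 F) {W₀ r : E} {lam : ℝ}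
    {l : E →L[ℝ] ℝ} (h : IsSimpleEigen (fderiv ℝ F W₀) lam r l) :
    ∃ (v : ℝ × E → E) (c : ℝ × E → ℝ), ContDiffAt ℝ 1 v (0, W₀) ∧ ContDiffAt ℝ 1 c (0, W₀) ∧
      v (0, W₀) = r ∧ c (0, W₀) = lam ∧
      (∀ᶠ z in 𝓝 ((0, W₀) : ℝ × E), F (z.2 + z.1 • v z) - F z.2 = (c z) • (z.1 • v z)) ∧
      (∀ᶠ W in 𝓝 W₀, fderiv ℝ F W (v (0, W)) = c (0, W) • v (0, W)) ∧
      (∀ᶠ u in 𝓝 ((W₀, (r, lam)) : E × (E × ℝ)), fderiv ℝ F u.1 u.2.1 = u.2.2 • u.2.1 →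
        l u.2.1 = 1 → v (0, u.1) = u.2.1 ∧ c (0, u.1) = u.2.2) ∧
      fderiv ℝ c (0, W₀) (1, 0) = 1 / 2 * fderiv ℝ (fun W => c (0, W)) W₀ r := by
  have : CompleteSpace E := FiniteDimensional.complete ℝ E
  have hinv := isInvertible_fderiv_jumpEquation hF h
  have hC : ContDiffAt ℝ 1 (jumpEquation F l) ((0, W₀), (r, lam)) :=
    (contDiff_jumpEquation hF l).contDiffAt
  have hbase : jumpEquation F l ((0, W₀), (r, lam)) = (0, 1) := by
    simp [jumpEquation, fluxQuotient_zero, h.eigen, h.norm]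
  set ψ := hC.implicitFunction one_ne_zero hinv with hψ
  have hψC : ContDiffAt ℝ 1 ψ (0, W₀) := hC.contDiffAt_implicitFunction one_ne_zero hinv
  have hψ0 : ψ (0, W₀) = (r, lam) := hC.implicitFunction_apply_self one_ne_zero hinv
  have hψeq := hC.eventually_apply_implicitFunction one_ne_zero hinv
  have hψuniq := hC.eventually_apply_eq_iff_implicitFunction one_ne_zero hinv
  rw [hbase] at hψeq hψuniq
  rw [← hψ] at hψeq hψuniq
  simp only at hψeq
  have hslice : Tendsto (fun W : E => ((0 : ℝ), W)) (𝓝 W₀) (𝓝 (0, W₀)) :=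
    (Continuous.prodMk_right (0 : ℝ)).tendsto W₀
  have heq : ∀ᶠ z in 𝓝 ((0, W₀) : ℝ × E),
      fluxQuotient F (z, (ψ z).1) = (ψ z).2 • (ψ z).1 ∧ l (ψ z).1 = 1 := by
    filter_upwards [hψeq] with z hz
    simpa [jumpEquation, Prod.ext_iff, sub_eq_zero] using hz
  have heigen : ∀ᶠ W in 𝓝 W₀, fderiv ℝ F W (ψ (0, W)).1 = (ψ (0, W)).2 • (ψ (0, W)).1 := by
    filter_upwards [hslice.eventually heq] with W hW
    simpa [fluxQuotient_zero] using hW.1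
  refine ⟨fun z => (ψ z).1, fun z => (ψ z).2, hψC.fst, hψC.snd, by simp [hψ0], by simp [hψ0],
    ?_, heigen, ?_, ?_⟩
  · filter_upwards [heq] with z hz
    rw [← smul_fluxQuotient hF, Prod.mk.eta, hz.1, smul_comm]
  -- Uniqueness in the implicit function theorem: at e = 0 a normalized eigenpair solves the jump
  -- equation, so it lies on the branch ψ.
  · have ht : Tendsto (fun u : E × (E × ℝ) => (((0 : ℝ), u.1), u.2)) (𝓝 (W₀, (r, lam)))
        (𝓝 (((0 : ℝ), W₀), (r, lam))) := by
      apply Continuous.tendsto'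
      · fun_prop
      · rfl
    filter_upwards [ht.eventually hψuniq] with u hu h1 h2
    have := hu.1 (by simp [jumpEquation, fluxQuotient_zero, h1, h2])
    simp [this]
  · have hψd : DifferentiableAt ℝ ψ (0, W₀) := hψC.differentiableAt one_ne_zero
    -- derivative along `e`
    have hA : HasDerivAt (fun e : ℝ => ψ (e, W₀)) (fderiv ℝ ψ (0, W₀) (1, 0)) 0 := by
      exact HasFDerivAt.comp_hasDerivAt (l := ψ) (f := fun e : ℝ => (e, W₀)) 0 hψd.hasFDerivAt
        ((hasDerivAt_id (0 : ℝ)).prodMk (hasDerivAt_const _ _))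
    have hB : HasDerivAt (fun s : ℝ => ψ (0, W₀ + s • r)) (fderiv ℝ ψ (0, W₀) (0, r)) 0 := by
      refine HasFDerivAt.comp_hasDerivAt (l := ψ) (f := fun s : ℝ => ((0 : ℝ), W₀ + s • r)) 0 ?_ ?_
      · simpa using hψd.hasFDerivAt
      · refine (hasDerivAt_const _ _).prodMk ?_
        simpa using ((hasDerivAt_id (0 : ℝ)).smul_const r).const_add W₀
    set a := fderiv ℝ ψ (0, W₀) (1, 0) with ha
    set b := fderiv ℝ ψ (0, W₀) (0, r) with hb
    have hA1 : HasDerivAt (fun e : ℝ => (ψ (e, W₀)).1) a.1 0 :=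
      (ContinuousLinearMap.fst ℝ E ℝ).hasFDerivAt.comp_hasDerivAt (0 : ℝ) hA
    have hA2 : HasDerivAt (fun e : ℝ => (ψ (e, W₀)).2) a.2 0 :=
      (ContinuousLinearMap.snd ℝ E ℝ).hasFDerivAt.comp_hasDerivAt (0 : ℝ) hA
    have hB1 : HasDerivAt (fun s : ℝ => (ψ (0, W₀ + s • r)).1) b.1 0 :=
      (ContinuousLinearMap.fst ℝ E ℝ).hasFDerivAt.comp_hasDerivAt (0 : ℝ) hB
    have hB2 : HasDerivAt (fun s : ℝ => (ψ (0, W₀ + s • r)).2) b.2 0 :=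
      (ContinuousLinearMap.snd ℝ E ℝ).hasFDerivAt.comp_hasDerivAt (0 : ℝ) hB
    set D := deriv (fun s : ℝ => fderiv ℝ F (W₀ + s • r) r) 0 with hD
    have hdF : ContDiff ℝ 1 (fderiv ℝ F) := hF.fderiv_right (by norm_num)
    -- differentiate the eigenvalue equation along `r`
    have hEq2 : b.2 = l D := by
      have e1 : HasDerivAt (fun s : ℝ => fderiv ℝ F (W₀ + s • r) r) D 0 := by
        refine DifferentiableAt.hasDerivAt ?_
        have : Differentiable ℝ (fderiv ℝ F) := hdF.differentiable one_ne_zero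
        fun_prop
      have e2 : HasDerivAt (fun s : ℝ => fderiv ℝ F (W₀ + s • r) (ψ (0, W₀ + s • r)).1)
          (D + fderiv ℝ F W₀ b.1) 0 := by
        have c1 : HasDerivAt (fun s : ℝ => fderiv ℝ F (W₀ + s • r))
            (fderiv ℝ (fderiv ℝ F) W₀ r) 0 := by
          refine HasFDerivAt.comp_hasDerivAt (l := fderiv ℝ F) (f := fun s : ℝ => W₀ + s • r)
            0 ?_ ?_
          · simpa using (hdF.differentiable one_ne_zero W₀).hasFDerivAt
          · simpa using ((hasDerivAt_id (0 : ℝ)).smul_const r).const_add W₀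
        have c2 := c1.clm_apply (hasDerivAt_const (0 : ℝ) r)
        have c3 : D = fderiv ℝ (fderiv ℝ F) W₀ r r := by
          simpa using e1.unique c2
        have c4 := c1.clm_apply hB1
        simpa [c3, hψ0] using c4
      have e3 : HasDerivAt (fun s : ℝ => (ψ (0, W₀ + s • r)).2 • (ψ (0, W₀ + s • r)).1)
          (lam • b.1 + b.2 • r) 0 := by
        simpa [hψ0] using hB2.fun_smul hB1
      have e4 : (fun s : ℝ => fderiv ℝ F (W₀ + s • r) (ψ (0, W₀ + s • r)).1) =ᶠ[𝓝 0]
          fun s : ℝ => (ψ (0, W₀ + s • r)).2 • (ψ (0, W₀ + s • r)).1 := by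
        have ht : Tendsto (fun s : ℝ => W₀ + s • r) (𝓝 0) (𝓝 W₀) := by
          apply Continuous.tendsto'
          · fun_prop
          · simp
        exact ht.eventually heigen
      -- The left eigenvector eliminates the unknown derivative of the direction, because l (dF b.1)
      -- = λ l b.1.
      have e5 := congrArg l (e2.unique (e3.congr_of_eventuallyEq e4))
      simp only [map_add, map_smul, h.left_eigen, h.norm, smul_eq_mul, mul_one] at e5
      linarith
    -- differentiate the jump equation along `e`
    have hEq1 : a.2 = 1 / 2 * l D := by
      have hq : DifferentiableAt ℝ (fluxQuotient F) ((0, W₀), r) :=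
        (contDiff_fluxQuotient hF).differentiable one_ne_zero _
      have e1 := hasDerivAt_fluxQuotient_zero hF W₀ r
      have p1 : HasDerivAt (fun e : ℝ => fluxQuotient F ((e, W₀), r))
          (fderiv ℝ (fluxQuotient F) ((0, W₀), r) ((1, 0), 0)) 0 := by
        exact HasFDerivAt.comp_hasDerivAt (l := fluxQuotient F)
          (f := fun e : ℝ => ((e, W₀), r)) 0 hq.hasFDerivAt
          (((hasDerivAt_id (0 : ℝ)).prodMk (hasDerivAt_const _ _)).prodMk (hasDerivAt_const _ _))
      have p2 : fderiv ℝ (fluxQuotient F) ((0, W₀), r) (0, a.1) = fderiv ℝ F W₀ a.1 := by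
        have q1 : HasFDerivAt (fun x : E => fluxQuotient F ((0, W₀), x))
            (fderiv ℝ (fluxQuotient F) ((0, W₀), r) ∘L .inr ℝ (ℝ × E) E) r :=
          HasFDerivAt.comp (g := fluxQuotient F) (f := fun x : E => (((0, W₀) : ℝ × E), x)) _
            hq.hasFDerivAt (hasFDerivAt_prodMk_right _ _)
        have q2 : HasFDerivAt (fun x : E => fluxQuotient F ((0, W₀), x)) (fderiv ℝ F W₀) r := by
          simp only [fluxQuotient_zero]
          exact (fderiv ℝ F W₀).hasFDerivAt
        simpa using congrArg (fun T : E →L[ℝ] E => T a.1) (q1.unique q2)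
      have e2 : HasDerivAt (fun e : ℝ => fluxQuotient F ((e, W₀), (ψ (e, W₀)).1))
          ((1 / 2 : ℝ) • D + fderiv ℝ F W₀ a.1) 0 := by
        have c1 : HasDerivAt (fun e : ℝ => fluxQuotient F ((e, W₀), (ψ (e, W₀)).1))
            (fderiv ℝ (fluxQuotient F) ((0, W₀), r) ((1, 0), a.1)) 0 := by
          refine HasFDerivAt.comp_hasDerivAt (l := fluxQuotient F)
            (f := fun e : ℝ => ((e, W₀), (ψ (e, W₀)).1)) 0 ?_
            (((hasDerivAt_id (0 : ℝ)).prodMk (hasDerivAt_const _ _)).prodMk hA1)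
          simpa [hψ0] using hq.hasFDerivAt
        refine c1.congr_deriv ?_
        rw [e1.unique p1, ← p2, ← map_add]
        simp
      have e3 : HasDerivAt (fun e : ℝ => (ψ (e, W₀)).2 • (ψ (e, W₀)).1)
          (lam • a.1 + a.2 • r) 0 := by
        simpa [hψ0] using hA2.fun_smul hA1
      have e4 : (fun e : ℝ => fluxQuotient F ((e, W₀), (ψ (e, W₀)).1)) =ᶠ[𝓝 0]
          fun e : ℝ => (ψ (e, W₀)).2 • (ψ (e, W₀)).1 := by
        have ht : Tendsto (fun e : ℝ => (e, W₀)) (𝓝 0) (𝓝 (0, W₀)) :=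
          (Continuous.prodMk_left W₀).tendsto 0
        filter_upwards [ht.eventually heq] with e he using he.1
      have e5 := congrArg l (e2.unique (e3.congr_of_eventuallyEq e4))
      simp only [map_add, map_smul, h.left_eigen, h.norm, smul_eq_mul, mul_one] at e5
      linarith
    have r1 : fderiv ℝ (fun z => (ψ z).2) (0, W₀) (1, 0) = a.2 := by
      rw [hψd.hasFDerivAt.snd.fderiv]; rfl
    have r2 : fderiv ℝ (fun W => (ψ (0, W)).2) W₀ r = b.2 := by
      have : HasFDerivAt (fun W => ψ (0, W)) (fderiv ℝ ψ (0, W₀) ∘L .inr ℝ ℝ E) W₀ :=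
        HasFDerivAt.comp (g := ψ) (f := fun W : E => ((0 : ℝ), W)) _
            hψd.hasFDerivAt (hasFDerivAt_prodMk_right _ _)
      rw [this.snd.fderiv]
      simp [hb]
    rw [r1, r2, hEq1, hEq2]

end SimpleEigenvalue

end PartialRiemann

/-! ### Regularity of the eigenvalues and jump curves of a hyperbolic system. -/

namespace PartialRiemann

/-- A function of class `C^n` near a point coincides near it with a globally `C^n` function. -/
theorem exists_contDiff_eventuallyEq {E G : Type*} [NormedAddCommGroup E] [InnerProductSpace ℝ E]
    [FiniteDimensional ℝ E] [NormedAddCommGroup G] [NormedSpace ℝ G] {n : ℕ∞} {f : E → G}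
    {s : Set E} {x : E} (hs : s ∈ 𝓝 x) (hf : ∀ y ∈ s, ContDiffAt ℝ n f y) :
    ∃ g : E → G, ContDiff ℝ n g ∧ g =ᶠ[𝓝 x] f := by
  obtain ⟨ρ, hρ, hball⟩ := Metric.nhds_basis_closedBall.mem_iff.1 hs
  let φ : ContDiffBump x := ⟨ρ / 2, ρ, half_pos hρ, half_lt_self hρ⟩
  refine ⟨fun y => φ y • f y, ?_, ?_⟩
  · refine contDiff_iff_contDiffAt.2 fun y => ?_
    by_cases hy : y ∈ tsupport φ
    · rw [φ.tsupport_eq] at hy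
      exact φ.contDiffAt.smul (hf y (hball hy))
    · refine (contDiffAt_const (c := (0 : G))).congr_of_eventuallyEq ?_
      filter_upwards [notMem_tsupport_iff_eventuallyEq.1 hy] with z hz
      simp [hz]
  · filter_upwards [φ.eventuallyEq_one] with y hy
    simp [hy]

namespace HyperbolicSystem

variable {m : ℕ} (S : HyperbolicSystem m)

theorem continuousOn_fderiv_F : ContinuousOn (fderiv ℝ S.F) S.Ω :=
  S.flux_smooth.continuousOn_fderiv_of_isOpen S.isOpen (by norm_num)

theorem hasFDerivAt_F {W : State m} (hW : W ∈ S.Ω) : HasFDerivAt S.F (fderiv ℝ S.F W) W :=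
  ((S.flux_smooth.contDiffAt (S.isOpen.mem_nhds hW)).differentiableAt (by norm_num)).hasFDerivAt

/-- The eigenvalue is the Rayleigh quotient of its eigenvector, and `R j` and dF are continuous. -/
theorem continuousOn_lam (j : Fin m) : ContinuousOn (S.lam j) S.Ω := by
  have h : ∀ W ∈ S.Ω, S.lam j W =
      inner ℝ (S.R j W) (fderiv ℝ S.F W (S.R j W)) / inner ℝ (S.R j W) (S.R j W) := by
    intro W hW
    have : inner ℝ (S.R j W) (S.R j W) ≠ 0 := by
      simpa using S.R_ne_zero j W hW
    rw [S.eigen j W hW, inner_smul_right]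
    field_simp
  refine ContinuousOn.congr ?_ h
  refine ContinuousOn.div ?_ ?_ ?_
  · exact (S.R_continuous j).inner (S.continuousOn_fderiv_F.clm_apply (S.R_continuous j))
  · exact (S.R_continuous j).inner (S.R_continuous j)
  · intro W hW
    simpa using S.R_ne_zero j W hW

/-- The left eigenvector is the coordinate functional along `R j W` in the basis of eigenvectors;
distinctness of the eigenvalues gives simplicity. -/
theorem exists_isSimpleEigen (j : Fin m) {W : State m} (hW : W ∈ S.Ω) :
    ∃ l : State m →L[ℝ] ℝ, IsSimpleEigen (fderiv ℝ S.F W) (S.lam j W) (S.R j W) l := by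
  have hli : LinearIndependent ℝ fun i => S.R i W :=
    Module.End.eigenvectors_linearIndependent' (fderiv ℝ S.F W : State m →ₗ[ℝ] State m)
      (fun i => S.lam i W) (S.lam_strictMono W hW).injective _ fun i =>
        Module.End.hasEigenvector_iff.2
          ⟨Module.End.mem_eigenspace_iff.2 (S.eigen i W hW), S.R_ne_zero i W hW⟩
  let b : Module.Basis (Fin m) ℝ (State m) := by
    classical
    exact
      if hm : Nonempty (Fin m) then
        basisOfLinearIndependentOfCardEqFinrank hli (by simp)
      else absurd ⟨j⟩ hm
  have hb : ∀ i, b i = S.R i W := by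
    intro i
    have hm : Nonempty (Fin m) := ⟨j⟩
    simp [b, hm]
  have hcoord : ∀ i x, b.coord i (fderiv ℝ S.F W x) = S.lam i W * b.coord i x := by
    intro i
    have : (b.coord i) ∘ₗ (fderiv ℝ S.F W : State m →ₗ[ℝ] State m) = S.lam i W • b.coord i := by
      refine b.ext fun k => ?_
      simp only [LinearMap.comp_apply, ContinuousLinearMap.coe_coe, LinearMap.smul_apply, hb,
        S.eigen k W hW, map_smul, smul_eq_mul]
      rw [← hb k]
      by_cases hik : k = i
      · rw [hik]
      · simp [Module.Basis.coord_apply, hik]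
    intro x
    exact congrArg (fun T : State m →ₗ[ℝ] ℝ => T x) this
  refine ⟨LinearMap.toContinuousLinearMap (b.coord j), S.eigen j W hW, fun x => hcoord j x, ?_, ?_⟩
  · rw [← hb]; simp
  · intro x hx hjx
    rw [← b.forall_coord_eq_zero_iff]
    intro i
    by_cases hij : i = j
    · rw [hij]; exact hjx
    · have h1 := hcoord i x
      rw [hx, map_smul, smul_eq_mul] at h1
      have h2 : S.lam j W - S.lam i W ≠ 0 :=
        sub_ne_zero.2 fun h => hij ((S.lam_strictMono W hW).injective h).symm
      have h3 : (S.lam j W - S.lam i W) * b.coord i x = 0 := by linarith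
      exact (mul_eq_zero.1 h3).resolve_left h2

/-- Discontinuities of the `j`-th family near `W₀`: the states `W` and `W + e v(e, W)` are
separated by a discontinuity of speed `c(e, W)`. -/
structure IsJumpCurve (j : Fin m) (W₀ : State m) (v : ℝ × State m → State m)
    (c : ℝ × State m → ℝ) (b : State m → ℝ) : Prop where
  smooth_v : ContDiffAt ℝ 1 v (0, W₀)
  smooth_c : ContDiffAt ℝ 1 c (0, W₀)
  v_base : v (0, W₀) = S.R j W₀
  b_base : b W₀ = 1
  b_cont : ContinuousOn b S.Ω
  direction : ∀ᶠ W in 𝓝 W₀, S.R j W = b W • v (0, W)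
  speed : ∀ᶠ W in 𝓝 W₀, c (0, W) = S.lam j W
  jump : ∀ᶠ z in 𝓝 ((0, W₀) : ℝ × State m),
    S.F (z.2 + z.1 • v z) - S.F z.2 = c z • (z.1 • v z)
  deriv_speed : fderiv ℝ c (0, W₀) (1, 0) = 1 / 2 * fderiv ℝ (S.lam j) W₀ (S.R j W₀)

/-- The vector R / l(R) is a normalized eigenvector close to `R j W₀`, so uniqueness of the implicit
function identifies it with the C¹ field v(0, ·). The factor b = l(R) remains merely continuous. -/
theorem exists_isJumpCurve (j : Fin m) {W₀ : State m} (hW₀ : W₀ ∈ S.Ω) :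
    ∃ v c b, S.IsJumpCurve j W₀ v c b := by
  -- A global C² flux makes the averaged Jacobian smooth everywhere; only its germ at W₀ matters.
  obtain ⟨G, hG, hGF⟩ := exists_contDiff_eventuallyEq (n := 2) (S.isOpen.mem_nhds hW₀)
    fun W hW => S.flux_smooth.contDiffAt (S.isOpen.mem_nhds hW)
  have hfd : fderiv ℝ G =ᶠ[𝓝 W₀] fderiv ℝ S.F := hGF.fderiv
  obtain ⟨l, hl⟩ := S.exists_isSimpleEigen j hW₀
  have hl' : IsSimpleEigen (fderiv ℝ G W₀) (S.lam j W₀) (S.R j W₀) l := by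
    rwa [hfd.eq_of_nhds]
  obtain ⟨v, c, hv, hc, hv0, hc0, hjump, heig, huniq, hder⟩ := exists_jump_curve hG hl'
  have hΩ : ∀ᶠ W in 𝓝 W₀, W ∈ S.Ω := S.isOpen.mem_nhds hW₀
  have hbc : ContinuousOn (fun W => l (S.R j W)) S.Ω :=
    l.continuous.comp_continuousOn (S.R_continuous j)
  have hb0 : ContinuousAt (fun W => l (S.R j W)) W₀ := hbc.continuousAt hΩ
  have hbne : ∀ᶠ W in 𝓝 W₀, l (S.R j W) ≠ 0 :=
    hb0.eventually_ne (by rw [hl.norm]; exact one_ne_zero)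
  have hRc : ContinuousAt (S.R j) W₀ := (S.R_continuous j).continuousAt hΩ
  have hlc : ContinuousAt (S.lam j) W₀ := (S.continuousOn_lam j).continuousAt hΩ
  have ht : Tendsto (fun W => (W, ((l (S.R j W))⁻¹ • S.R j W, S.lam j W))) (𝓝 W₀)
      (𝓝 (W₀, (S.R j W₀, S.lam j W₀))) := by
    have h1 : ContinuousAt (fun W => (l (S.R j W))⁻¹ • S.R j W) W₀ :=
      (hb0.inv₀ (by rw [hl.norm]; exact one_ne_zero)).smul hRc
    have h2 : Tendsto (fun W => (l (S.R j W))⁻¹ • S.R j W) (𝓝 W₀) (𝓝 (S.R j W₀)) := by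
      simpa [ContinuousAt, hl.norm] using h1
    exact tendsto_id.prodMk_nhds (h2.prodMk_nhds hlc)
  have hident : ∀ᶠ W in 𝓝 W₀, v (0, W) = (l (S.R j W))⁻¹ • S.R j W ∧ c (0, W) = S.lam j W := by
    filter_upwards [ht.eventually huniq, hΩ, hbne, hfd] with W hW hWΩ hne hf
    refine hW ?_ ?_
    · simp only [hf, map_smul, S.eigen j W hWΩ]
      rw [smul_comm]
    · simp [hne]
  have hspeed : ∀ᶠ W in 𝓝 W₀, c (0, W) = S.lam j W := hident.mono fun W h => h.2
  refine ⟨v, c, fun W => l (S.R j W), hv, hc, hv0, hl.norm, hbc, ?_, hspeed, ?_, ?_⟩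
  · filter_upwards [hident, hbne] with W hW hne
    rw [hW.1, smul_smul, mul_inv_cancel₀ hne, one_smul]
  · have t1 : Tendsto (fun z : ℝ × State m => z.2) (𝓝 (0, W₀)) (𝓝 W₀) := continuous_snd.tendsto _
    have t2 : Tendsto (fun z : ℝ × State m => z.2 + z.1 • v z) (𝓝 (0, W₀)) (𝓝 W₀) := by
      have : ContinuousAt (fun z : ℝ × State m => z.2 + z.1 • v z) (0, W₀) :=
        continuousAt_snd.add (continuousAt_fst.smul hv.continuousAt)
      simpa [ContinuousAt] using this
    filter_upwards [hjump, t1.eventually hGF, t2.eventually hGF] with z hz h1 h2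
    rw [← h1, ← h2, hz]
  · rw [hder]
    congr 2
    exact Filter.EventuallyEq.fderiv_eq hspeed

variable {S} in
theorem IsJumpCurve.contDiffAt_lam {j : Fin m} {W₀ : State m} {v : ℝ × State m → State m}
    {c : ℝ × State m → ℝ} {b : State m → ℝ} (h : S.IsJumpCurve j W₀ v c b) :
    ContDiffAt ℝ 1 (S.lam j) W₀ := by
  refine ContDiffAt.congr_of_eventuallyEq ?_ (h.speed.mono fun W hW => hW.symm)
  exact h.smooth_c.comp (f := fun W : State m => ((0 : ℝ), W)) W₀
    (contDiffAt_const.prodMk contDiffAt_id)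

/-- `HyperbolicSystem` does not postulate differentiable eigenvalues; the regularity is that of the
speed c(0, ·). It gives the `fderiv` in `GenuinelyNonlinear` and `LinearlyDegenerate` its usual
meaning. -/
theorem contDiffAt_lam (j : Fin m) {W : State m} (hW : W ∈ S.Ω) :
    ContDiffAt ℝ 1 (S.lam j) W := by
  obtain ⟨v, c, b, h⟩ := S.exists_isJumpCurve j hW
  exact h.contDiffAt_lam

theorem hasFDerivAt_lam (j : Fin m) {W : State m} (hW : W ∈ S.Ω) :
    HasFDerivAt (S.lam j) (fderiv ℝ (S.lam j) W) W :=
  ((S.contDiffAt_lam j hW).differentiableAt one_ne_zero).hasFDerivAt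

end HyperbolicSystem

end PartialRiemann

/-! ### Gluing, local flows and integral curves of a continuous rescaling of a C¹ field. -/

namespace PartialRiemann

section Flow

variable {E : Type*} [NormedAddCommGroup E] [NormedSpace ℝ E]

/-- Two strictly differentiable functions of `(t, x)` that agree for `t = 0` and have the same
derivative can be glued along `t = 0`. -/
theorem hasStrictFDerivAt_ite_neg {G : Type*} [NormedAddCommGroup G] [NormedSpace ℝ G]
    {f g : ℝ × E → G} {D : ℝ × E →L[ℝ] G} {x₀ : E}
    (hf : HasStrictFDerivAt f D (0, x₀)) (hg : HasStrictFDerivAt g D (0, x₀))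
    (h : ∀ᶠ x in 𝓝 x₀, f (0, x) = g (0, x)) :
    HasStrictFDerivAt (fun z : ℝ × E => if z.1 < 0 then g z else f z) D (0, x₀) := by
  refine HasStrictFDerivAt.of_isLittleO ?_
  rw [Asymptotics.isLittleO_iff]
  intro ε hε
  have hf' := (Asymptotics.isLittleO_iff.1 hf.isLittleO) (half_pos hε)
  have hg' := (Asymptotics.isLittleO_iff.1 hg.isLittleO) (half_pos hε)
  obtain ⟨ρ, hρ, hball⟩ := Metric.eventually_nhds_iff_ball.1
    ((hf'.and hg').and (((continuous_snd.comp continuous_fst).tendsto' _ _ rfl).eventually h))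
  refine Metric.eventually_nhds_iff_ball.2 ⟨ρ, hρ, ?_⟩
  have hslice : ∀ z : ℝ × E, z ∈ Metric.ball ((0 : ℝ), x₀) ρ →
      ((0 : ℝ), z.2) ∈ Metric.ball ((0 : ℝ), x₀) ρ := by
    intro z hz
    rw [Metric.mem_ball, Prod.dist_eq, max_lt_iff] at hz ⊢
    exact ⟨by simpa using hρ, hz.2⟩
  have hboth : ∀ z w : ℝ × E, z ∈ Metric.ball ((0 : ℝ), x₀) ρ → w ∈ Metric.ball ((0 : ℝ), x₀) ρ →
      (‖f z - f w - D (z - w)‖ ≤ ε / 2 * ‖z - w‖ ∧ ‖g z - g w - D (z - w)‖ ≤ ε / 2 * ‖z - w‖) ∧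
        f (0, z.2) = g (0, z.2) := by
    intro z w hz hw
    refine hball (z, w) ?_
    rw [Metric.mem_ball, Prod.dist_eq, max_lt_iff]
    exact ⟨hz, hw⟩
  have hmixed : ∀ z w : ℝ × E, z ∈ Metric.ball ((0 : ℝ), x₀) ρ → w ∈ Metric.ball ((0 : ℝ), x₀) ρ →
      z.1 < 0 → 0 ≤ w.1 → ‖g z - f w - D (z - w)‖ ≤ ε * ‖z - w‖ := by
    intro z w hz hw hz0 hw0
    -- Points on opposite sides are compared through a point of the interface, where f and g agree.
    -- In the max norm neither leg is longer than z - w.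
    set u : ℝ × E := (0, w.2) with hu
    have huB := hslice w hw
    have h1 := (hboth z u hz huB).1.2
    have h2 := (hboth u w huB hw).1.1
    have h3 : f u = g u := (hboth w w hw hw).2
    have n1 : ‖z - u‖ ≤ ‖z - w‖ := by
      simp only [Prod.norm_def, Prod.fst_sub, Prod.snd_sub, hu]
      refine max_le_max ?_ le_rfl
      rw [Real.norm_eq_abs, Real.norm_eq_abs, abs_of_nonpos (by linarith),
        abs_of_nonpos (by linarith)]
      linarith
    have n2 : ‖u - w‖ ≤ ‖z - w‖ := by
      simp only [Prod.norm_def, Prod.fst_sub, Prod.snd_sub, hu, sub_self, norm_zero]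
      refine max_le ?_ (le_max_of_le_right (norm_nonneg _))
      refine le_max_of_le_left ?_
      rw [Real.norm_eq_abs, Real.norm_eq_abs, abs_of_nonpos (by linarith),
        abs_of_nonpos (by linarith)]
      linarith
    have key : g z - f w - D (z - w) = (g z - g u - D (z - u)) + (f u - f w - D (u - w)) := by
      rw [h3, map_sub, map_sub, map_sub]; abel
    rw [key]
    calc _ ≤ ε / 2 * ‖z - u‖ + ε / 2 * ‖u - w‖ := (norm_add_le _ _).trans (add_le_add h1 h2)
      _ ≤ ε / 2 * ‖z - w‖ + ε / 2 * ‖z - w‖ := by gcongr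
      _ = _ := by ring
  rintro ⟨z, w⟩ hzw
  rw [Metric.mem_ball, Prod.dist_eq, max_lt_iff] at hzw
  have hz : z ∈ Metric.ball ((0 : ℝ), x₀) ρ := hzw.1
  have hw : w ∈ Metric.ball ((0 : ℝ), x₀) ρ := hzw.2
  have hle : ε / 2 * ‖z - w‖ ≤ ε * ‖z - w‖ := by
    gcongr; linarith
  by_cases hz0 : z.1 < 0 <;> by_cases hw0 : w.1 < 0
  · simpa [hz0, hw0] using (hboth z w hz hw).1.2.trans hle
  · simpa [hz0, hw0] using hmixed z w hz hw hz0 (not_lt.1 hw0)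
  · have := hmixed w z hw hz hw0 (not_lt.1 hz0)
    simp only [hz0, hw0, if_true, if_false]
    have e : f z - g w - D (z - w) = -(g w - f z - D (w - z)) := by
      rw [map_sub, map_sub]; abel
    rw [e, norm_neg, norm_sub_rev z w]
    exact this
  · simpa [hz0, hw0] using (hboth z w hz hw).1.1.trans hle

theorem contDiffOn_one_of_hasDerivAt {f f' : ℝ → E} {s : Set ℝ} (hs : IsOpen s)
    (hf : ∀ x ∈ s, HasDerivAt f (f' x) x) (hf' : ContinuousOn f' s) : ContDiffOn ℝ 1 f s := by
  have : ContDiffOn ℝ (0 + 1) f s := by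
    rw [contDiffOn_succ_iff_deriv_of_isOpen hs]
    refine ⟨fun x hx => (hf x hx).differentiableAt.differentiableWithinAt, by simp, ?_⟩
    rw [contDiffOn_zero]
    exact hf'.congr fun x hx => (hf x hx).deriv
  simpa using this

theorem eq_of_hasDerivAt_zero {f : ℝ → E} {s : Set ℝ} (hs : Convex ℝ s)
    (hf : ∀ x ∈ s, HasDerivAt f 0 x) {x y : ℝ} (hx : x ∈ s) (hy : y ∈ s) : f y = f x := by
  have := hs.norm_image_sub_le_of_norm_hasDerivWithin_le (f := f) (f' := fun _ => 0) (C := 0)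
    (fun t ht => (hf t ht).hasDerivWithinAt) (fun t _ => by simp) hx hy
  simpa [sub_eq_zero] using this

/-- Two `C¹` curves with the same value and the same derivative at `0` can be glued at `0`. -/
theorem contDiffOn_ite_neg {f g f' g' : ℝ → E} {δ : ℝ}
    (hf : ∀ x ∈ Ioo (-δ) δ, HasDerivAt f (f' x) x) (hg : ∀ x ∈ Ioo (-δ) δ, HasDerivAt g (g' x) x)
    (hf' : ContinuousOn f' (Ioo (-δ) δ)) (hg' : ContinuousOn g' (Ioo (-δ) δ))
    (h0 : f 0 = g 0) (h0' : f' 0 = g' 0) :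
    (∀ x ∈ Ioo (-δ) δ, HasDerivAt (fun x => if x < 0 then g x else f x)
      (if x < 0 then g' x else f' x) x) ∧
    ContDiffOn ℝ 1 (fun x => if x < 0 then g x else f x) (Ioo (-δ) δ) := by
  have hd : ∀ x ∈ Ioo (-δ) δ, HasDerivAt (fun x => if x < 0 then g x else f x)
      (if x < 0 then g' x else f' x) x := by
    intro x hx
    rcases lt_trichotomy x 0 with hx0 | hx0 | hx0
    · rw [if_pos hx0]
      refine (hg x hx).congr_of_eventuallyEq ?_
      filter_upwards [Iio_mem_nhds hx0] with y hy
      exact if_pos hy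
    · subst hx0
      rw [if_neg (lt_irrefl _)]
      have h1 : HasDerivWithinAt (fun x => if x < 0 then g x else f x) (f' 0) (Iic 0) 0 := by
        rw [h0']
        refine (hg 0 hx).hasDerivWithinAt.congr (fun y hy => ?_) (by simp [h0])
        rcases lt_or_eq_of_le (show y ≤ 0 from hy) with hy | hy
        · simp [hy]
        · simp [hy, h0]
      have h2 : HasDerivWithinAt (fun x => if x < 0 then g x else f x) (f' 0) (Ici 0) 0 := by
        refine (hf 0 hx).hasDerivWithinAt.congr (fun y hy => ?_) (by simp)
        simp [not_lt.2 (show 0 ≤ y from hy)]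
      have := h1.union h2
      rwa [Iic_union_Ici, hasDerivWithinAt_univ] at this
    · rw [if_neg (not_lt.2 hx0.le)]
      refine (hf x hx).congr_of_eventuallyEq ?_
      filter_upwards [Ioi_mem_nhds hx0] with y hy
      exact if_neg (not_lt.2 (le_of_lt hy))
  refine ⟨hd, ?_⟩
  have hc : ContinuousOn (fun x => if x < 0 then g' x else f' x) (Ioo (-δ) δ) := by
    refine ContinuousOn.if ?_ ?_ ?_
    · rintro x ⟨_, hx⟩
      have : x = 0 := by
        have := frontier_lt_subset_eq continuous_id continuous_const hx
        simpa using this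
      rw [this, h0']
    · exact hg'.mono inter_subset_left
    · exact hf'.mono inter_subset_left
  exact contDiffOn_one_of_hasDerivAt isOpen_Ioo hd hc

/-- The local flow of a `C¹` vector field; it is strictly differentiable at time `0`. -/
theorem exists_flow [CompleteSpace E] {r : E → E} {x₀ : E} (hr : ContDiffAt ℝ 1 r x₀) :
    ∃ y : ℝ × E → E,
      HasStrictFDerivAt y ((ContinuousLinearMap.fst ℝ ℝ E).smulRight (r x₀) +
        ContinuousLinearMap.snd ℝ ℝ E) (0, x₀) ∧
      ∀ᶠ z in 𝓝 ((0, x₀) : ℝ × E), y (0, z.2) = z.2 ∧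
        HasDerivAt (fun t => y (t, z.2)) (r (y z)) z.1 := by
  obtain ⟨a, ha, ρ', ρ, _, _, hρ, hpl⟩ := IsPicardLindelof.of_contDiffAt_one hr
  obtain ⟨α, hα, L, hL⟩ :=
    (hpl 0).exists_forall_mem_closedBall_eq_hasDerivWithinAt_lipschitzOnWith
  obtain ⟨K, s, hs, hK⟩ := hr.exists_lipschitzOnWith
  simp only [zero_sub, zero_add] at hα hL
  have hρ : (0 : ℝ) < ρ := hρ
  have hder : ∀ x ∈ Metric.ball x₀ ρ, ∀ t ∈ Ioo (-a) a, HasDerivAt (α x) (r (α x t)) t :=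
    fun x hx t ht => ((hα x (Metric.ball_subset_closedBall hx)).2 t
      (Ioo_subset_Icc_self ht)).hasDerivAt (Icc_mem_nhds ht.1 ht.2)
  have hzero : ∀ x ∈ Metric.ball x₀ ρ, α x 0 = x := fun x hx =>
    (hα x (Metric.ball_subset_closedBall hx)).1
  have hlip : ∀ t ∈ Ioo (-a) a, ∀ x ∈ Metric.ball x₀ ρ, ∀ x' ∈ Metric.ball x₀ ρ,
      ‖α x t - α x' t‖ ≤ L * ‖x - x'‖ := fun t ht x hx x' hx' =>
    (hL t (Ioo_subset_Icc_self ht)).norm_sub_le (Metric.ball_subset_closedBall hx)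
      (Metric.ball_subset_closedBall hx')
  have h0a : (0 : ℝ) ∈ Ioo (-a) a := ⟨by linarith, ha⟩
  have hx₀ : x₀ ∈ Metric.ball x₀ ρ := Metric.mem_ball_self hρ
  have hcont : ContinuousAt (fun z : ℝ × E => α z.2 z.1) (0, x₀) := by
    have h1 : Tendsto (fun z : ℝ × E => L * ‖z.2 - x₀‖ + ‖α x₀ z.1 - α x₀ 0‖) (𝓝 (0, x₀))
        (𝓝 0) := by
      have c1 : ContinuousAt (fun z : ℝ × E => α x₀ z.1) (0, x₀) :=
        ContinuousAt.comp (f := fun z : ℝ × E => z.1) (g := α x₀)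
          (hder x₀ hx₀ 0 h0a).continuousAt continuousAt_fst
      have c2 : ContinuousAt (fun z : ℝ × E => L * ‖z.2 - x₀‖ + ‖α x₀ z.1 - α x₀ 0‖) (0, x₀) :=
        (continuousAt_const.mul (continuousAt_snd.sub continuousAt_const).norm).add
          (c1.sub continuousAt_const).norm
      simpa [ContinuousAt] using c2
    refine tendsto_iff_norm_sub_tendsto_zero.2 (squeeze_zero' (Eventually.of_forall fun _ =>
      norm_nonneg _) ?_ h1)
    filter_upwards [prod_mem_nhds (Ioo_mem_nhds h0a.1 h0a.2) (Metric.ball_mem_nhds x₀ hρ)]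
      with z hz
    calc ‖α z.2 z.1 - α x₀ 0‖ = ‖(α z.2 z.1 - α x₀ z.1) + (α x₀ z.1 - α x₀ 0)‖ := by
          congr 1; abel
      _ ≤ _ := (norm_add_le _ _).trans (by gcongr; exact hlip _ hz.1 _ hz.2 _ hx₀)
  refine ⟨fun z => α z.2 z.1, ?_, ?_⟩
  swap
  · filter_upwards [prod_mem_nhds (Ioo_mem_nhds h0a.1 h0a.2) (Metric.ball_mem_nhds x₀ hρ)]
      with z hz
    exact ⟨hzero _ hz.2, hder _ hz.2 _ hz.1⟩
  -- Lipschitz dependence on the initial point suffices at time 0: the difference of two solutions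
  -- drifts by at most K L ‖x₁ - x₂‖ per unit of time, and the time is short.
  refine HasStrictFDerivAt.of_isLittleO ?_
  rw [Asymptotics.isLittleO_iff]
  intro ε hε
  have e1 : ∀ᶠ z in 𝓝 ((0, x₀) : ℝ × E), α z.2 z.1 ∈ s ∧ ‖r (α z.2 z.1) - r x₀‖ ≤ ε / 2 := by
    have hc' : Tendsto (fun z : ℝ × E => α z.2 z.1) (𝓝 (0, x₀)) (𝓝 x₀) := by
      simpa [ContinuousAt, hzero x₀ hx₀] using hcont
    refine (hc'.eventually hs).and ?_
    have hc2 := (hr.continuousAt.tendsto.comp hc')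
    filter_upwards [hc2.eventually (Metric.closedBall_mem_nhds _ (half_pos hε))] with z hz
    simpa [dist_eq_norm] using hz
  obtain ⟨d, hd, hdball⟩ := Metric.eventually_nhds_iff_ball.1 (e1.and
    (prod_mem_nhds (Ioo_mem_nhds h0a.1 h0a.2) (Metric.ball_mem_nhds x₀ hρ)))
  -- Chosen so that K L κ ≤ ε / 2; the added 1 keeps the denominator positive.
  set κ : ℝ := ε / (2 * (K * L + 1)) with hκ
  have hκ0 : 0 < κ := by positivity
  set d' := min d κ with hd'
  have hd'0 : 0 < d' := lt_min hd hκ0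
  refine Metric.eventually_nhds_iff_ball.2 ⟨d', hd'0, ?_⟩
  rintro ⟨⟨t₁, x₁⟩, ⟨t₂, x₂⟩⟩ hz
  simp only [Metric.mem_ball, Prod.dist_eq, max_lt_iff] at hz
  obtain ⟨⟨ht₁, hx₁⟩, ht₂, hx₂⟩ := hz
  have hbox : ∀ t x, dist t 0 < d' → dist x x₀ < d' → (α x t ∈ s ∧ ‖r (α x t) - r x₀‖ ≤ ε / 2) ∧
      t ∈ Ioo (-a) a ∧ x ∈ Metric.ball x₀ ρ := by
    intro t x ht hx
    have := hdball (t, x) (by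
      rw [Metric.mem_ball, Prod.dist_eq, max_lt_iff]
      exact ⟨ht.trans_le (min_le_left _ _), hx.trans_le (min_le_left _ _)⟩)
    exact ⟨this.1, this.2.1, this.2.2⟩
  have hconv : Convex ℝ (Metric.ball (0 : ℝ) d') := convex_ball _ _
  -- variation in time
  have hI : ‖(α x₁ t₁ - t₁ • r x₀) - (α x₁ t₂ - t₂ • r x₀)‖ ≤ ε / 2 * ‖t₁ - t₂‖ := by
    refine hconv.norm_image_sub_le_of_norm_hasDerivWithin_le
      (f := fun t => α x₁ t - t • r x₀) (f' := fun t => r (α x₁ t) - r x₀)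
      (fun t ht => ?_) (fun t ht => (hbox t x₁ ht hx₁).1.2) ht₂ ht₁
    obtain ⟨_, h2, h3⟩ := hbox t x₁ ht hx₁
    have h5 := (hder x₁ h3 t h2).sub ((hasDerivAt_id t).smul_const (r x₀))
    rw [one_smul] at h5
    exact h5.hasDerivWithinAt
  -- variation in space
  have hII : ‖(α x₁ t₂ - α x₂ t₂) - (α x₁ 0 - α x₂ 0)‖ ≤ (K * (L * ‖x₁ - x₂‖)) * ‖t₂ - 0‖ := by
    refine hconv.norm_image_sub_le_of_norm_hasDerivWithin_le
      (f := fun t => α x₁ t - α x₂ t) (f' := fun t => r (α x₁ t) - r (α x₂ t))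
      (fun t ht => ?_) (fun t ht => ?_) (Metric.mem_ball_self hd'0) ht₂
    · obtain ⟨_, h2, h3⟩ := hbox t x₁ ht hx₁
      obtain ⟨_, _, h3'⟩ := hbox t x₂ ht hx₂
      exact ((hder x₁ h3 t h2).sub (hder x₂ h3' t h2)).hasDerivWithinAt
    · obtain ⟨h1, h2, h3⟩ := hbox t x₁ ht hx₁
      obtain ⟨h1', _, h3'⟩ := hbox t x₂ ht hx₂
      exact (hK.norm_sub_le h1.1 h1'.1).trans (by gcongr; exact hlip t h2 _ h3 _ h3')
  have hx₁ρ := (hbox 0 x₁ (by simpa using hd'0) hx₁).2.2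
  have hx₂ρ := (hbox 0 x₂ (by simpa using hd'0) hx₂).2.2
  rw [hzero _ hx₁ρ, hzero _ hx₂ρ] at hII
  have ht₂κ : ‖t₂ - 0‖ ≤ κ := by
    rw [← dist_eq_norm]; exact ht₂.le.trans (min_le_right _ _)
  have hII' : ‖(α x₁ t₂ - α x₂ t₂) - (x₁ - x₂)‖ ≤ ε / 2 * ‖x₁ - x₂‖ := by
    refine hII.trans ?_
    calc K * (L * ‖x₁ - x₂‖) * ‖t₂ - 0‖ ≤ K * (L * ‖x₁ - x₂‖) * κ := by gcongr
      _ = (K * L) * κ * ‖x₁ - x₂‖ := by ring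
      _ ≤ (K * L + 1) * κ * ‖x₁ - x₂‖ := by gcongr; linarith
      _ = ε / 2 * ‖x₁ - x₂‖ := by
        rw [hκ]; congr 1; field_simp
  have hn1 : ‖t₁ - t₂‖ ≤ ‖((t₁, x₁) : ℝ × E) - (t₂, x₂)‖ := norm_fst_le (((t₁, x₁) : ℝ × E) - (t₂, x₂))
  have hn2 : ‖x₁ - x₂‖ ≤ ‖((t₁, x₁) : ℝ × E) - (t₂, x₂)‖ := norm_snd_le (((t₁, x₁) : ℝ × E) - (t₂, x₂))
  have hsplit : α x₁ t₁ - α x₂ t₂ - ((ContinuousLinearMap.fst ℝ ℝ E).smulRight (r x₀) +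
        ContinuousLinearMap.snd ℝ ℝ E) (((t₁, x₁) : ℝ × E) - (t₂, x₂)) =
      ((α x₁ t₁ - t₁ • r x₀) - (α x₁ t₂ - t₂ • r x₀)) +
        ((α x₁ t₂ - α x₂ t₂) - (x₁ - x₂)) := by
    simp [sub_smul]; abel
  simp only
  rw [hsplit]
  calc _ ≤ ε / 2 * ‖t₁ - t₂‖ + ε / 2 * ‖x₁ - x₂‖ := (norm_add_le _ _).trans (add_le_add hI hII')
    _ ≤ ε / 2 * ‖((t₁, x₁) : ℝ × E) - (t₂, x₂)‖ + ε / 2 * ‖((t₁, x₁) : ℝ × E) - (t₂, x₂)‖ := by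
      gcongr
    _ = _ := by ring

/-- Change of time with prescribed positive speed. -/
theorem exists_time_change {g : ℝ → ℝ} (hg : Continuous g) (h1 : ∀ t, 1 / 2 ≤ g t)
    (h2 : ∀ t, g t ≤ 2) :
    ∃ τ T : ℝ → ℝ, (∀ e, HasDerivAt T (g (T e))⁻¹ e) ∧ T 0 = 0 ∧ (∀ e, |T e| ≤ 2 * |e|) ∧
      (∀ t, |τ t| ≤ 2 * |t|) ∧ (∀ t, T (τ t) = t) ∧ (∀ t, 0 ≤ t → 0 ≤ τ t) := by
  set τ : ℝ → ℝ := fun t => ∫ s in (0 : ℝ)..t, g s with hτ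
  have hd : ∀ t, HasDerivAt τ (g t) t := fun t => hg.integral_hasStrictDerivAt 0 t |>.hasDerivAt
  have hcont : Continuous τ := continuous_iff_continuousAt.2 fun t => (hd t).continuousAt
  have h0 : τ 0 = 0 := by simp [hτ]
  have hpos : ∀ t, 0 < g t := fun t => lt_of_lt_of_le (by norm_num) (h1 t)
  have hmono : StrictMono τ := strictMono_of_hasDerivAt_pos hd hpos
  have hlow : ∀ s t, s ≤ t → 1 / 2 * (t - s) ≤ τ t - τ s := by
    intro s t hst
    have : Monotone fun t => τ t - 1 / 2 * t := by
      refine monotone_of_hasDerivAt_nonneg (f' := fun t => g t - 1 / 2 * 1) (fun x => (hd x).sub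
        ((hasDerivAt_id x).const_mul _)) fun x => ?_
      have := h1 x
      simp only [Pi.zero_apply]; linarith
    have := this hst
    simp only at this
    linarith
  have hup : ∀ s t, s ≤ t → τ t - τ s ≤ 2 * (t - s) := by
    intro s t hst
    have : Monotone fun t => 2 * t - τ t := by
      refine monotone_of_hasDerivAt_nonneg (f' := fun t => 2 * 1 - g t) (fun x =>
        ((hasDerivAt_id x).const_mul _).sub (hd x)) fun x => ?_
      have := h2 x
      simp only [Pi.zero_apply]; linarith
    have := this hst
    simp only at this
    linarith
  have hsurj : Function.Surjective τ := by
    refine hcont.surjective ?_ ?_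
    · refine tendsto_atTop_mono' _ (f₁ := fun t => 1 / 2 * t) ?_
        (Tendsto.const_mul_atTop (show (0 : ℝ) < 1 / 2 by norm_num) tendsto_id)
      filter_upwards [eventually_ge_atTop 0] with t ht
      have := hlow 0 t ht
      simp only [h0] at this; linarith
    · refine tendsto_atBot_mono' _ (f₁ := fun t => 1 / 2 * t) ?_
        (Tendsto.const_mul_atBot (show (0 : ℝ) < 1 / 2 by norm_num) tendsto_id)
      filter_upwards [eventually_le_atBot 0] with t ht
      have := hlow t 0 ht
      simp only [h0] at this; linarith
  let O := hmono.orderIsoOfSurjective τ hsurj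
  have hO : ∀ e, τ (O.symm e) = e := fun e => O.apply_symm_apply e
  have hO' : ∀ t, O.symm (τ t) = t := fun t => O.symm_apply_apply t
  have hT0 : O.symm 0 = 0 := by
    have := hO' 0; rwa [h0] at this
  refine ⟨τ, fun e => O.symm e, fun e => ?_, hT0, fun e => ?_, fun t => ?_, hO', fun t ht => ?_⟩
  · exact HasDerivAt.of_local_left_inverse O.symm.continuous.continuousAt (hd _) (hpos _).ne'
      (Eventually.of_forall hO)
  · rcases le_total 0 (O.symm e) with h | h
    · have := hlow 0 _ h
      rw [hO, h0] at this
      rw [abs_of_nonneg h]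
      have := le_abs_self e
      linarith
    · have := hlow _ 0 h
      rw [hO, h0] at this
      rw [abs_of_nonpos h]
      have := neg_le_abs e
      linarith
  · rcases le_total 0 t with h | h
    · have a1 := hup 0 t h
      have a2 := hlow 0 t h
      rw [h0] at a1 a2
      rw [abs_of_nonneg h, abs_of_nonneg (by linarith)]
      linarith
    · have a1 := hup t 0 h
      have a2 := hlow t 0 h
      rw [h0] at a1 a2
      rw [abs_of_nonpos h, abs_of_nonpos (by linarith)]
      linarith
  · have := hmono.monotone ht
    rwa [h0] at this

/-- Integral curves of a continuous vector field `R` that is proportional to a `C¹` vector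
field `r`. -/
theorem exists_integral_curves [CompleteSpace E] {R r : E → E} {b : E → ℝ} {x₀ : E}
    (hr : ContDiffAt ℝ 1 r x₀) (hb : ∀ᶠ x in 𝓝 x₀, ContinuousAt b x) (hb₀ : b x₀ = 1)
    (hR : ∀ᶠ x in 𝓝 x₀, R x = b x • r x) {N : Set E} (hN : N ∈ 𝓝 x₀) :
    ∃ (y : ℝ × E → E) (ρ : ℝ → E → E) (τ : ℝ × E → ℝ) (δ : ℝ),
      HasStrictFDerivAt y ((ContinuousLinearMap.fst ℝ ℝ E).smulRight (R x₀) +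
        ContinuousLinearMap.snd ℝ ℝ E) (0, x₀) ∧
      (∀ᶠ x in 𝓝 x₀, y (0, x) = x) ∧ 0 < δ ∧
      (∀ᶠ x in 𝓝 x₀, ρ 0 x = x ∧ ∀ e ∈ Ioo (-δ) δ, ρ e x ∈ N ∧
        HasDerivAt (fun e => ρ e x) (R (ρ e x)) e) ∧
      Tendsto τ (𝓝 (0, x₀)) (𝓝 0) ∧
      ∀ᶠ z in 𝓝 ((0, x₀) : ℝ × E), y z = ρ (τ z) z.2 ∧ (0 ≤ z.1 → 0 ≤ τ z) := by
  obtain ⟨y, hy, hflow⟩ := exists_flow hr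
  have hRx₀ : R x₀ = r x₀ := by rw [hR.self_of_nhds, hb₀, one_smul]
  have hy0 : y (0, x₀) = x₀ := hflow.self_of_nhds.1
  have hyc : Tendsto y (𝓝 (0, x₀)) (𝓝 x₀) := by
    have := hy.continuousAt
    rwa [ContinuousAt, hy0] at this
  have hbc : ContinuousAt b x₀ := hb.self_of_nhds
  have hbt : Tendsto b (𝓝 x₀) (𝓝 1) := hb₀ ▸ hbc
  have hgood : ∀ᶠ x in 𝓝 x₀, (x ∈ N ∧ ContinuousAt b x) ∧ R x = b x • r x ∧ b x ∈ Ioo (1 / 2) 2 :=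
    (Filter.Eventually.and hN hb).and (hR.and (hbt.eventually (Ioo_mem_nhds (by norm_num)
      (by norm_num))))
  obtain ⟨a, ha, hbox⟩ := Metric.eventually_nhds_iff_ball.1 (hflow.and (hyc.eventually hgood))
  have hbox' : ∀ x ∈ Metric.ball x₀ a, ∀ t ∈ Ioo (-a) a, (y (0, x) = x ∧
      HasDerivAt (fun t => y (t, x)) (r (y (t, x))) t) ∧ (y (t, x) ∈ N ∧ ContinuousAt b (y (t, x)))
        ∧ R (y (t, x)) = b (y (t, x)) • r (y (t, x)) ∧ b (y (t, x)) ∈ Ioo (1 / 2) 2 := by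
    intro x hx t ht
    refine hbox (t, x) ?_
    rw [Metric.mem_ball, Prod.dist_eq, max_lt_iff]
    refine ⟨?_, hx⟩
    rw [Real.dist_eq, sub_zero]
    exact abs_lt.2 ht
  -- Clamping time to [-a/2, a/2] gives a speed defined and bounded on all of ℝ.
  set cl : ℝ → ℝ := fun t => max (-(a / 2)) (min (a / 2) t) with hcl
  have hclc : Continuous cl := by fun_prop
  have hclm : ∀ t, cl t ∈ Ioo (-a) a := by
    intro t
    refine ⟨lt_of_lt_of_le (by linarith) (le_max_left _ _), max_lt (by linarith) ?_⟩
    exact (min_le_left _ _).trans_lt (by linarith)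
  have hcleq : ∀ t, |t| < a / 2 → cl t = t := by
    intro t ht
    rw [abs_lt] at ht
    simp only [hcl]
    rw [min_eq_right ht.2.le, max_eq_right ht.1.le]
  have htc : ∀ x ∈ Metric.ball x₀ a, ∃ τ T : ℝ → ℝ,
      (∀ e, HasDerivAt T ((b (y (cl (T e), x)))⁻¹)⁻¹ e) ∧ T 0 = 0 ∧ (∀ e, |T e| ≤ 2 * |e|) ∧
      (∀ t, |τ t| ≤ 2 * |t|) ∧ (∀ t, T (τ t) = t) ∧ (∀ t, 0 ≤ t → 0 ≤ τ t) := by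
    intro x hx
    -- With g = 1 / b the inverse time change has T' = b(y(T)) where the clamp is inactive, so e ↦
    -- y(T e) has velocity b r = R.
    refine exists_time_change (g := fun t => (b (y (cl t, x)))⁻¹) ?_ ?_ ?_
    · refine continuous_iff_continuousAt.2 fun t => ?_
      obtain ⟨h1, h2, _, h4⟩ := hbox' x hx (cl t) (hclm t)
      refine ContinuousAt.inv₀ ?_ (by have := h4.1; linarith)
      have c1 : ContinuousAt (fun t => y (cl t, x)) t :=
        ContinuousAt.comp (g := fun t => y (t, x)) (f := cl) h1.2.continuousAt hclc.continuousAt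
      exact ContinuousAt.comp (g := b) (f := fun t => y (cl t, x)) h2.2 c1
    · intro t
      have h4 := (hbox' x hx (cl t) (hclm t)).2.2.2
      have h5 : (0 : ℝ) < b (y (cl t, x)) := by have := h4.1; linarith
      rw [one_div]
      exact inv_anti₀ h5 h4.2.le
    · intro t
      have h4 := (hbox' x hx (cl t) (hclm t)).2.2.2
      have := inv_anti₀ (by norm_num) h4.1.le
      simpa using this
  choose! τ T hTd hT0 hTle hτle hTτ hτpos using htc
  have hball : Metric.ball x₀ a ∈ 𝓝 x₀ := Metric.ball_mem_nhds x₀ ha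
  have hballz : ∀ᶠ z in 𝓝 ((0, x₀) : ℝ × E), z.2 ∈ Metric.ball x₀ a :=
    (continuous_snd.tendsto _).eventually hball
  -- For |e| < a / 4 the bound |T e| ≤ 2 |e| keeps the time within the unclamped range.
  refine ⟨y, fun e x => y (T x e, x), fun z => τ z.2 z.1, a / 4, ?_, ?_, by positivity, ?_, ?_, ?_⟩
  · rwa [hRx₀]
  · filter_upwards [hball] with x hx using (hbox' x hx 0 ⟨by linarith, ha⟩).1.1
  · filter_upwards [hball] with x hx
    refine ⟨?_, fun e he => ?_⟩
    · rw [hT0 x hx]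
      exact (hbox' x hx 0 ⟨by linarith, ha⟩).1.1
    · have hTe : |T x e| < a / 2 := by
        have := hTle x hx e
        have := abs_lt.2 he
        linarith
      have hmem : T x e ∈ Ioo (-a) a := by
        rw [← hcleq _ hTe]; exact hclm _
      obtain ⟨⟨_, h1⟩, ⟨h2, _⟩, h3, h4⟩ := hbox' x hx _ hmem
      refine ⟨h2, ?_⟩
      have hT' := hTd x hx e
      rw [hcleq _ hTe, inv_inv] at hT'
      rw [h3]
      exact HasDerivAt.scomp (g₁ := fun t => y (t, x)) (h := T x) e h1 hT'
  · refine squeeze_zero_norm' (a := fun z : ℝ × E => 2 * |z.1|) ?_ ?_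
    · filter_upwards [hballz] with z hz using hτle _ hz _
    · exact (Continuous.tendsto' (by fun_prop) _ _ (by simp))
  · filter_upwards [hballz] with z hz
    refine ⟨?_, hτpos _ hz _⟩
    rw [hTτ _ hz]

end Flow

end PartialRiemann

/-! ### Entropy along shocks, and construction of the wave curves. -/

namespace PartialRiemann

theorem convexOn_fderiv_le_sub {E : Type*} [NormedAddCommGroup E] [NormedSpace ℝ E] {s : Set E}
    {f : E → ℝ} {f' : E →L[ℝ] ℝ} {x y : E} (hf : ConvexOn ℝ s f) (hx : x ∈ s) (hy : y ∈ s)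
    (hd : HasFDerivAt f f' x) : f' (y - x) ≤ f y - f x := by
  have h1 := hf.comp_affineMap (AffineMap.lineMap x y : ℝ →ᵃ[ℝ] E)
  have h2 : HasDerivAt (f ∘ (AffineMap.lineMap x y : ℝ →ᵃ[ℝ] E)) (f' (y - x)) 0 := by
    refine HasFDerivAt.comp_hasDerivAt (l := f) (f := (AffineMap.lineMap x y : ℝ →ᵃ[ℝ] E)) 0 ?_
      AffineMap.hasDerivAt_lineMap
    simpa using hd
  have h3 := h1.le_slope_of_hasDerivAt (x := 0) (y := 1) (by simpa using hx) (by simpa using hy)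
    one_pos h2
  simpa [slope] using h3

theorem hasDerivAt_slice {E G : Type*} [NormedAddCommGroup E] [NormedSpace ℝ E]
    [NormedAddCommGroup G] [NormedSpace ℝ G] {f : ℝ × E → G} {t : ℝ} {x : E}
    (hf : ContDiffAt ℝ 1 f (t, x)) :
    HasDerivAt (fun t => f (t, x)) (fderiv ℝ f (t, x) (1, 0)) t :=
  HasFDerivAt.comp_hasDerivAt (l := f) (f := fun t : ℝ => (t, x)) t
    (hf.differentiableAt one_ne_zero).hasFDerivAt
    ((hasDerivAt_id t).prodMk (hasDerivAt_const _ _))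

namespace HyperbolicSystem

variable {m : ℕ} {S : HyperbolicSystem m}

theorem IsEntropyPair.hasFDerivAt_entropy {η q : State m → ℝ} (h : S.IsEntropyPair η q)
    {W : State m} (hW : W ∈ S.Ω) : HasFDerivAt η (fderiv ℝ η W) W :=
  ((h.entropy_smooth.contDiffAt (S.isOpen.mem_nhds hW)).differentiableAt one_ne_zero).hasFDerivAt

theorem IsEntropyPair.hasFDerivAt_flux {η q : State m → ℝ} (h : S.IsEntropyPair η q)
    {W : State m} (hW : W ∈ S.Ω) :
    HasFDerivAt q ((fderiv ℝ η W).comp (fderiv ℝ S.F W)) W := by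
  rw [← h.compat W hW]
  exact ((h.flux_smooth.contDiffAt (S.isOpen.mem_nhds hW)).differentiableAt
    one_ne_zero).hasFDerivAt

/-- Along a curve of discontinuities whose speed is nondecreasing, the entropy inequality holds on
the side of negative parameters. -/
theorem IsEntropyPair.shock_inequality {η q : State m → ℝ} (h : S.IsEntropyPair η q) {a : ℝ}
    {W : State m} {γ γ' : ℝ → State m} {c c' : ℝ → ℝ} (hW : W ∈ S.Ω) (hγ0 : γ 0 = W)
    (hγΩ : ∀ t ∈ Ioo (-a) a, γ t ∈ S.Ω) (hγ : ∀ t ∈ Ioo (-a) a, HasDerivAt γ (γ' t) t)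
    (hc : ∀ t ∈ Ioo (-a) a, HasDerivAt c (c' t) t) (hc' : ∀ t ∈ Ioo (-a) a, 0 ≤ c' t)
    (hjump : ∀ t ∈ Ioo (-a) a, S.RankineHugoniot W (γ t) (c t)) {t : ℝ} (ht : t ∈ Ioo (-a) 0) :
    q (γ t) - q W ≤ c t * (η (γ t) - η W) := by
  have ha : 0 < a := by linarith [ht.1, ht.2]
  have hRH : ∀ t ∈ Ioo (-a) a, fderiv ℝ S.F (γ t) (γ' t) = c' t • (γ t - W) + c t • γ' t := by
    intro t ht
    have d1 : HasDerivAt (fun t => S.F (γ t) - S.F W) (fderiv ℝ S.F (γ t) (γ' t)) t :=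
      ((S.hasFDerivAt_F (hγΩ t ht)).comp_hasDerivAt t (hγ t ht)).sub_const _
    have d2 : HasDerivAt (fun t => c t • (γ t - W)) (c t • γ' t + c' t • (γ t - W)) t :=
      (hc t ht).fun_smul ((hγ t ht).sub_const W)
    have e : (fun t => S.F (γ t) - S.F W) =ᶠ[𝓝 t] fun t => c t • (γ t - W) := by
      filter_upwards [Ioo_mem_nhds ht.1 ht.2] with u hu using hjump u hu
    rw [d1.unique (d2.congr_of_eventuallyEq e), add_comm]
  -- By the differentiated Rankine–Hugoniot relation the terms in γ' cancel. What remains is c'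
  -- times the convexity defect of η at γ t, which is nonnegative; as the function vanishes at 0, it
  -- is nonpositive for t < 0.
  have hD : ∀ t ∈ Ioo (-a) a, HasDerivAt (fun t => q (γ t) - q W - c t * (η (γ t) - η W))
      (c' t * (η W - η (γ t) - fderiv ℝ η (γ t) (W - γ t))) t := by
    intro t ht
    have d1 := ((h.hasFDerivAt_flux (hγΩ t ht)).comp_hasDerivAt t (hγ t ht)).sub_const (q W)
    have d2 := (hc t ht).mul
      (((h.hasFDerivAt_entropy (hγΩ t ht)).comp_hasDerivAt t (hγ t ht)).sub_const (η W))
    refine (d1.sub d2).congr_deriv ?_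
    simp only [ContinuousLinearMap.comp_apply, hRH t ht, map_add, map_smul, smul_eq_mul, map_sub,
      Function.comp_apply]
    ring
  have hmono : MonotoneOn (fun t => q (γ t) - q W - c t * (η (γ t) - η W)) (Ioo (-a) a) := by
    refine monotoneOn_of_deriv_nonneg (convex_Ioo _ _)
      (fun t ht => (hD t ht).continuousAt.continuousWithinAt) ?_ ?_
    · rw [interior_Ioo]
      exact fun t ht => (hD t ht).differentiableAt.differentiableWithinAt
    · rw [interior_Ioo]
      intro t ht
      rw [(hD t ht).deriv]
      have := convexOn_fderiv_le_sub h.convex (hγΩ t ht) hW (h.hasFDerivAt_entropy (hγΩ t ht))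
      exact mul_nonneg (hc' t ht) (by linarith)
  have := hmono ⟨ht.1, ht.2.trans ha⟩ ⟨by linarith, ha⟩ ht.2.le
  simp only [hγ0, sub_self, mul_zero] at this
  linarith

theorem not_genuinelyNonlinear_and_linearlyDegenerate {j : Fin m} {W : State m} (hW : W ∈ S.Ω)
    (h1 : S.GenuinelyNonlinear j) (h2 : S.LinearlyDegenerate j) : False := by
  have := (h1 W hW).symm.trans (h2 W hW)
  exact one_ne_zero this

/-- λ is constant along the curve, so F(γ) - λ γ has derivative dF R - λ R = 0. -/
theorem isContact_of_integralCurve {j : Fin m} (hj : S.LinearlyDegenerate j) {δ : ℝ}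
    {γ : ℝ → State m} (hΩ : ∀ e ∈ Ioo (-δ) δ, γ e ∈ S.Ω)
    (hγ : ∀ e ∈ Ioo (-δ) δ, HasDerivAt γ (S.R j (γ e)) e) {e : ℝ} (he : e ∈ Ioo (-δ) δ) :
    S.IsContact j (γ 0) (γ e) := by
  have h0 : (0 : ℝ) ∈ Ioo (-δ) δ := ⟨by linarith [he.1, he.2], by linarith [he.1, he.2]⟩
  have hlam : ∀ e ∈ Ioo (-δ) δ, S.lam j (γ e) = S.lam j (γ 0) := by
    intro e he
    refine eq_of_hasDerivAt_zero (f := fun e => S.lam j (γ e)) (convex_Ioo _ _) (fun t ht => ?_)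
      h0 he
    have := (S.hasFDerivAt_lam j (hΩ t ht)).comp_hasDerivAt t (hγ t ht)
    rwa [hj _ (hΩ t ht)] at this
  refine ⟨?_, hlam e he⟩
  have := eq_of_hasDerivAt_zero (f := fun e => S.F (γ e) - S.lam j (γ 0) • γ e)
    (convex_Ioo _ _) (fun t ht => ?_) h0 he
  · rw [RankineHugoniot, smul_sub]
    rw [sub_eq_sub_iff_add_eq_add] at this ⊢
    rw [add_comm (S.lam j (γ 0) • γ e), ← this]
  · have := ((S.hasFDerivAt_F (hΩ t ht)).comp_hasDerivAt t (hγ t ht)).sub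
      ((hγ t ht).const_smul (S.lam j (γ 0)))
    rwa [S.eigen j _ (hΩ t ht), hlam t ht, sub_self] at this

/-- The normalization dλ·R = 1 makes the parameter of the curve equal to the characteristic speed up
to a shift, so a fan can be parametrized by ξ = x / t. -/
theorem lam_integralCurve {j : Fin m} (hj : S.GenuinelyNonlinear j) {a e : ℝ}
    {γ : ℝ → State m} (hΩ : ∀ t ∈ Icc a e, γ t ∈ S.Ω) (hcont : ContinuousOn γ (Icc a e))
    (hγ : ∀ t ∈ Ioo a e, HasDerivAt γ (S.R j (γ t)) t) {t : ℝ} (ht : t ∈ Icc a e) :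
    S.lam j (γ t) = S.lam j (γ a) + (t - a) := by
  have hc : ContinuousOn (fun t => S.lam j (γ t) - t) (Icc a e) :=
    ((S.continuousOn_lam j).comp hcont hΩ).sub continuousOn_id
  have hd : ∀ t ∈ Ioo a e, HasDerivAt (fun t => S.lam j (γ t) - t) 0 t := by
    intro t ht
    have := ((S.hasFDerivAt_lam j (hΩ t (Ioo_subset_Icc_self ht))).comp_hasDerivAt t
      (hγ t ht)).sub (hasDerivAt_id t)
    rwa [hj _ (hΩ t (Ioo_subset_Icc_self ht)), sub_self] at this
  have key : S.lam j (γ t) - t = S.lam j (γ a) - a := by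
    rcases eq_or_lt_of_le ht.1 with h | h
    · rw [h]
    · obtain ⟨c, hc1, hc2⟩ := exists_hasDerivAt_eq_slope (fun t => S.lam j (γ t) - t) (fun _ => 0) h
        (hc.mono (Icc_subset_Icc_right ht.2))
        (fun x hx => hd x ⟨hx.1, hx.2.trans_le ht.2⟩)
      have : t - a ≠ 0 := by linarith
      field_simp at hc2
      linarith
  linarith

/-- The wave curves of a field near a state `W₀`, with the entropy inequality for shocks and a
reparametrization `y` of the curves that is strictly differentiable at `(0, W₀)`. -/
theorem exists_isWaveCurve {j : Fin m}
    (hj : S.GenuinelyNonlinear j ∨ S.LinearlyDegenerate j) {W₀ : State m} (hW₀ : W₀ ∈ S.Ω) :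
    ∃ (χ : ℝ → State m → State m) (s : ℝ → State m → ℝ) (V : Set (State m)) (δ : ℝ)
      (y : ℝ × State m → State m) (τ : ℝ × State m → ℝ),
      V ∈ 𝓝 W₀ ∧ 0 < δ ∧ S.IsWaveCurve j V δ χ s ∧
      (S.GenuinelyNonlinear j → ∀ W ∈ V, ∀ e ∈ Ioo (-δ) 0, ∀ η q, S.IsEntropyPair η q →
        q (χ e W) - q W ≤ s e W * (η (χ e W) - η W)) ∧
      HasStrictFDerivAt y ((ContinuousLinearMap.fst ℝ ℝ (State m)).smulRight (S.R j W₀) +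
        ContinuousLinearMap.snd ℝ ℝ (State m)) (0, W₀) ∧
      Tendsto τ (𝓝 (0, W₀)) (𝓝 0) ∧
      ∀ᶠ z in 𝓝 ((0, W₀) : ℝ × State m), y z = χ (τ z) z.2 := by
  obtain ⟨v, c, b, hJ⟩ := S.exists_isJumpCurve j hW₀
  have hΩn : S.Ω ∈ 𝓝 W₀ := S.isOpen.mem_nhds hW₀
  have hbcont : ∀ᶠ W in 𝓝 W₀, ContinuousAt b W := by
    filter_upwards [hΩn] with W hW using hJ.b_cont.continuousAt (S.isOpen.mem_nhds hW)
  have hr : ContDiffAt ℝ 1 (fun W => v (0, W)) W₀ :=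
    hJ.smooth_v.comp (f := fun W : State m => ((0 : ℝ), W)) W₀
      (contDiffAt_const.prodMk contDiffAt_id)
  obtain ⟨y, ρ, τ, δ, hy, hy0, hδ, hρ, hτ, hyρ⟩ :=
    exists_integral_curves (R := S.R j) hr hbcont hJ.b_base hJ.direction hΩn
  have hRcont : ∀ W, (∀ e ∈ Ioo (-δ) δ, ρ e W ∈ S.Ω ∧
      HasDerivAt (fun e => ρ e W) (S.R j (ρ e W)) e) →
      ContinuousOn (fun e => S.R j (ρ e W)) (Ioo (-δ) δ) := by
    intro W hW
    exact (S.R_continuous j).comp (fun e he => (hW e he).2.continuousAt.continuousWithinAt)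
      fun e he => (hW e he).1
  rcases hj with hj | hj
  swap
  · refine ⟨ρ, fun _ _ => 0, _, δ, y, τ, hρ, hδ, ?_, ?_, hy, hτ, hyρ.mono fun z hz => hz.1⟩
    · have h0 : (0 : ℝ) ∈ Ioo (-δ) δ := ⟨by linarith, hδ⟩
      refine ⟨fun W hW e he => (hW.2 e he).1, fun W hW => hW.1, fun W hW => ?_, fun W hW => ?_,
        fun h W hW => ?_, fun h W hW => ?_, fun _ W hW e he => (hW.2 e he).2, fun _ W hW e he => ?_⟩
      · exact contDiffOn_one_of_hasDerivAt isOpen_Ioo (fun e he => (hW.2 e he).2)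
          (hRcont W hW.2)
      · have := (hW.2 0 h0).2
        rwa [hW.1] at this
      · exact (not_genuinelyNonlinear_and_linearlyDegenerate hW₀ h hj).elim
      · exact (not_genuinelyNonlinear_and_linearlyDegenerate hW₀ h hj).elim
      · have := isContact_of_integralCurve hj (γ := fun e => ρ e W) (fun e he => (hW.2 e he).1)
          (fun e he => (hW.2 e he).2) he
        simpa only [hW.1] using this
    · exact fun h => (not_genuinelyNonlinear_and_linearlyDegenerate hW₀ h hj).elim
  -- the genuinely nonlinear case
  set h : ℝ × State m → State m := fun z => z.2 + z.1 • v z with hh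
  have hhC : ContDiffAt ℝ 1 h (0, W₀) := contDiffAt_snd.add (contDiffAt_fst.smul hJ.smooth_v)
  have hh0 : ∀ W, h (0, W) = W := fun W => by simp [hh]
  have hhc : Tendsto h (𝓝 (0, W₀)) (𝓝 W₀) := by
    have := hhC.continuousAt
    rwa [ContinuousAt, hh0] at this
  have hhd : ∀ W, ContDiffAt ℝ 1 v (0, W) → HasStrictFDerivAt h
      ((ContinuousLinearMap.fst ℝ ℝ (State m)).smulRight (v (0, W)) +
        ContinuousLinearMap.snd ℝ ℝ (State m)) (0, W) := by
    intro W hW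
    have h1 := (hasStrictFDerivAt_snd (𝕜 := ℝ) (E := ℝ) (F := State m) (p := (0, W))).add
      ((hasStrictFDerivAt_fst (𝕜 := ℝ) (E := ℝ) (F := State m) (p := (0, W))).smul
        (hW.hasStrictFDerivAt one_ne_zero))
    refine h1.congr_fderiv ?_
    ext z <;> simp
  -- Excess of the shock speed over the characteristic speed of the right state. Its slope at the
  -- base point is 1/2 - 1, so it is positive for t < 0: this is the right-hand Lax inequality.
  set D : ℝ × State m → ℝ := fun z => c z - S.lam j (h z) with hDdef
  have hlamh : ContDiffAt ℝ 1 (fun z => S.lam j (h z)) (0, W₀) := by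
    refine ContDiffAt.comp (g := S.lam j) (f := h) (0, W₀) ?_ hhC
    rw [hh0]; exact hJ.contDiffAt_lam
  have hDC : ContDiffAt ℝ 1 D (0, W₀) := hJ.smooth_c.sub hlamh
  have hcd : fderiv ℝ c (0, W₀) (1, 0) = 1 / 2 := by
    rw [hJ.deriv_speed, hj W₀ hW₀, mul_one]
  have hDd : fderiv ℝ D (0, W₀) (1, 0) = -(1 / 2) := by
    have h1 : HasDerivAt (fun t => S.lam j (h (t, W₀))) 1 0 := by
      have h2 : HasDerivAt (fun t => h (t, W₀)) (S.R j W₀) 0 := by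
        have := hasDerivAt_slice hhC
        rw [(hhd W₀ hJ.smooth_v).hasFDerivAt.fderiv] at this
        simpa [hJ.v_base] using this
      have h3 : HasFDerivAt (S.lam j) (fderiv ℝ (S.lam j) W₀) (h (0, W₀)) := by
        rw [hh0]; exact S.hasFDerivAt_lam j hW₀
      exact (h3.comp_hasDerivAt (0 : ℝ) h2).congr_deriv (hj W₀ hW₀)
    have h4 := (hasDerivAt_slice hDC).unique ((hasDerivAt_slice hJ.smooth_c).sub h1)
    rw [h4, hcd]; norm_num
  have hev1 : ∀ {G : Type} [NormedAddCommGroup G] [NormedSpace ℝ G] {f : ℝ × State m → G},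
      ContDiffAt ℝ 1 f (0, W₀) → ∀ᶠ z in 𝓝 ((0, W₀) : ℝ × State m), ContDiffAt ℝ 1 f z :=
    fun hf => hf.eventually (by simp)
  have hfdc : ∀ {f : ℝ × State m → ℝ}, ContDiffAt ℝ 1 f (0, W₀) →
      ContinuousAt (fun z => fderiv ℝ f z (1, 0)) (0, W₀) := fun hf =>
    (hf.continuousAt_fderiv one_ne_zero).clm_apply continuousAt_const
  have hpos : ∀ᶠ z in 𝓝 ((0, W₀) : ℝ × State m), 0 < fderiv ℝ c z (1, 0) :=
    (hfdc hJ.smooth_c).eventually (lt_mem_nhds (by simp [hcd]))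
  have hneg : ∀ᶠ z in 𝓝 ((0, W₀) : ℝ × State m), fderiv ℝ D z (1, 0) < 0 :=
    (hfdc hDC).eventually (gt_mem_nhds (by simp only [hDd]; norm_num))
  have hsnd : Tendsto (fun z : ℝ × State m => z.2) (𝓝 (0, W₀)) (𝓝 W₀) := continuous_snd.tendsto _
  have hlamc : ∀ i, Tendsto (S.lam i) (𝓝 W₀) (𝓝 (S.lam i W₀)) := fun i =>
    ((S.continuousOn_lam i).continuousAt hΩn)
  have hcc : Tendsto c (𝓝 (0, W₀)) (𝓝 (S.lam j W₀)) := by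
    have := hJ.smooth_c.continuousAt
    rwa [ContinuousAt, hJ.speed.self_of_nhds] at this
  have hlow : ∀ᶠ z in 𝓝 ((0, W₀) : ℝ × State m), ∀ i, i < j → S.lam i z.2 < c z := by
    refine eventually_all.2 fun i => ?_
    by_cases hij : i < j
    · filter_upwards [((hlamc i).comp hsnd).eventually_lt hcc (S.lam_strictMono W₀ hW₀ hij)]
        with z hz _ using hz
    · exact Eventually.of_forall fun z hz => absurd hz hij
  have hupp : ∀ᶠ z in 𝓝 ((0, W₀) : ℝ × State m), ∀ i, j < i → c z < S.lam i (h z) := by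
    refine eventually_all.2 fun i => ?_
    by_cases hij : j < i
    · filter_upwards [hcc.eventually_lt ((hlamc i).comp hhc) (S.lam_strictMono W₀ hW₀ hij)]
        with z hz _ using hz
    · exact Eventually.of_forall fun z hz => absurd hz hij
  have hbt : Tendsto b (𝓝 W₀) (𝓝 1) := by
    have := hbcont.self_of_nhds
    rwa [ContinuousAt, hJ.b_base] at this
  have hb2 : ∀ᶠ W in 𝓝 W₀, b W ∈ Ioo (1 / 2) 2 :=
    hbt.eventually (Ioo_mem_nhds (by norm_num) (by norm_num))
  obtain ⟨a, ha, hbox⟩ := Metric.eventually_nhds_iff_ball.1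
    ((((hev1 hJ.smooth_v).and (hev1 hJ.smooth_c)).and ((hev1 hhC).and (hev1 hDC))).and
      ((hJ.jump.and ((hhc.eventually hΩn).and (hsnd.eventually hΩn))).and
      ((hpos.and hneg).and (hlow.and hupp))))
  have hmemb : ∀ {t : ℝ} {W : State m}, t ∈ Ioo (-a) a → W ∈ Metric.ball W₀ a →
      ((t, W) : ℝ × State m) ∈ Metric.ball ((0 : ℝ), W₀) a := by
    intro t W ht hW
    rw [Metric.mem_ball, Prod.dist_eq, max_lt_iff]
    refine ⟨?_, hW⟩
    rw [Real.dist_eq, sub_zero]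
    exact abs_lt.2 ht
  have h0a : (0 : ℝ) ∈ Ioo (-a) a := ⟨by linarith, ha⟩
  set V : Set (State m) := {W | W ∈ Metric.ball W₀ a ∧ b W ∈ Ioo (1 / 2) 2 ∧
    c (0, W) = S.lam j W ∧ S.R j W = b W • v (0, W) ∧ ρ 0 W = W ∧ ∀ e ∈ Ioo (-δ) δ, ρ e W ∈ S.Ω ∧
      HasDerivAt (fun e => ρ e W) (S.R j (ρ e W)) e} with hVdef
  have hV : V ∈ 𝓝 W₀ := by
    filter_upwards [Metric.ball_mem_nhds W₀ ha, hb2, hJ.speed, hJ.direction, hρ]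
      with W h1 h2 h3 h4 h5 using ⟨h1, h2, h3, h4, h5.1, h5.2⟩
  -- Since b W < 2 on V, the bound |e| < a / 2 keeps b W * e in (-a, a).
  set δ' : ℝ := min δ (a / 2) with hδ'
  have hδ'0 : 0 < δ' := lt_min hδ (half_pos ha)
  have hsub : Ioo (-δ') δ' ⊆ Ioo (-δ) δ :=
    Ioo_subset_Ioo (neg_le_neg (min_le_left _ _)) (min_le_left _ _)
  have htime : ∀ W ∈ V, ∀ e ∈ Ioo (-δ') δ', b W * e ∈ Ioo (-a) a := by
    intro W hW e he
    have h1 : |e| < a / 2 := (abs_lt.2 he).trans_le (min_le_right _ _)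
    have h2 := hW.2.1
    refine abs_lt.1 ?_
    rw [abs_mul, abs_of_pos (by linarith [h2.1])]
    nlinarith [h2.1, h2.2, abs_nonneg e]
  have htime' : ∀ W ∈ V, ∀ e ∈ Ioo (-δ') 0, b W * e ∈ Ioo (-a) 0 := by
    intro W hW e he
    have h2 := hW.2.1.1
    exact ⟨(htime W hW e ⟨he.1, he.2.trans hδ'0⟩).1, by nlinarith [he.2]⟩
  have hshock : ∀ W ∈ V, ∀ t ∈ Ioo (-a) 0, S.IsLaxShock j W (h (t, W)) (c (t, W)) := by
    intro W hW t ht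
    have hta : t ∈ Ioo (-a) a := ⟨ht.1, ht.2.trans ha⟩
    obtain ⟨_, ⟨hj1, _, _⟩, _, hl, hu⟩ := hbox _ (hmemb hta hW.1)
    have hcm : StrictMonoOn (fun t => c (t, W)) (Ioo (-a) a) := by
      have hd : ∀ t ∈ Ioo (-a) a, HasDerivAt (fun t => c (t, W)) (fderiv ℝ c (t, W) (1, 0)) t :=
        fun t ht => hasDerivAt_slice (hbox _ (hmemb ht hW.1)).1.1.2
      refine strictMonoOn_of_deriv_pos (convex_Ioo _ _)
        (fun t ht => (hd t ht).continuousAt.continuousWithinAt) ?_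
      rw [interior_Ioo]
      intro t ht
      rw [(hd t ht).deriv]
      exact (hbox _ (hmemb ht hW.1)).2.2.1.1
    have hDm : StrictAntiOn (fun t => D (t, W)) (Ioo (-a) a) := by
      have hd : ∀ t ∈ Ioo (-a) a, HasDerivAt (fun t => D (t, W)) (fderiv ℝ D (t, W) (1, 0)) t :=
        fun t ht => hasDerivAt_slice (hbox _ (hmemb ht hW.1)).1.2.2
      refine strictAntiOn_of_deriv_neg (convex_Ioo _ _)
        (fun t ht => (hd t ht).continuousAt.continuousWithinAt) ?_
      rw [interior_Ioo]
      intro t ht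
      rw [(hd t ht).deriv]
      exact (hbox _ (hmemb ht hW.1)).2.2.1.2
    have hD0 : D (0, W) = 0 := by
      simp [hDdef, hh0, hW.2.2.1]
    refine ⟨?_, ?_, ?_, hl, hu⟩
    · rw [RankineHugoniot]
      simp only [hh] at hj1 ⊢
      rw [add_sub_cancel_left, hj1]
    · have : D (0, W) < D (t, W) := hDm hta h0a ht.2
      rw [hD0] at this
      simp only [hDdef] at this
      linarith
    · have := hcm hta h0a ht.2
      simp only [hW.2.2.1] at this
      exact this
  -- The shock branch has tangent v(0, W) while R = b v(0, ·), hence the factor b W in χ. In y each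
  -- branch keeps its smooth parameter, because b is only continuous, and τ converts it into the
  -- parameter of χ.
  refine ⟨fun e W => if e < 0 then h (b W * e, W) else ρ e W, fun e W => c (b W * e, W), V, δ',
    fun z => if z.1 < 0 then h z else y z, fun z => if z.1 < 0 then (b z.2)⁻¹ * z.1 else τ z,
    hV, hδ'0, ?_, ?_, ?_, ?_, ?_⟩
  · have hcurve : ∀ W ∈ V, (∀ e ∈ Ioo (-δ') δ', HasDerivAt
        (fun e => if e < 0 then h (b W * e, W) else ρ e W)
        (if e < 0 then b W • fderiv ℝ h (b W * e, W) (1, 0) else S.R j (ρ e W)) e) ∧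
        ContDiffOn ℝ 1 (fun e => if e < 0 then h (b W * e, W) else ρ e W) (Ioo (-δ') δ') := by
      intro W hW
      refine contDiffOn_ite_neg (fun e he => (hW.2.2.2.2.2 e (hsub he)).2) (fun e he => ?_)
        ((hRcont W hW.2.2.2.2.2).mono hsub) ?_ ?_ ?_
      · have d1 := hasDerivAt_slice (hbox _ (hmemb (htime W hW e he) hW.1)).1.2.1
        have d2 : HasDerivAt (fun e => b W * e) (b W) e := by
          simpa using (hasDerivAt_id e).const_mul (b W)
        exact HasDerivAt.scomp (g₁ := fun t => h (t, W)) (h := fun e => b W * e) e d1 d2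
      · intro e he
        have d1 := (hbox _ (hmemb (htime W hW e he) hW.1)).1.2.1
        refine ContinuousAt.continuousWithinAt ?_
        refine ContinuousAt.const_smul (ContinuousAt.clm_apply ?_ continuousAt_const) (b W)
        exact ContinuousAt.comp (g := fderiv ℝ h) (f := fun e : ℝ => (b W * e, W))
          (d1.continuousAt_fderiv one_ne_zero) (by fun_prop)
      · simp [hh0, hW.2.2.2.2.1]
      · have d1 := (hbox _ (hmemb h0a hW.1)).1.1.1
        rw [mul_zero, (hhd W d1).hasFDerivAt.fderiv, hW.2.2.2.2.1, hW.2.2.2.1]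
        simp
    refine ⟨fun W hW e he => ?_, fun W hW => ?_, fun W hW => (hcurve W hW).2, fun W hW => ?_,
      fun _ W hW e he => ?_, fun _ W hW e he => ?_, fun hc => ?_, fun hc => ?_⟩
    · by_cases he0 : e < 0
      · simp only [he0, if_true]
        exact (hbox _ (hmemb (htime W hW e he) hW.1)).2.1.2.1
      · simp only [he0, if_false]
        exact (hW.2.2.2.2.2 e (hsub he)).1
    · simp [hW.2.2.2.2.1]
    · have := (hcurve W hW).1 0 ⟨by linarith, hδ'0⟩
      simpa [hW.2.2.2.2.1] using this
    · have := (hcurve W hW).1 e ⟨by linarith [he.1], he.2⟩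
      simpa [not_lt.2 he.1.le] using this
    · simp only [he.2, if_true]
      exact hshock W hW _ (htime' W hW e he)
    · exact (not_genuinelyNonlinear_and_linearlyDegenerate hW₀ hj hc).elim
    · exact (not_genuinelyNonlinear_and_linearlyDegenerate hW₀ hj hc).elim
  · intro _ W hW e he η q hηq
    simp only [he.2, if_true]
    refine hηq.shock_inequality (a := a) (γ := fun t => h (t, W))
      (γ' := fun t => fderiv ℝ h (t, W) (1, 0)) (c := fun t => c (t, W))
      (c' := fun t => fderiv ℝ c (t, W) (1, 0)) (hbox _ (hmemb h0a hW.1)).2.1.2.2 (hh0 W)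
      (fun t ht => (hbox _ (hmemb ht hW.1)).2.1.2.1)
      (fun t ht => hasDerivAt_slice (hbox _ (hmemb ht hW.1)).1.2.1)
      (fun t ht => hasDerivAt_slice (hbox _ (hmemb ht hW.1)).1.1.2)
      (fun t ht => (hbox _ (hmemb ht hW.1)).2.2.1.1.le) (fun t ht => ?_) (htime' W hW e he)
    have := (hbox _ (hmemb ht hW.1)).2.1.1
    rw [RankineHugoniot]
    simp only [hh] at this ⊢
    rw [add_sub_cancel_left, this]
  · refine hasStrictFDerivAt_ite_neg hy ?_ ?_
    · have := hhd W₀ hJ.smooth_v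
      rwa [hJ.v_base] at this
    · filter_upwards [hy0] with W hW
      rw [hW, hh0]
  · have hbz : ∀ᶠ z in 𝓝 ((0, W₀) : ℝ × State m), b z.2 ∈ Ioo (1 / 2) 2 := hsnd.eventually hb2
    have hz0 : Tendsto (fun z : ℝ × State m => (b z.2)⁻¹ * z.1) (𝓝 (0, W₀)) (𝓝 0) := by
      have t1 : Tendsto (fun z : ℝ × State m => (b z.2)⁻¹) (𝓝 (0, W₀)) (𝓝 (1 : ℝ)⁻¹) :=
        (hbt.comp hsnd).inv₀ one_ne_zero
      have t2 : Tendsto (fun z : ℝ × State m => z.1) (𝓝 (0, W₀)) (𝓝 0) := continuous_fst.tendsto _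
      simpa using t1.mul t2
    exact hz0.if' hτ
  · filter_upwards [hyρ, hsnd.eventually hb2] with z hz hb
    have hbpos : 0 < b z.2 := by linarith [hb.1]
    -- τ z is negative exactly when z.1 is, so χ (τ z) selects the same branch as y.
    by_cases hz0 : z.1 < 0
    · have : (b z.2)⁻¹ * z.1 < 0 := mul_neg_of_pos_of_neg (inv_pos.2 hbpos) hz0
      simp only [hz0, if_true, this]
      rw [mul_inv_cancel_left₀ hbpos.ne']
    · simp only [hz0, if_false, not_lt.2 (hz.2 (not_lt.1 hz0))]
      exact hz.1

end HyperbolicSystem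

end PartialRiemann

/-! ### Weak formulation: jumps and centered fans. -/

namespace PartialRiemann

section WeakForm

variable {φ : ℝ × ℝ → ℝ}

theorem hasDerivAt_fst_slice (hφ : ContDiff ℝ 1 φ) (x t : ℝ) :
    HasDerivAt (fun x => φ (x, t)) (fderiv ℝ φ (x, t) (1, 0)) x :=
  HasFDerivAt.comp_hasDerivAt (l := φ) (f := fun x : ℝ => (x, t)) x
    (hφ.differentiable one_ne_zero _).hasFDerivAt
    ((hasDerivAt_id x).prodMk (hasDerivAt_const _ _))

theorem hasDerivAt_snd_slice (hφ : ContDiff ℝ 1 φ) (x t : ℝ) :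
    HasDerivAt (fun t => φ (x, t)) (fderiv ℝ φ (x, t) (0, 1)) t :=
  HasFDerivAt.comp_hasDerivAt (l := φ) (f := fun t : ℝ => (x, t)) t
    (hφ.differentiable one_ne_zero _).hasFDerivAt
    ((hasDerivAt_const _ _).prodMk (hasDerivAt_id t))

theorem hasCompactSupport_comp_of_leftInverse {X Y : Type*} [TopologicalSpace X]
    [TopologicalSpace Y] [R1Space X] {f : Y → ℝ} (hf : HasCompactSupport f) {g : X → Y} {p : Y → X}
    (hp : Continuous p) (hpg : ∀ x, p (g x) = x) : HasCompactSupport fun x => f (g x) := by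
  refine HasCompactSupport.intro (hf.isCompact.image hp) fun x hx => ?_
  by_contra h
  exact hx ⟨g x, subset_tsupport _ h, hpg x⟩

theorem hasCompactSupport_fst_slice (hc : HasCompactSupport φ) (t : ℝ) :
    HasCompactSupport fun x => φ (x, t) :=
  hasCompactSupport_comp_of_leftInverse hc (g := fun x => (x, t)) continuous_fst fun _ => rfl

theorem hasCompactSupport_snd_slice (hc : HasCompactSupport φ) (x : ℝ) :
    HasCompactSupport fun t => φ (x, t) :=
  hasCompactSupport_comp_of_leftInverse hc (g := fun t => (x, t)) continuous_snd fun _ => rfl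

theorem integrable_fderiv_apply (hφ : ContDiff ℝ 1 φ) (hc : HasCompactSupport φ) (e : ℝ × ℝ) :
    Integrable fun z => fderiv ℝ φ z e := by
  refine Continuous.integrable_of_hasCompactSupport
    ((hφ.continuous_fderiv one_ne_zero).clm_apply continuous_const) ?_
  exact (hc.fderiv ℝ).comp_left (g := fun T : ℝ × ℝ →L[ℝ] ℝ => T e) rfl

theorem integral_prod_Ioi_fderiv_snd (hφ : ContDiff ℝ 1 φ) (hc : HasCompactSupport φ) (A : Set ℝ) :
    ∫ z in A ×ˢ Ioi (0 : ℝ), fderiv ℝ φ z (0, 1) = -∫ x in A, φ (x, 0) := by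
  rw [Measure.volume_eq_prod, setIntegral_prod _ (by
    rw [← Measure.volume_eq_prod]; exact (integrable_fderiv_apply hφ hc _).integrableOn),
    ← integral_neg]
  congr 1
  ext x
  have h := HasCompactSupport.integral_Ioi_deriv_eq (f := fun t => φ (x, t)) (by fun_prop)
    (hasCompactSupport_snd_slice hc x) 0
  rw [← h]
  congr 1
  ext t
  exact (hasDerivAt_snd_slice hφ x t).deriv.symm

theorem integral_prod_Ioi_fderiv_fst (hφ : ContDiff ℝ 1 φ) (hc : HasCompactSupport φ) :
    ∫ z in Ioi (0 : ℝ) ×ˢ Ioi (0 : ℝ), fderiv ℝ φ z (1, 0) = -∫ t in Ioi 0, φ (0, t) := by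
  rw [Measure.volume_eq_prod, ← Measure.prod_restrict, integral_prod_symm _ (by
    rw [Measure.prod_restrict, ← Measure.volume_eq_prod]
    exact (integrable_fderiv_apply hφ hc _).integrableOn), ← integral_neg]
  congr 1
  ext t
  have h := HasCompactSupport.integral_Ioi_deriv_eq (f := fun x => φ (x, t)) (by fun_prop)
    (hasCompactSupport_fst_slice hc t) 0
  rw [← h]
  congr 1
  ext x
  exact (hasDerivAt_fst_slice hφ x t).deriv.symm

theorem integral_univ_prod_Ioi_fderiv_fst (hφ : ContDiff ℝ 1 φ) (hc : HasCompactSupport φ) :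
    ∫ z in univ ×ˢ Ioi (0 : ℝ), fderiv ℝ φ z (1, 0) = 0 := by
  rw [Measure.volume_eq_prod, ← Measure.prod_restrict, integral_prod_symm _ (by
    rw [Measure.prod_restrict, ← Measure.volume_eq_prod]
    exact (integrable_fderiv_apply hφ hc _).integrableOn), Measure.restrict_univ]
  refine integral_eq_zero_of_ae (Eventually.of_forall fun t => ?_)
  refine integral_eq_zero_of_hasDerivAt_of_integrable (fun x => hasDerivAt_fst_slice hφ x t) ?_ ?_
  · have hd : (fun x => fderiv ℝ φ (x, t) (1, 0)) = deriv fun x => φ (x, t) :=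
      funext fun x => (hasDerivAt_fst_slice hφ x t).deriv.symm
    refine Continuous.integrable_of_hasCompactSupport ?_ ?_
    · have := hφ.continuous_fderiv one_ne_zero
      fun_prop
    · rw [hd]; exact (hasCompactSupport_fst_slice hc t).deriv
  · exact Continuous.integrable_of_hasCompactSupport (by have := hφ.continuous; fun_prop)
      (hasCompactSupport_fst_slice hc t)

/-- The shear `(x, t) ↦ (x + s t, t)`. -/
def shear (s : ℝ) : ℝ × ℝ ≃ₜ ℝ × ℝ where
  toFun z := (z.1 + s * z.2, z.2)
  invFun z := (z.1 - s * z.2, z.2)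
  left_inv z := by simp
  right_inv z := by simp
  continuous_toFun := by fun_prop
  continuous_invFun := by fun_prop

theorem measurePreserving_shear (s : ℝ) : MeasurePreserving (shear s) := by
  have h1 : MeasurePreserving (fun p : ℝ × ℝ => (id p.1, p.2 + s * p.1))
      (volume.prod volume) (volume.prod volume) := by
    refine MeasurePreserving.skew_product (g := fun t x => x + s * t) (MeasurePreserving.id _)
      ?_ ?_
    · exact Measurable.add measurable_snd (measurable_fst.const_mul s)
    · exact Eventually.of_forall fun t => map_add_right_eq_self volume (s * t)
  have h2 := (Measure.measurePreserving_swap (μ := (volume : Measure ℝ))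
    (ν := (volume : Measure ℝ))).comp (h1.comp Measure.measurePreserving_swap)
  exact h2

/-- The shear straightens the line x = s t, so that integrals to its right reduce to a quadrant,
where Fubini and the fundamental theorem of calculus apply. -/
theorem setIntegral_halfPlane (s : ℝ) (f : ℝ × ℝ → ℝ) :
    ∫ z in {z : ℝ × ℝ | 0 < z.2 ∧ s * z.2 < z.1}, f z =
      ∫ z in Ioi (0 : ℝ) ×ˢ Ioi (0 : ℝ), f (z.1 + s * z.2, z.2) := by
  have h := (measurePreserving_shear s).setIntegral_preimage_emb
    (shear s).measurableEmbedding f {z : ℝ × ℝ | 0 < z.2 ∧ s * z.2 < z.1}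
  rw [← h]
  have hset : shear s ⁻¹' {z : ℝ × ℝ | 0 < z.2 ∧ s * z.2 < z.1} = Ioi (0 : ℝ) ×ˢ Ioi (0 : ℝ) := by
    ext z
    simp [shear, and_comm]
  rw [hset]
  rfl

theorem fderiv_comp_shear (hφ : ContDiff ℝ 1 φ) (s : ℝ) (z e : ℝ × ℝ) :
    fderiv ℝ (fun z : ℝ × ℝ => φ (z.1 + s * z.2, z.2)) z e =
      fderiv ℝ φ (z.1 + s * z.2, z.2) (e.1 + s * e.2, e.2) := by
  let L : ℝ × ℝ →L[ℝ] ℝ × ℝ :=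
    (ContinuousLinearMap.fst ℝ ℝ ℝ + s • ContinuousLinearMap.snd ℝ ℝ ℝ).prod
      (ContinuousLinearMap.snd ℝ ℝ ℝ)
  have h1 : HasFDerivAt (fun z : ℝ × ℝ => φ (L z)) ((fderiv ℝ φ (L z)).comp L) z :=
    HasFDerivAt.comp (g := φ) (f := L) z (hφ.differentiable one_ne_zero _).hasFDerivAt
      L.hasFDerivAt
  have h2 : (fun z : ℝ × ℝ => φ (z.1 + s * z.2, z.2)) = fun z => φ (L z) := rfl
  rw [h2, h1.fderiv]
  rfl

theorem contDiff_comp_shear (hφ : ContDiff ℝ 1 φ) (s : ℝ) :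
    ContDiff ℝ 1 fun z : ℝ × ℝ => φ (z.1 + s * z.2, z.2) := by
  fun_prop

theorem hasCompactSupport_comp_shear (hc : HasCompactSupport φ) (s : ℝ) :
    HasCompactSupport fun z : ℝ × ℝ => φ (z.1 + s * z.2, z.2) :=
  hc.comp_homeomorph (shear s)

theorem integral_halfPlane_fderiv_fst (hφ : ContDiff ℝ 1 φ) (hc : HasCompactSupport φ) (s : ℝ) :
    ∫ z in {z : ℝ × ℝ | 0 < z.2 ∧ s * z.2 < z.1}, fderiv ℝ φ z (1, 0) =
      -∫ t in Ioi 0, φ (s * t, t) := by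
  have := integral_prod_Ioi_fderiv_fst (contDiff_comp_shear hφ s) (hasCompactSupport_comp_shear hc s)
  simp only [fderiv_comp_shear hφ, mul_zero, add_zero, zero_add] at this
  rw [setIntegral_halfPlane, this]

/-- ∂ₜ + s ∂ₓ is tangent to the line x = s t and becomes ∂ₜ after the shear, so the only boundary
contribution is at t = 0. -/
theorem integral_halfPlane_fderiv_direction (hφ : ContDiff ℝ 1 φ) (hc : HasCompactSupport φ)
    (s : ℝ) :
    ∫ z in {z : ℝ × ℝ | 0 < z.2 ∧ s * z.2 < z.1},
      (fderiv ℝ φ z (0, 1) + s * fderiv ℝ φ z (1, 0)) = -∫ x in Ioi 0, φ (x, 0) := by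
  have := integral_prod_Ioi_fderiv_snd (contDiff_comp_shear hφ s) (hasCompactSupport_comp_shear hc s)
    (Ioi 0)
  simp only [fderiv_comp_shear hφ, mul_zero, add_zero, zero_add, mul_one] at this
  rw [setIntegral_halfPlane, ← this]
  congr 1
  ext z
  have : ((s, 1) : ℝ × ℝ) = (0, 1) + s • (1, 0) := by simp
  rw [this, map_add, map_smul, smul_eq_mul]

variable {E : Type*} [NormedAddCommGroup E] [NormedSpace ℝ E]

/-- The weak form of `∂ₜ G + ∂ₓ K` on `t > 0`, with initial datum `g₀`, tested against `φ`, is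
well defined and equal to `A`. -/
structure HasAction (φ : ℝ × ℝ → ℝ) (G K : ℝ × ℝ → E) (g₀ : ℝ → E) (A : E) : Prop where
  integrable : IntegrableOn
    (fun z => fderiv ℝ φ z (0, 1) • G z + fderiv ℝ φ z (1, 0) • K z) {z : ℝ × ℝ | 0 < z.2}
  integrable_zero : Integrable fun x => φ (x, 0) • g₀ x
  eq : (∫ z in {z : ℝ × ℝ | 0 < z.2},
      (fderiv ℝ φ z (0, 1) • G z + fderiv ℝ φ z (1, 0) • K z)) + ∫ x, φ (x, 0) • g₀ x = A

theorem measurableSet_upper : MeasurableSet {z : ℝ × ℝ | 0 < z.2} :=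
  measurableSet_lt measurable_const measurable_snd

theorem HasAction.add {G G' K K' : ℝ × ℝ → E} {g₀ g₀' : ℝ → E} {A A' : E}
    (h : HasAction φ G K g₀ A) (h' : HasAction φ G' K' g₀' A') :
    HasAction φ (fun z => G z + G' z) (fun z => K z + K' z) (fun x => g₀ x + g₀' x) (A + A') := by
  have e1 : (fun z => fderiv ℝ φ z (0, 1) • (G z + G' z) + fderiv ℝ φ z (1, 0) • (K z + K' z)) =
      fun z => (fderiv ℝ φ z (0, 1) • G z + fderiv ℝ φ z (1, 0) • K z) +
        (fderiv ℝ φ z (0, 1) • G' z + fderiv ℝ φ z (1, 0) • K' z) := by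
    ext z; simp only [smul_add]; abel
  have e2 : (fun x => φ (x, 0) • (g₀ x + g₀' x)) =
      fun x => φ (x, 0) • g₀ x + φ (x, 0) • g₀' x := by
    ext z; simp only [smul_add]
  refine ⟨?_, ?_, ?_⟩
  · rw [e1]; exact h.integrable.add h'.integrable
  · rw [e2]; exact h.integrable_zero.add h'.integrable_zero
  · rw [e1, e2, integral_add h.integrable h'.integrable,
      integral_add h.integrable_zero h'.integrable_zero, ← h.eq, ← h'.eq]
    abel

theorem HasAction.congr {G G' K K' : ℝ × ℝ → E} {g₀ g₀' : ℝ → E} {A A' : E}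
    (h : HasAction φ G K g₀ A) (hG : ∀ z : ℝ × ℝ, 0 < z.2 → G' z = G z)
    (hK : ∀ z : ℝ × ℝ, 0 < z.2 → K' z = K z) (h₀ : ∀ x, g₀' x = g₀ x) (hA : A' = A) :
    HasAction φ G' K' g₀' A' := by
  have e : EqOn (fun z => fderiv ℝ φ z (0, 1) • G z + fderiv ℝ φ z (1, 0) • K z)
      (fun z => fderiv ℝ φ z (0, 1) • G' z + fderiv ℝ φ z (1, 0) • K' z)
      {z : ℝ × ℝ | 0 < z.2} := by
    intro z hz
    simp only [hG z hz, hK z hz]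
  obtain rfl : g₀' = g₀ := funext h₀
  subst hA
  refine ⟨h.integrable.congr_fun e measurableSet_upper, h.integrable_zero, ?_⟩
  rw [← h.eq, setIntegral_congr_fun measurableSet_upper e]

theorem hasAction_const (hφ : ContDiff ℝ 1 φ) (hc : HasCompactSupport φ) [CompleteSpace E]
    (g f : E) : HasAction φ (fun _ => g) (fun _ => f) (fun _ => g) 0 := by
  have i1 := integrable_fderiv_apply hφ hc (0, 1)
  have i2 := integrable_fderiv_apply hφ hc (1, 0)
  have i0 : Integrable fun x => φ (x, 0) := Continuous.integrable_of_hasCompactSupport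
    (by have := hφ.continuous; fun_prop) (hasCompactSupport_fst_slice hc 0)
  refine ⟨((i1.smul_const g).add (i2.smul_const f)).integrableOn, i0.smul_const g, ?_⟩
  have hset : {z : ℝ × ℝ | 0 < z.2} = univ ×ˢ Ioi (0 : ℝ) := by ext z; simp
  rw [integral_add (i1.smul_const g).integrableOn (i2.smul_const f).integrableOn,
    integral_smul_const, integral_smul_const, integral_smul_const, hset,
    integral_univ_prod_Ioi_fderiv_fst hφ hc, integral_prod_Ioi_fderiv_snd hφ hc]
  simp

theorem HasAction.zero : HasAction φ (fun _ => (0 : E)) (fun _ => 0) (fun _ => 0) 0 :=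
  ⟨by simp, by simp, by simp⟩

theorem HasAction.sum {ι : Type*} (s : Finset ι) {G K : ι → ℝ × ℝ → E} {g₀ : ι → ℝ → E}
    {A : ι → E} (h : ∀ i ∈ s, HasAction φ (G i) (K i) (g₀ i) (A i)) :
    HasAction φ (fun z => ∑ i ∈ s, G i z) (fun z => ∑ i ∈ s, K i z) (fun x => ∑ i ∈ s, g₀ i x)
      (∑ i ∈ s, A i) := by
  classical
  induction s using Finset.induction_on with
  | empty => simpa using HasAction.zero
  | insert i s hi ih =>
    simp only [Finset.sum_insert hi]
    exact (h i (Finset.mem_insert_self i s)).add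
      (ih fun k hk => h k (Finset.mem_insert_of_mem hk))

theorem measurableSet_halfPlane (s : ℝ) :
    MeasurableSet {z : ℝ × ℝ | 0 < z.2 ∧ s * z.2 < z.1} :=
  measurableSet_upper.inter (measurableSet_lt (measurable_snd.const_mul s) measurable_fst)

theorem setIntegral_upper_ite (s : ℝ) (f : ℝ × ℝ → E) :
    ∫ z in {z : ℝ × ℝ | 0 < z.2}, (if s < z.1 / z.2 then f z else 0) =
      ∫ z in {z : ℝ × ℝ | 0 < z.2 ∧ s * z.2 < z.1}, f z := by
  rw [← integral_indicator measurableSet_upper, ← integral_indicator (measurableSet_halfPlane s)]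
  congr 1
  ext z
  by_cases hz : 0 < z.2
  · by_cases hs : s * z.2 < z.1
    · simp [indicator, hz, hs, lt_div_iff₀ hz]
    · simp [indicator, hz, hs, lt_div_iff₀ hz]
  · simp [indicator, hz]

theorem measurableSet_lt_div (s : ℝ) : MeasurableSet {z : ℝ × ℝ | s < z.1 / z.2} :=
  measurableSet_lt measurable_const (measurable_fst.div measurable_snd)

theorem integrable_pos_part (hφ : ContDiff ℝ 1 φ) (hc : HasCompactSupport φ) (g : E) :
    Integrable fun x => φ (x, 0) • (if 0 < x then g else 0) := by
  have i0 : Integrable fun x => φ (x, 0) := Continuous.integrable_of_hasCompactSupport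
    (by have := hφ.continuous; fun_prop) (hasCompactSupport_fst_slice hc 0)
  have := (i0.smul_const g).indicator (measurableSet_Ioi (a := (0 : ℝ)))
  refine this.congr (Eventually.of_forall fun x => ?_)
  by_cases hx : 0 < x <;> simp [indicator, hx]

theorem integral_pos_part [CompleteSpace E] (φ : ℝ × ℝ → ℝ) (g : E) :
    ∫ x, φ (x, 0) • (if 0 < x then g else 0) = (∫ x in Ioi 0, φ (x, 0)) • g := by
  rw [← integral_smul_const, ← integral_indicator measurableSet_Ioi]
  congr 1
  ext x
  by_cases hx : 0 < x <;> simp [indicator, hx]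

/-- The weak form for a discontinuity of speed `s`. -/
theorem hasAction_jump (hφ : ContDiff ℝ 1 φ) (hc : HasCompactSupport φ) [CompleteSpace E]
    (s : ℝ) (g f : E) :
    HasAction φ (fun z => if s < z.1 / z.2 then g else 0) (fun z => if s < z.1 / z.2 then f else 0)
      (fun x => if 0 < x then g else 0) ((∫ t in Ioi 0, φ (s * t, t)) • (s • g - f)) := by
  have i1 := integrable_fderiv_apply hφ hc (0, 1)
  have i2 := integrable_fderiv_apply hφ hc (1, 0)
  -- Splitting g ∂ₜφ + f ∂ₓφ into g (∂ₜ + s ∂ₓ)φ, which cancels the initial term, and (f - s g) ∂ₓφ,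
  -- which leaves the Rankine–Hugoniot defect.
  have e : (fun z : ℝ × ℝ => fderiv ℝ φ z (0, 1) • (if s < z.1 / z.2 then g else 0) +
      fderiv ℝ φ z (1, 0) • (if s < z.1 / z.2 then f else 0)) = fun z =>
      if s < z.1 / z.2 then
        ((fderiv ℝ φ z (0, 1) + s * fderiv ℝ φ z (1, 0)) • g +
          fderiv ℝ φ z (1, 0) • (f - s • g)) else 0 := by
    ext z
    by_cases hs : s < z.1 / z.2
    · simp only [hs, if_true, add_smul, smul_sub, mul_smul]
      rw [smul_comm s]
      abel
    · simp [hs]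
  have i3 : Integrable fun z => fderiv ℝ φ z (0, 1) + s * fderiv ℝ φ z (1, 0) :=
    i1.add (i2.const_mul s)
  refine ⟨?_, integrable_pos_part hφ hc g, ?_⟩
  · rw [e]
    have := ((i3.smul_const g).add (i2.smul_const (f - s • g))).indicator
      (measurableSet_lt_div s)
    refine (this.congr (Eventually.of_forall fun z => ?_)).integrableOn
    by_cases hs : s < z.1 / z.2 <;> simp [indicator, hs]
  · rw [e, setIntegral_upper_ite, integral_pos_part, integral_add
      (i3.smul_const g).integrableOn (i2.smul_const (f - s • g)).integrableOn,
      integral_smul_const, integral_smul_const, integral_halfPlane_fderiv_direction hφ hc s,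
      integral_halfPlane_fderiv_fst hφ hc, neg_smul, neg_smul, smul_sub, smul_sub]
    abel

/-- The weak form for a centered rarefaction. -/
theorem hasAction_fan (hφ : ContDiff ℝ 1 φ) (hc : HasCompactSupport φ) [CompleteSpace E]
    {a b : ℝ} (hab : a ≤ b) {G K G' : ℝ → E} (hG : ∀ s ∈ Icc a b, HasDerivAt G (G' s) s)
    (hK : ∀ s ∈ Icc a b, HasDerivAt K (s • G' s) s) (hG' : ContinuousOn G' (Icc a b)) :
    HasAction φ (fun z => G (max a (min b (z.1 / z.2))) - G a)
      (fun z => K (max a (min b (z.1 / z.2))) - K a)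
      (fun x => if 0 < x then G b - G a else 0) 0 := by
  have i1 := integrable_fderiv_apply hφ hc (0, 1)
  have i2 := integrable_fderiv_apply hφ hc (1, 0)
  have hK' : ContinuousOn (fun s => s • G' s) (Icc a b) := continuousOn_id.smul hG'
  have iG : IntegrableOn G' (Ioc a b) := hG'.integrableOn_Icc.mono_set Ioc_subset_Icc_self
  have iK : IntegrableOn (fun s => s • G' s) (Ioc a b) :=
    hK'.integrableOn_Icc.mono_set Ioc_subset_Icc_self
  -- representation of the profile by the primitive of its derivative
  have hrep : ∀ {P P' : ℝ → E}, (∀ s ∈ Icc a b, HasDerivAt P (P' s) s) →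
      ContinuousOn P' (Icc a b) → ∀ ξ : ℝ,
      ∫ s in Ioc a b, (if s < ξ then P' s else 0) = P (max a (min b ξ)) - P a := by
    intro P P' hP hP' ξ
    have hcl : max a (min b ξ) ∈ Icc a b := ⟨le_max_left _ _, max_le hab (min_le_left _ _)⟩
    have hsub : Icc a (max a (min b ξ)) ⊆ Icc a b := Icc_subset_Icc_right hcl.2
    have h1 : ∫ s in a..(max a (min b ξ)), P' s = P (max a (min b ξ)) - P a := by
      refine intervalIntegral.integral_eq_sub_of_hasDerivAt (fun s hs => hP s ?_) ?_
      · rw [uIcc_of_le hcl.1] at hs; exact hsub hs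
      · refine ContinuousOn.intervalIntegrable ?_
        rw [uIcc_of_le hcl.1]; exact hP'.mono hsub
    rw [← h1, intervalIntegral.integral_of_le hcl.1,
      ← integral_indicator measurableSet_Ioc, ← integral_indicator measurableSet_Ioc]
    refine integral_congr_ae ?_
    -- At s = ξ the strict inequality s < ξ and the closed end of the interval may disagree.
    filter_upwards [Measure.ae_ne volume ξ] with s hs
    by_cases h2 : s ∈ Ioc a b
    · by_cases h3 : s < ξ
      · have : s ∈ Ioc a (max a (min b ξ)) := ⟨h2.1, le_max_of_le_right (le_min h2.2 h3.le)⟩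
        simp [indicator, h2, h3, this]
      · have h4 : s ∉ Ioc a (max a (min b ξ)) := by
          rintro ⟨h5, h6⟩
          rcases le_max_iff.1 h6 with h7 | h7
          · exact absurd h5 (not_lt.2 h7)
          · exact h3 (lt_of_le_of_ne (h7.trans (min_le_right _ _)) hs)
        simp only [indicator, h2, h3, h4, if_true, if_false]
    · have h4 : s ∉ Ioc a (max a (min b ξ)) := fun h5 => h2 ⟨h5.1, h5.2.trans hcl.2⟩
      simp only [indicator, h2, h4, if_false]
  -- the integrand on the product space
  set f : ℝ × ℝ → ℝ → E := fun z s => if s < z.1 / z.2 then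
    fderiv ℝ φ z (0, 1) • G' s + fderiv ℝ φ z (1, 0) • (s • G' s) else 0 with hf
  have hf_int : Integrable (Function.uncurry f)
      ((volume.restrict {z : ℝ × ℝ | 0 < z.2}).prod (volume.restrict (Ioc a b))) := by
    have j1 := (i1.integrableOn (s := {z : ℝ × ℝ | 0 < z.2})).smul_prod iG
    have j2 := (i2.integrableOn (s := {z : ℝ × ℝ | 0 < z.2})).smul_prod iK
    have hm : MeasurableSet {w : (ℝ × ℝ) × ℝ | w.2 < w.1.1 / w.1.2} :=
      measurableSet_lt measurable_snd
        ((measurable_fst.comp measurable_fst).div (measurable_snd.comp measurable_fst))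
    refine ((j1.add j2).indicator hm).congr (Eventually.of_forall fun w => ?_)
    by_cases hw : w.2 < w.1.1 / w.1.2 <;> simp [indicator, hf, Function.uncurry, hw]
  have hinner : ∀ z : ℝ × ℝ, ∫ s in Ioc a b, f z s =
      fderiv ℝ φ z (0, 1) • (G (max a (min b (z.1 / z.2))) - G a) +
        fderiv ℝ φ z (1, 0) • (K (max a (min b (z.1 / z.2))) - K a) := by
    intro z
    have hind : ∀ {P' : ℝ → E} (r : ℝ), IntegrableOn P' (Ioc a b) →
        IntegrableOn (fun s => r • (if s < z.1 / z.2 then P' s else 0)) (Ioc a b) := by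
      intro P' r hP'
      refine ((hP'.smul r).indicator (measurableSet_Iio (a := z.1 / z.2))).congr
        (Eventually.of_forall fun s => ?_)
      by_cases hs : s < z.1 / z.2 <;> simp [indicator, hs]
    rw [← hrep hG hG' (z.1 / z.2), ← hrep hK hK' (z.1 / z.2), ← integral_smul, ← integral_smul,
      ← integral_add (hind _ iG) (hind _ iK)]
    congr 1
    ext s
    by_cases hs : s < z.1 / z.2 <;> simp [hf, hs]
  refine ⟨?_, integrable_pos_part hφ hc _, ?_⟩
  · refine hf_int.integral_prod_left.congr (Eventually.of_forall fun z => ?_)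
    exact hinner z
  -- The infinitesimal jump G' s ds of speed s satisfies Rankine–Hugoniot exactly, the flux jump
  -- being s G' s ds; only its initial contribution survives.
  · have houter : ∀ s : ℝ, ∫ z in {z : ℝ × ℝ | 0 < z.2}, f z s =
        (-∫ x in Ioi 0, φ (x, 0)) • G' s := by
      intro s
      rw [← integral_halfPlane_fderiv_direction hφ hc s, ← integral_smul_const,
        ← setIntegral_upper_ite]
      congr 1
      ext z
      by_cases hs : s < z.1 / z.2
      · simp only [hf, hs, if_true, add_smul, mul_smul]
        rw [smul_comm s]
      · simp [hf, hs]
    have hGb : ∫ s in Ioc a b, G' s = G b - G a := by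
      rw [← intervalIntegral.integral_of_le hab]
      refine intervalIntegral.integral_eq_sub_of_hasDerivAt (fun s hs => hG s ?_) ?_
      · rwa [uIcc_of_le hab] at hs
      · refine ContinuousOn.intervalIntegrable ?_
        rwa [uIcc_of_le hab]
    have hswap := integral_integral_swap hf_int
    simp only [hinner, houter] at hswap
    rw [hswap, integral_smul, hGb, integral_pos_part, neg_smul, neg_add_cancel]

end WeakForm

end PartialRiemann

/-! ### Solving for the wave strengths. -/

namespace PartialRiemann

theorem sum_ite_lt_succ {G : Type*} [AddCommMonoid G] {p : ℕ} (f : Fin p → G) (k : Fin p) :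
    (∑ j : Fin p, if j.val < k.val + 1 then f j else 0) =
      (∑ j : Fin p, if j.val < k.val then f j else 0) + f k := by
  have h : f k = ∑ j : Fin p, if j = k then f j else 0 := by simp
  rw [h, ← Finset.sum_add_distrib]
  refine Finset.sum_congr rfl fun j _ => ?_
  rcases lt_trichotomy j k with h | h | h
  · have h1 : j.val < k.val := h
    simp [h1, h1.trans (Nat.lt_succ_self _), h.ne]
  · simp [h]
  · have h1 : k.val < j.val := h
    simp [not_lt.2 h1.le, show ¬ j.val < k.val + 1 by omega, h.ne']

section WaveStrengths

variable {E : Type*} {p : ℕ}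

/-- The states obtained from `x.2` by following successively the curves `y j` up to the
parameters `x.1 j`. -/
def successiveStates (y : Fin p → ℝ × E → E) (i : Fin (p + 1)) (x : (Fin p → ℝ) × E) : E :=
  Fin.induction (motive := fun _ => E) x.2 (fun j w => y j (x.1 j, w)) i

theorem successiveStates_succ (y : Fin p → ℝ × E → E) (j : Fin p) (x : (Fin p → ℝ) × E) :
    successiveStates y j.succ x = y j (x.1 j, successiveStates y j.castSucc x) := by
  simp [successiveStates, Fin.induction_succ]

variable [NormedAddCommGroup E] [NormedSpace ℝ E]

/-- Every curve has the identity as its derivative in the state, so to first order the increments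
along the r j simply add. -/
theorem hasStrictFDerivAt_successiveStates {y : Fin p → ℝ × E → E} {r : Fin p → E} {W₀ : E}
    (hy : ∀ j, HasStrictFDerivAt (y j) ((ContinuousLinearMap.fst ℝ ℝ E).smulRight (r j) +
      ContinuousLinearMap.snd ℝ ℝ E) (0, W₀)) (hy₀ : ∀ j, y j (0, W₀) = W₀) (i : Fin (p + 1)) :
    successiveStates y i (0, W₀) = W₀ ∧ ∃ D : (Fin p → ℝ) × E →L[ℝ] E,
      HasStrictFDerivAt (successiveStates y i) D (0, W₀) ∧
      ∀ x, D x = x.2 + ∑ j : Fin p, if j.val < i.val then x.1 j • r j else 0 := by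
  induction i using Fin.induction with
  | zero =>
    refine ⟨rfl, ContinuousLinearMap.snd ℝ _ _, ?_, fun x => by simp⟩
    exact hasStrictFDerivAt_snd
  | succ k ih =>
    obtain ⟨h0, D, hD, hDx⟩ := ih
    refine ⟨by rw [successiveStates_succ, h0]; exact hy₀ k, ?_⟩
    let P : (Fin p → ℝ) × E →L[ℝ] ℝ :=
      (ContinuousLinearMap.proj k).comp (ContinuousLinearMap.fst ℝ (Fin p → ℝ) E)
    have h1 : HasStrictFDerivAt (fun x : (Fin p → ℝ) × E => (x.1 k, successiveStates y k.castSucc x))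
        (P.prod D) (0, W₀) := P.hasStrictFDerivAt.prodMk hD
    have h2 : HasStrictFDerivAt (y k) ((ContinuousLinearMap.fst ℝ ℝ E).smulRight (r k) +
        ContinuousLinearMap.snd ℝ ℝ E) ((fun x : (Fin p → ℝ) × E =>
          (x.1 k, successiveStates y k.castSucc x)) (0, W₀)) := by
      simp only [h0]
      exact hy k
    refine ⟨_, (h2.comp (0, W₀) h1).congr_of_eventuallyEq
      (Eventually.of_forall fun x => (successiveStates_succ y k x).symm), fun x => ?_⟩
    rw [Fin.val_succ, sum_ite_lt_succ, ← add_assoc, ← Fin.val_castSucc k, ← hDx x]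
    simp [P, add_comm]

/-- Local solvability of `Ψ = 0` at the end of a chain of `p` curves. -/
theorem eventually_exists_successive_states [CompleteSpace E] {y : Fin p → ℝ × E → E}
    {r : Fin p → E} {W₀ : E}
    (hy : ∀ j, HasStrictFDerivAt (y j) ((ContinuousLinearMap.fst ℝ ℝ E).smulRight (r j) +
      ContinuousLinearMap.snd ℝ ℝ E) (0, W₀)) (hy₀ : ∀ j, y j (0, W₀) = W₀)
    {Ψ : E → Fin p → ℝ} {Ψ' : E →L[ℝ] (Fin p → ℝ)} (hΨ : HasStrictFDerivAt Ψ Ψ' W₀)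
    (hΨ₀ : Ψ W₀ = 0) (hsurj : ∀ a, ∃ t : Fin p → ℝ, Ψ' (∑ j, t j • r j) = a)
    {N : Fin p → Set (ℝ × E)} (hN : ∀ j, N j ∈ 𝓝 (0, W₀)) {M : Set E} (hM : M ∈ 𝓝 W₀) :
    ∀ᶠ W in 𝓝 W₀, ∃ (t : Fin p → ℝ) (w : Fin (p + 1) → E), w 0 = W ∧
      (∀ j, w j.succ = y j (t j, w j.castSucc)) ∧ (∀ j, (t j, w j.castSucc) ∈ N j) ∧
      (∀ i, w i ∈ M) ∧ Ψ (w (Fin.last p)) = 0 := by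
  have hst := fun i => hasStrictFDerivAt_successiveStates hy hy₀ i
  have hcont : ∀ i, Tendsto (successiveStates y i) (𝓝 (0, W₀)) (𝓝 W₀) := by
    intro i
    obtain ⟨h0, D, hD, _⟩ := hst i
    have := hD.continuousAt
    rwa [ContinuousAt, h0] at this
  obtain ⟨hl0, D, hD, hDx⟩ := hst (Fin.last p)
  have hΓ : HasStrictFDerivAt
      (fun x : (Fin p → ℝ) × E => (Ψ (successiveStates y (Fin.last p) x), x.2))
      ((Ψ'.comp D).prod (ContinuousLinearMap.snd ℝ _ _)) (0, W₀) := by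
    refine HasStrictFDerivAt.prodMk ?_ hasStrictFDerivAt_snd
    refine HasStrictFDerivAt.comp (g := Ψ) (f := successiveStates y (Fin.last p)) (0, W₀) ?_ hD
    rwa [hl0]
  have hrange : ((Ψ'.comp D).prod (ContinuousLinearMap.snd ℝ (Fin p → ℝ) E)).range = ⊤ := by
    refine LinearMap.range_eq_top.2 ?_
    rintro ⟨a, w⟩
    obtain ⟨t, ht⟩ := hsurj (a - Ψ' w)
    refine ⟨(t, w), ?_⟩
    simp [hDx, ht]
  -- With W kept as second output, openness at the base point says that (0, W) is attained for every
  -- W near W₀, with parameters in any prescribed neighbourhood. No uniqueness of t is needed.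
  have hmap := hΓ.map_nhds_eq_of_surj hrange
  have hgood : ∀ᶠ x in 𝓝 ((0, W₀) : (Fin p → ℝ) × E),
      (∀ j, (x.1 j, successiveStates y j.castSucc x) ∈ N j) ∧
        ∀ i, successiveStates y i x ∈ M := by
    refine (eventually_all.2 fun j => ?_).and (eventually_all.2 fun i => (hcont i).eventually hM)
    have h1 : Tendsto (fun x : (Fin p → ℝ) × E => x.1 j) (𝓝 (0, W₀)) (𝓝 0) :=
      Continuous.tendsto' (by fun_prop) _ _ rfl
    exact (h1.prodMk_nhds (hcont j.castSucc)).eventually (hN j)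
  have himage := image_mem_map (m := fun x : (Fin p → ℝ) × E =>
    (Ψ (successiveStates y (Fin.last p) x), x.2)) hgood
  rw [hmap, hl0, hΨ₀] at himage
  have hslice : Tendsto (fun W : E => ((0 : Fin p → ℝ), W)) (𝓝 W₀) (𝓝 (0, W₀)) :=
    (Continuous.prodMk_right (0 : Fin p → ℝ)).tendsto W₀
  filter_upwards [hslice.eventually himage] with W hW
  obtain ⟨x, ⟨hx1, hx2⟩, hx3⟩ := hW
  simp only [Prod.mk.injEq] at hx3
  exact ⟨x.1, fun i => successiveStates y i x, hx3.2, fun j => successiveStates_succ y j x, hx1,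
    hx2, hx3.1⟩

end WaveStrengths

/-- Transversality of the directions `R k`, `k < p`, to the manifold. -/
theorem exists_fderiv_sum_eq {m p : ℕ} (hp : p ≤ m) {L : State m →L[ℝ] State m}
    (hL : Function.Surjective L) {R tang : Fin m → State m}
    (htang : ∀ k : Fin m, p ≤ k.val → L (tang k) = EuclideanSpace.single k 1)
    {b : Module.Basis (Fin m) ℝ (State m)} (hb : ∀ k, b k = if k.val < p then R k else tang k)
    (a : Fin p → ℝ) :
    ∃ t : Fin p → ℝ, ∀ i : Fin p,
      L (∑ j : Fin p, t j • R (Fin.castLE hp j)) (Fin.castLE hp i) = a i := by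
  -- The vector x realizes a in the first p coordinates of L x. Its components on `tang k`, p ≤ k,
  -- do not affect those coordinates, so its components on the R k already do the job.
  obtain ⟨x, hx⟩ := hL (WithLp.toLp 2 fun k : Fin m => if h : k.val < p then a ⟨k, h⟩ else 0)
  refine ⟨fun j => b.repr x (Fin.castLE hp j), fun i => ?_⟩
  have hsplit : x = (∑ j : Fin p, b.repr x (Fin.castLE hp j) • R (Fin.castLE hp j)) +
      ∑ k : Fin m, if k.val < p then 0 else b.repr x k • tang k := by
    have h1 : ∑ j : Fin p, b.repr x (Fin.castLE hp j) • R (Fin.castLE hp j) =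
        ∑ k : Fin m, if k.val < p then b.repr x k • R k else 0 := by
      rw [← Finset.sum_filter]
      refine Finset.sum_bij (fun j _ => Fin.castLE hp j) ?_ ?_ ?_ ?_
      · intro j _; simp
      · intro j _ j' _ h; exact Fin.castLE_injective hp h
      · intro k hk
        have hk' : k.val < p := by simpa using hk
        exact ⟨⟨k, hk'⟩, Finset.mem_univ _, by ext; rfl⟩
      · intro j _; rfl
    rw [h1, ← Finset.sum_add_distrib]
    conv_lhs => rw [← b.sum_repr x]
    refine Finset.sum_congr rfl fun k _ => ?_
    by_cases hk : k.val < p <;> simp [hb, hk]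
  have hzero : L (∑ k : Fin m, if k.val < p then 0 else b.repr x k • tang k) (Fin.castLE hp i) = 0 := by
    rw [map_sum]
    simp only [WithLp.ofLp_sum, Finset.sum_apply]
    refine Finset.sum_eq_zero fun k _ => ?_
    by_cases hk : k.val < p
    · simp [hk]
    · have hne : Fin.castLE hp i ≠ k := by
        intro h
        rw [← h] at hk
        exact hk i.isLt
      simp [hk, htang k (not_lt.1 hk), hne]
  have hxi : L x (Fin.castLE hp i) = a i := by
    rw [hx]; simp
  rw [hsplit, map_add, PiLp.add_apply, hzero, add_zero] at hxi
  exact hxi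

end PartialRiemann

/-! ### Elementary waves and their superposition. -/

namespace PartialRiemann

theorem sum_ite_lt_sub {G : Type*} [AddCommGroup G] {p : ℕ} (w : Fin (p + 1) → G)
    (i : Fin (p + 1)) :
    (∑ j : Fin p, if j.val < i.val then w j.succ - w j.castSucc else 0) = w i - w 0 := by
  induction i using Fin.induction with
  | zero => simp
  | succ k ih =>
    rw [Fin.val_succ, sum_ite_lt_succ, ← Fin.val_castSucc k, ih]
    abel

/-- Telescoping along a chain of which only the `k`-th step is incomplete. -/
theorem add_sum_sub_eq {X G : Type*} [AddCommGroup G] {p : ℕ} (h : X → G) {w : Fin (p + 1) → X}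
    {x : Fin p → X} {k : Fin p} (hlt : ∀ i, i < k → x i = w i.succ)
    (hgt : ∀ i, k < i → x i = w i.castSucc) :
    h (w 0) + ∑ i, (h (x i) - h (w i.castSucc)) = h (x k) := by
  have h1 : ∀ i : Fin p, h (x i) - h (w i.castSucc) =
      (if i.val < k.castSucc.val then h (w i.succ) - h (w i.castSucc) else 0) +
        if i = k then h (x i) - h (w i.castSucc) else 0 := by
    intro i
    rcases lt_trichotomy i k with h2 | h2 | h2
    · simp [h2, hlt i h2, h2.ne]
    · simp [h2]
    · simp [h2.not_gt, hgt i h2, h2.ne']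
  rw [Finset.sum_congr rfl fun i _ => h1 i, Finset.sum_add_distrib,
    sum_ite_lt_sub (fun i => h (w i)) k.castSucc, Finset.sum_ite_eq' Finset.univ k]
  simp

namespace HyperbolicSystem

variable {m : ℕ} (S : HyperbolicSystem m)

/-- `C` is a self-similar wave between the states `u` (left) and `v` (right), with speeds
in `[a, b]`, which satisfies the conservation law and the entropy inequalities in the weak sense. -/
structure IsElementaryWave (u v : State m) (a b : ℝ) (C : ℝ → State m) : Prop where
  le : a ≤ b
  left : ∀ ξ ≤ a, C ξ = u
  right : ∀ ξ, b < ξ → C ξ = v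
  measurable : Measurable C
  bounded : ∃ K : Set (State m), IsCompact K ∧ K ⊆ S.Ω ∧ ∀ ξ, C ξ ∈ K
  weak : ∀ φ : ℝ × ℝ → ℝ, ContDiff ℝ 1 φ → HasCompactSupport φ →
    HasAction φ (fun z => C (z.1 / z.2) - u) (fun z => S.F (C (z.1 / z.2)) - S.F u)
      (fun x => if 0 < x then v - u else 0) 0
  entropy : ∀ η q : State m → ℝ, S.IsEntropyPair η q →
    ∀ φ : ℝ × ℝ → ℝ, ContDiff ℝ 1 φ → HasCompactSupport φ → (∀ z, 0 ≤ φ z) →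
    ∃ A, 0 ≤ A ∧ HasAction φ (fun z => η (C (z.1 / z.2)) - η u) (fun z => q (C (z.1 / z.2)) - q u)
      (fun x => if 0 < x then η v - η u else 0) A

variable {S}

/-- In `hasAction_jump` the Rankine–Hugoniot defect vanishes for F, and for (η, q) it is the
nonnegative entropy dissipation weighted by ∫ φ(s t, t) dt. -/
theorem isElementaryWave_jump {u v : State m} {s : ℝ} (hu : u ∈ S.Ω) (hv : v ∈ S.Ω)
    (hjump : S.RankineHugoniot u v s)
    (hent : ∀ η q, S.IsEntropyPair η q → q v - q u ≤ s * (η v - η u)) :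
    S.IsElementaryWave u v s s fun ξ => if s < ξ then v else u := by
  have hC : ∀ {G : Type} [AddCommGroup G] (h : State m → G) (ξ : ℝ),
      h (if s < ξ then v else u) - h u = if s < ξ then h v - h u else 0 := by
    intro G _ h ξ
    by_cases hs : s < ξ <;> simp [hs]
  refine ⟨le_rfl, fun ξ hξ => if_neg (not_lt.2 hξ), fun ξ hξ => if_pos hξ,
    Measurable.ite measurableSet_Ioi measurable_const measurable_const,
    ⟨{u, v}, (Set.toFinite _).isCompact, ?_, fun ξ => ?_⟩, fun φ hφ hc => ?_,
    fun η q hηq φ hφ hc hpos => ?_⟩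
  · rintro x (rfl | rfl)
    · exact hu
    · exact hv
  · by_cases hs : s < ξ <;> simp [hs]
  · refine (hasAction_jump hφ hc s (v - u) (S.F v - S.F u)).congr (fun z _ => ?_) (fun z _ => ?_)
      (fun _ => rfl) ?_
    · exact hC id _
    · exact hC S.F _
    · rw [hjump, sub_self, smul_zero]
  · refine ⟨_, ?_, (hasAction_jump hφ hc s (η v - η u) (q v - q u)).congr (fun z _ => hC η _)
      (fun z _ => hC q _) (fun _ => rfl) rfl⟩
    rw [smul_eq_mul, smul_eq_mul]
    exact mul_nonneg (setIntegral_nonneg measurableSet_Ioi fun t _ => hpos _)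
      (sub_nonneg.2 (hent η q hηq))

/-- Where λ(γ s) = s, the chain rule gives (F ∘ γ)' = s γ' and (q ∘ γ)' = s (η ∘ γ)', the relations
required by `hasAction_fan`; entropy is therefore conserved. -/
theorem isElementaryWave_fan {j : Fin m} {a b : ℝ} (hab : a ≤ b) {γ : ℝ → State m}
    (hΩ : ∀ s ∈ Icc a b, γ s ∈ S.Ω) (hγ : ∀ s ∈ Icc a b, HasDerivAt γ (S.R j (γ s)) s)
    (hlam : ∀ s ∈ Icc a b, S.lam j (γ s) = s) :
    S.IsElementaryWave (γ a) (γ b) a b fun ξ => γ (max a (min b ξ)) := by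
  have hcl : ∀ ξ, max a (min b ξ) ∈ Icc a b := fun ξ =>
    ⟨le_max_left _ _, max_le hab (min_le_left _ _)⟩
  have hγc : ContinuousOn γ (Icc a b) := fun s hs => (hγ s hs).continuousAt.continuousWithinAt
  have hRc : ContinuousOn (fun s => S.R j (γ s)) (Icc a b) := (S.R_continuous j).comp hγc hΩ
  refine ⟨hab, fun ξ hξ => ?_, fun ξ hξ => ?_, ?_, ⟨γ '' Icc a b, isCompact_Icc.image_of_continuousOn
    hγc, ?_, fun ξ => ⟨_, hcl ξ, rfl⟩⟩, fun φ hφ hc => ?_, fun η q hηq φ hφ hc hpos => ?_⟩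
  · rw [max_eq_left ((min_le_right _ _).trans hξ)]
  · rw [min_eq_left hξ.le, max_eq_right hab]
  · exact (hγc.comp_continuous (by fun_prop) hcl).measurable
  · rintro _ ⟨s, hs, rfl⟩
    exact hΩ s hs
  · refine hasAction_fan hφ hc hab (G := γ) (K := fun s => S.F (γ s)) hγ (fun s hs => ?_) hRc
    have := (S.hasFDerivAt_F (hΩ s hs)).comp_hasDerivAt s (hγ s hs)
    rwa [S.eigen j _ (hΩ s hs), hlam s hs] at this
  · refine ⟨0, le_rfl, hasAction_fan hφ hc hab (G := fun s => η (γ s)) (K := fun s => q (γ s))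
      (G' := fun s => fderiv ℝ η (γ s) (S.R j (γ s))) (fun s hs => ?_) (fun s hs => ?_) ?_⟩
    · exact (hηq.hasFDerivAt_entropy (hΩ s hs)).comp_hasDerivAt s (hγ s hs)
    · have := (hηq.hasFDerivAt_flux (hΩ s hs)).comp_hasDerivAt s (hγ s hs)
      rwa [ContinuousLinearMap.comp_apply, S.eigen j _ (hΩ s hs), hlam s hs, map_smul] at this
    · exact ((hηq.entropy_smooth.continuousOn_fderiv_of_isOpen S.isOpen le_rfl).comp hγc
        hΩ).clm_apply hRc

/-- The profile made of the successive waves `C j`. -/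
def superposition {p : ℕ} (w : Fin (p + 1) → State m) (C : Fin p → ℝ → State m) (ξ : ℝ) :
    State m :=
  w 0 + ∑ j, (C j ξ - w j.castSucc)

section Superposition

variable {p : ℕ} {w : Fin (p + 1) → State m} {a b : Fin p → ℝ} {C : Fin p → ℝ → State m}

theorem superposition_eq (hC : ∀ j, S.IsElementaryWave (w j.castSucc) (w j.succ) (a j) (b j) (C j))
    {ξ : ℝ} {k : Fin p} (hlt : ∀ i, i < k → b i < ξ) (hgt : ∀ i, k < i → ξ ≤ a i) :
    superposition w C ξ = C k ξ ∧ ∀ {G : Type} [AddCommGroup G] (h : State m → G),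
      h (w 0) + ∑ i, (h (C i ξ) - h (w i.castSucc)) = h (C k ξ) := by
  have h1 : ∀ i, i < k → C i ξ = w i.succ := fun i hi => (hC i).right ξ (hlt i hi)
  have h2 : ∀ i, k < i → C i ξ = w i.castSucc := fun i hi => (hC i).left ξ (hgt i hi)
  exact ⟨add_sum_sub_eq id h1 h2, fun h => add_sum_sub_eq h h1 h2⟩

/-- With at most one unfinished wave at ξ the sum telescopes, also after applying any h to the
states. This makes the nonlinear quantities F, η and q additive over the waves. -/
theorem superposition_cases
    (hC : ∀ j, S.IsElementaryWave (w j.castSucc) (w j.succ) (a j) (b j) (C j))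
    (hord : ∀ i j, i < j → b i < a j) (ξ : ℝ) :
    (superposition w C ξ = w 0 ∨ ∃ k, superposition w C ξ = C k ξ) ∧
    ∀ {G : Type} [AddCommGroup G] (h : State m → G),
      h (superposition w C ξ) = h (w 0) + ∑ i, (h (C i ξ) - h (w i.castSucc)) := by
  classical
  by_cases hall : ∀ j, ξ ≤ a j
  · have h1 : ∀ i, C i ξ = w i.castSucc := fun i => (hC i).left ξ (hall i)
    have h2 : superposition w C ξ = w 0 := by simp [superposition, h1]
    exact ⟨Or.inl h2, fun h => by simp [h1, h2]⟩
  · push Not at hall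
    obtain ⟨j, hj⟩ := hall
    -- The last wave begun before ξ: the ordering of the speeds finishes all earlier ones.
    obtain ⟨k, hk⟩ := (Finset.univ.filter fun j => a j < ξ).exists_maximal ⟨j, by simpa using hj⟩
    have hkξ : a k < ξ := by simpa using hk.prop
    have h := superposition_eq hC (ξ := ξ) (k := k) (fun i hi => (hord i k hi).trans hkξ)
      fun i hi => by
        by_contra hcon
        exact hk.not_gt (by simpa using hcon) hi
    exact ⟨Or.inr ⟨k, h.1⟩, fun g => by rw [h.1, h.2]⟩

theorem superposition_const
    (hC : ∀ j, S.IsElementaryWave (w j.castSucc) (w j.succ) (a j) (b j) (C j)) (i : Fin (p + 1))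
    {ξ : ℝ} (hlt : ∀ j : Fin p, j.val < i.val → b j < ξ)
    (hgt : ∀ j : Fin p, i.val ≤ j.val → ξ < a j) : superposition w C ξ = w i := by
  induction i using Fin.cases with
  | zero =>
    have h1 : ∀ i, C i ξ = w i.castSucc := fun i => (hC i).left ξ (hgt i (Nat.zero_le _)).le
    simp [superposition, h1]
  | succ k =>
    rw [(superposition_eq hC (k := k) (fun i hi => hlt i ?_) fun i hi => (hgt i ?_).le).1,
      (hC k).right ξ (hlt k (by simp))]
    · rw [Fin.val_succ]; exact Nat.lt_succ_of_lt hi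
    · rw [Fin.val_succ]; exact hi

/-- The constant state w 0 has zero action and the initial datum telescopes like the profile, so the
total action is the sum of those of the waves. -/
theorem isEntropySolution_superposition
    (hC : ∀ j, S.IsElementaryWave (w j.castSucc) (w j.succ) (a j) (b j) (C j))
    (hord : ∀ i j, i < j → b i < a j) (hw : ∀ i, w i ∈ S.Ω) :
    S.IsEntropySolution fun x t => if 0 < t then superposition w C (x / t) else
      if 0 < x then w (Fin.last p) else w 0 := by
  have hzero : ∀ {G : Type} [AddCommGroup G] (h : State m → G) (x : ℝ),
      h (if 0 < x then w (Fin.last p) else w 0) =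
        h (w 0) + ∑ j : Fin p, if 0 < x then h (w j.succ) - h (w j.castSucc) else 0 := by
    intro G _ h x
    by_cases hx : 0 < x
    · have h1 := sum_ite_lt_sub (fun i => h (w i)) (Fin.last p)
      simp only [Fin.val_last, Fin.is_lt, if_true] at h1
      simp [hx, h1]
    · simp [hx]
  have hmeas : Measurable (superposition w C) := by
    unfold superposition
    exact measurable_const.add (Finset.measurable_fun_sum _ fun j _ =>
      (hC j).measurable.sub measurable_const)
  choose K hK hKΩ hCK using fun j => (hC j).bounded
  refine ⟨?_, ⟨(⋃ j, K j) ∪ range w, ?_, ?_, ?_⟩, fun φ hφ hc => ?_,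
    fun η q hηq φ hφ hc hpos => ?_⟩
  · refine Measurable.ite measurableSet_upper
      (hmeas.comp (measurable_fst.div measurable_snd)) ?_
    exact Measurable.ite (measurableSet_lt measurable_const measurable_fst) measurable_const
      measurable_const
  · exact (isCompact_iUnion hK).union (finite_range w).isCompact
  · exact union_subset (iUnion_subset hKΩ) (range_subset_iff.2 hw)
  · intro x t _
    by_cases ht : 0 < t
    · simp only [ht, if_true]
      rcases (superposition_cases hC hord (x / t)).1 with h | ⟨k, h⟩
      · rw [h]; exact Or.inr ⟨0, rfl⟩
      · rw [h]; exact Or.inl (mem_iUnion.2 ⟨k, hCK k _⟩)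
    · by_cases hx : 0 < x
      · simp only [ht, hx, if_true, if_false]; exact Or.inr ⟨_, rfl⟩
      · simp only [ht, hx, if_false]; exact Or.inr ⟨_, rfl⟩
  · have hA := (hasAction_const hφ hc (w 0) (S.F (w 0))).add
      (HasAction.sum Finset.univ fun j _ => (hC j).weak φ hφ hc)
    have hB := hA.congr (A' := 0)
      (G' := fun z => if 0 < z.2 then superposition w C (z.1 / z.2) else
        if 0 < z.1 then w (Fin.last p) else w 0)
      (K' := fun z => S.F (if 0 < z.2 then superposition w C (z.1 / z.2) else
        if 0 < z.1 then w (Fin.last p) else w 0))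
      (g₀' := fun x => if 0 < x then w (Fin.last p) else w 0)
      (fun z hz => by rw [if_pos hz]; rfl)
      (fun z hz => by rw [if_pos hz]; exact (superposition_cases hC hord _).2 S.F)
      (fun x => hzero id x) (by simp)
    simpa only [lt_irrefl, if_false] using hB.eq
  · choose A hA0 hA using fun j => (hC j).entropy η q hηq φ hφ hc hpos
    have hA := (hasAction_const hφ hc (η (w 0)) (q (w 0))).add
      (HasAction.sum Finset.univ fun j _ => hA j)
    have hB := hA.congr (A' := ∑ j, A j)
      (G' := fun z => η (if 0 < z.2 then superposition w C (z.1 / z.2) else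
        if 0 < z.1 then w (Fin.last p) else w 0))
      (K' := fun z => q (if 0 < z.2 then superposition w C (z.1 / z.2) else
        if 0 < z.1 then w (Fin.last p) else w 0))
      (g₀' := fun x => η (if 0 < x then w (Fin.last p) else w 0))
      (fun z hz => by rw [if_pos hz]; exact (superposition_cases hC hord _).2 η)
      (fun z hz => by rw [if_pos hz]; exact (superposition_cases hC hord _).2 q)
      (fun x => hzero η x) (by simp)
    have hnn : 0 ≤ ∑ j, A j := Finset.sum_nonneg fun j _ => hA0 j
    rw [← hB.eq] at hnn
    simpa only [lt_irrefl, if_false, smul_eq_mul] using hnn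

end Superposition

end HyperbolicSystem

end PartialRiemann

/-! ### From wave curves to elementary waves, and separation of the speeds. -/

namespace PartialRiemann

namespace HyperbolicSystem

variable {m : ℕ} {S : HyperbolicSystem m}

theorem IsWaveCurve.mono {j : Fin m} {V V' : Set (State m)} {δ δ' : ℝ}
    {χ : ℝ → State m → State m} {s : ℝ → State m → ℝ} (h : S.IsWaveCurve j V δ χ s)
    (hV : V' ⊆ V) (hδ : δ' ≤ δ) : S.IsWaveCurve j V' δ' χ s := by
  have hsub : Ioo (-δ') δ' ⊆ Ioo (-δ) δ := Ioo_subset_Ioo (neg_le_neg hδ) hδ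
  exact ⟨fun W hW e he => h.mem W (hV hW) e (hsub he), fun W hW => h.zero W (hV hW),
    fun W hW => (h.regular W (hV hW)).mono hsub, fun W hW => h.tangent W (hV hW),
    fun hj W hW e he => h.rarefaction hj W (hV hW) e ⟨he.1, he.2.trans_le hδ⟩,
    fun hj W hW e he => h.shock hj W (hV hW) e ⟨(neg_le_neg hδ).trans_lt he.1, he.2⟩,
    fun hj W hW e he => h.contact_curve hj W (hV hW) e (hsub he),
    fun hj W hW e he => h.contact hj W (hV hW) e (hsub he)⟩

theorem IsWaveCurve.subset {j : Fin m} {V : Set (State m)} {δ : ℝ}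
    {χ : ℝ → State m → State m} {s : ℝ → State m → ℝ} (h : S.IsWaveCurve j V δ χ s)
    (hδ : 0 < δ) : V ⊆ S.Ω := fun W hW => by
  have := h.mem W hW 0 ⟨neg_lt_zero.2 hδ, hδ⟩
  rwa [h.zero W hW] at this

/-- Along the curve of a linearly degenerate field the entropy flux balances the entropy. -/
theorem IsWaveCurve.contact_entropy {j : Fin m} {V : Set (State m)} {δ : ℝ}
    {χ : ℝ → State m → State m} {s : ℝ → State m → ℝ} (h : S.IsWaveCurve j V δ χ s)
    (hj : S.LinearlyDegenerate j) {W : State m} (hW : W ∈ V) {e : ℝ} (he : e ∈ Ioo (-δ) δ)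
    {η q : State m → ℝ} (hηq : S.IsEntropyPair η q) :
    q (χ e W) - q W = S.lam j W * (η (χ e W) - η W) := by
  have h0 : (0 : ℝ) ∈ Ioo (-δ) δ := ⟨by linarith [he.1, he.2], by linarith [he.1, he.2]⟩
  have key := eq_of_hasDerivAt_zero (f := fun e => q (χ e W) - S.lam j W * η (χ e W))
    (convex_Ioo _ _) (fun t ht => ?_) h0 he
  · rw [h.zero W hW] at key
    linarith
  · have hΩ := h.mem W hW t ht
    have d1 := (hηq.hasFDerivAt_flux hΩ).comp_hasDerivAt t (h.contact_curve hj W hW t ht)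
    have d2 := ((hηq.hasFDerivAt_entropy hΩ).comp_hasDerivAt t
      (h.contact_curve hj W hW t ht)).const_mul (S.lam j W)
    refine (d1.sub d2).congr_deriv ?_
    rw [ContinuousLinearMap.comp_apply, S.eigen j _ hΩ, (h.contact hj W hW t ht).speed_eq,
      map_smul, smul_eq_mul, sub_self]

/-- The wave of parameter `e` of a field, issued from the left state `W`. -/
theorem IsWaveCurve.exists_isElementaryWave {j : Fin m} {V : Set (State m)} {δ : ℝ}
    {χ : ℝ → State m → State m} {s : ℝ → State m → ℝ} (h : S.IsWaveCurve j V δ χ s)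
    (hj : S.GenuinelyNonlinear j ∨ S.LinearlyDegenerate j)
    (hent : S.GenuinelyNonlinear j → ∀ W ∈ V, ∀ e ∈ Ioo (-δ) 0, ∀ η q, S.IsEntropyPair η q →
      q (χ e W) - q W ≤ s e W * (η (χ e W) - η W))
    {W : State m} (hW : W ∈ V) {e : ℝ} (he : e ∈ Ioo (-δ) δ) :
    ∃ C : ℝ → State m, S.IsElementaryWave W (χ e W) (S.speedMin j e (s e W) W)
        (S.speedMax j e (s e W) (χ e W)) C ∧
      ∀ ξ ∈ Ioo (S.speedMin j e (s e W) W) (S.speedMax j e (s e W) (χ e W)),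
        C ξ = χ (ξ - S.speedMin j e (s e W) W) W := by
  have hδ : 0 < δ := by linarith [he.1, he.2]
  have hWΩ := h.subset hδ hW
  have hχΩ := h.mem W hW e he
  rcases hj with hj | hj
  · by_cases he0 : e < 0
    · have h1 : S.speedMin j e (s e W) W = s e W := if_pos ⟨hj, he0⟩
      have h2 : S.speedMax j e (s e W) (χ e W) = s e W := if_pos ⟨hj, he0⟩
      rw [h1, h2]
      refine ⟨_, isElementaryWave_jump hWΩ hχΩ (h.shock hj W hW e ⟨he.1, he0⟩).jump
        (hent hj W hW e ⟨he.1, he0⟩), fun ξ hξ => ?_⟩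
      exact absurd (hξ.1.trans hξ.2) (lt_irrefl _)
    · have h1 : S.speedMin j e (s e W) W = S.lam j W := if_neg fun hh => he0 hh.2
      have h2 : S.speedMax j e (s e W) (χ e W) = S.lam j (χ e W) := if_neg fun hh => he0 hh.2
      have he0 : 0 ≤ e := not_lt.1 he0
      have hsub : ∀ t ∈ Icc 0 e, t ∈ Ioo (-δ) δ := fun t ht =>
        ⟨by linarith [ht.1], ht.2.trans_lt he.2⟩
      have hd : ∀ t ∈ Icc 0 e, HasDerivAt (fun t => χ t W) (S.R j (χ t W)) t := by
        intro t ht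
        -- `rarefaction` covers positive parameters only; at 0 the two-sided derivative is
        -- `tangent`.
        rcases eq_or_lt_of_le ht.1 with h3 | h3
        · rw [← h3, h.zero W hW]; exact h.tangent W hW
        · exact h.rarefaction hj W hW t ⟨h3, ht.2.trans_lt he.2⟩
      have hlam : ∀ t ∈ Icc 0 e, S.lam j (χ t W) = S.lam j W + t := by
        intro t ht
        have := lam_integralCurve hj (γ := fun t => χ t W) (fun t ht => h.mem W hW t (hsub t ht))
          (fun t ht => (hd t ht).continuousAt.continuousWithinAt)
          (fun t ht => hd t (Ioo_subset_Icc_self ht)) ht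
        simpa only [h.zero W hW, sub_zero] using this
      have h3 : S.lam j (χ e W) = S.lam j W + e := hlam e ⟨he0, le_rfl⟩
      rw [h1, h2, h3]
      set μ := S.lam j W with hμ
      have hmem : ∀ ξ ∈ Icc μ (μ + e), ξ - μ ∈ Icc 0 e := fun ξ hξ =>
        ⟨by linarith [hξ.1], by linarith [hξ.2]⟩
      have hfan := isElementaryWave_fan (S := S) (j := j) (a := μ) (b := μ + e) (by linarith)
        (γ := fun ξ => χ (ξ - μ) W)
        (fun ξ hξ => h.mem W hW _ (hsub _ (hmem ξ hξ)))
        (fun ξ hξ => by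
          have := HasDerivAt.scomp (g₁ := fun t => χ t W) (h := fun ξ : ℝ => ξ - μ) ξ
            (hd _ (hmem ξ hξ)) ((hasDerivAt_id ξ).sub_const μ)
          rw [one_smul] at this
          exact this)
        (fun ξ hξ => by rw [hlam _ (hmem ξ hξ)]; ring)
      simp only [sub_self, add_sub_cancel_left, h.zero W hW] at hfan
      refine ⟨_, hfan, fun ξ hξ => ?_⟩
      rw [min_eq_right hξ.2.le, max_eq_right hξ.1.le]
  · have hn : ¬ S.GenuinelyNonlinear j := fun hh =>
      not_genuinelyNonlinear_and_linearlyDegenerate hWΩ hh hj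
    have h1 : S.speedMin j e (s e W) W = S.lam j W := if_neg fun hh => hn hh.1
    have h2 : S.speedMax j e (s e W) (χ e W) = S.lam j (χ e W) := if_neg fun hh => hn hh.1
    have hcont := h.contact hj W hW e he
    rw [h1, h2, hcont.speed_eq]
    refine ⟨_, isElementaryWave_jump hWΩ hχΩ hcont.jump fun η q hηq =>
      (h.contact_entropy hj hW he hηq).le, fun ξ hξ => ?_⟩
    exact absurd (hξ.1.trans hξ.2) (lt_irrefl _)

/-- A shock is slower than the characteristic speed on its left, and any other wave ends at the one
on its right, so bounding both end states bounds the wave. -/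
theorem IsWaveCurve.speedMax_lt {j : Fin m} {V : Set (State m)} {δ : ℝ}
    {χ : ℝ → State m → State m} {s : ℝ → State m → ℝ} (h : S.IsWaveCurve j V δ χ s)
    {W : State m} (hW : W ∈ V) {e : ℝ} (he : e ∈ Ioo (-δ) δ) {c : ℝ} (h1 : S.lam j W < c)
    (h2 : S.lam j (χ e W) < c) : S.speedMax j e (s e W) (χ e W) < c := by
  unfold speedMax
  split_ifs with hh
  · exact (h.shock hh.1 W hW e ⟨he.1, hh.2⟩).lt_left.trans h1
  · exact h2

theorem IsWaveCurve.lt_speedMin {j : Fin m} {V : Set (State m)} {δ : ℝ}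
    {χ : ℝ → State m → State m} {s : ℝ → State m → ℝ} (h : S.IsWaveCurve j V δ χ s)
    {W : State m} (hW : W ∈ V) {e : ℝ} (he : e ∈ Ioo (-δ) δ) {c : ℝ} (h1 : c < S.lam j W)
    (h2 : c < S.lam j (χ e W)) : c < S.speedMin j e (s e W) W := by
  unfold speedMin
  split_ifs with hh
  · exact h2.trans (h.shock hh.1 W hW e ⟨he.1, hh.2⟩).right_lt
  · exact h1

/-- Near `W₀` the characteristic speeds are uniformly separated. -/
theorem eventually_lam_separated {W₀ : State m} (hW₀ : W₀ ∈ S.Ω) :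
    ∀ᶠ W in 𝓝 W₀, ∀ i j, i < j → S.lam i W < (S.lam i W₀ + S.lam j W₀) / 2 ∧
      (S.lam i W₀ + S.lam j W₀) / 2 < S.lam j W := by
  refine eventually_all.2 fun i => eventually_all.2 fun j => ?_
  by_cases hij : i < j
  · have hlt : S.lam i W₀ < S.lam j W₀ := S.lam_strictMono W₀ hW₀ hij
    have hc : ∀ k, ContinuousAt (S.lam k) W₀ := fun k =>
      (S.continuousOn_lam k).continuousAt (S.isOpen.mem_nhds hW₀)
    filter_upwards [(hc i).eventually (gt_mem_nhds
      (show S.lam i W₀ < (S.lam i W₀ + S.lam j W₀) / 2 by linarith)),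
      (hc j).eventually (lt_mem_nhds
      (show (S.lam i W₀ + S.lam j W₀) / 2 < S.lam j W₀ by linarith))] with W h1 h2 _
    exact ⟨h1, h2⟩
  · exact Eventually.of_forall fun W h => absurd h hij

end HyperbolicSystem

theorem surjective_fderiv_chart {m : ℕ} (Φ : OpenPartialHomeomorph (State m) (State m))
    (hΦ : ContDiffOn ℝ 1 Φ Φ.source) (hΦ_symm : ContDiffOn ℝ 1 Φ.symm Φ.target) {W₀ : State m}
    (hW₀ : W₀ ∈ Φ.source) : Function.Surjective (fderiv ℝ Φ W₀) := by
  have hd : HasFDerivAt Φ (fderiv ℝ Φ W₀) W₀ :=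
    ((hΦ.contDiffAt (Φ.open_source.mem_nhds hW₀)).differentiableAt one_ne_zero).hasFDerivAt
  have ht : Φ W₀ ∈ Φ.target := Φ.map_source hW₀
  have hs : HasFDerivAt Φ.symm (fderiv ℝ Φ.symm (Φ W₀)) (Φ W₀) :=
    ((hΦ_symm.contDiffAt (Φ.open_target.mem_nhds ht)).differentiableAt one_ne_zero).hasFDerivAt
  have hd' : HasFDerivAt Φ (fderiv ℝ Φ W₀) (Φ.symm (Φ W₀)) := by rwa [Φ.left_inv hW₀]
  have hcomp := hd'.comp (Φ W₀) hs
  have hid : HasFDerivAt (Φ ∘ Φ.symm) (ContinuousLinearMap.id ℝ (State m)) (Φ W₀) :=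
    (hasFDerivAt_id _).congr_of_eventuallyEq (by
      filter_upwards [Φ.open_target.mem_nhds ht] with x hx using Φ.right_inv hx)
  have heq := hcomp.unique hid
  intro x
  exact ⟨fderiv ℝ Φ.symm (Φ W₀) x, congrArg (fun T : State m →L[ℝ] State m => T x) heq⟩

end PartialRiemann

/-! ### Assembly of the solution. -/

theorem theorem2 {m : ℕ} (S : PartialRiemann.HyperbolicSystem m)
    (h_fields : ∀ j, S.GenuinelyNonlinear j ∨ S.LinearlyDegenerate j)
    (p : ℕ) (hp : p ≤ m) (W₀ : PartialRiemann.State m)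
    (Φ : OpenPartialHomeomorph (PartialRiemann.State m) (PartialRiemann.State m))
    (hΦ_source : Φ.source ⊆ S.Ω) (hΦ_target : 0 ∈ Φ.target)
    (hΦ : ContDiffOn ℝ 1 Φ Φ.source) (hΦ_symm : ContDiffOn ℝ 1 Φ.symm Φ.target)
    (hW₀ : W₀ ∈ PartialRiemann.boundaryManifold Φ p)
    (tang : Fin m → PartialRiemann.State m)
    (h_tang : ∀ k : Fin m, p ≤ k.val → fderiv ℝ Φ W₀ (tang k) = EuclideanSpace.single k 1)
    (h_transversal : ∃ b : Module.Basis (Fin m) ℝ (PartialRiemann.State m),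
      ∀ k, b k = if k.val < p then S.R k W₀ else tang k) :
    ∃ (χ : Fin m → ℝ → PartialRiemann.State m → PartialRiemann.State m)
      (s : Fin m → ℝ → PartialRiemann.State m → ℝ)
      (V : Set (PartialRiemann.State m)) (δ : ℝ),
      V ∈ 𝓝 W₀ ∧ V ⊆ S.Ω ∧ 0 < δ ∧
      (∀ j, S.IsWaveCurve j V δ (χ j) (s j)) ∧
      ∃ Ω₁ ∈ 𝓝 W₀, Ω₁ ⊆ Φ.source ∧ ∀ Wl ∈ Ω₁,
        ∃ (ε : Fin p → ℝ) (w : Fin (p + 1) → PartialRiemann.State m)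
          (U : ℝ → PartialRiemann.State m) (W : ℝ → ℝ → PartialRiemann.State m),
          (∀ j, ε j ∈ Ioo (-δ) δ) ∧ (∀ i, w i ∈ V) ∧
          w 0 = Wl ∧
          (∀ j : Fin p, w j.succ = χ (Fin.castLE hp j) (ε j) (w j.castSucc)) ∧
          w (Fin.last p) ∈ PartialRiemann.boundaryManifold Φ p ∧
          PartialRiemann.HyperbolicSystem.IsSuperposition
            (fun j => χ (Fin.castLE hp j)) w
            (fun j => S.speedMin (Fin.castLE hp j) (ε j)
              (s (Fin.castLE hp j) (ε j) (w j.castSucc)) (w j.castSucc))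
            (fun j => S.speedMax (Fin.castLE hp j) (ε j)
              (s (Fin.castLE hp j) (ε j) (w j.castSucc)) (w j.succ))
            U ∧
          (∀ x t, 0 < t → W x t = U (x / t)) ∧
          (∀ x, 0 < x → W x 0 = w (Fin.last p)) ∧
          S.SolvesPartialRiemann Wl (PartialRiemann.boundaryManifold Φ p) W := by
  open PartialRiemann HyperbolicSystem in
  have hW₀s : W₀ ∈ Φ.source := hW₀.1
  have hW₀Ω : W₀ ∈ S.Ω := hΦ_source hW₀s
  have hsn : Φ.source ∈ 𝓝 W₀ := Φ.open_source.mem_nhds hW₀s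
  choose χ s V' δ' y τ hV' hδ' hcurve' hent' hy hτ hyχ using
    fun j => exists_isWaveCurve (h_fields j) hW₀Ω
  obtain ⟨δ, hδle, hδ⟩ : ∃ δ, (∀ j, δ ≤ δ' j) ∧ 0 < δ := by
    have h1 : ∀ᶠ d in 𝓝[>] (0 : ℝ), ∀ j, d ≤ δ' j := eventually_all.2 fun j =>
      eventually_nhdsWithin_of_eventually_nhds (Iic_mem_nhds (hδ' j))
    exact (h1.and self_mem_nhdsWithin).exists
  -- The midpoints between characteristic speeds at W₀ act as barriers: since all intermediate
  -- states lie in V, waves of different families cannot overlap.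
  set V : Set (State m) := {W | W ∈ Φ.source ∧ (∀ j, W ∈ V' j) ∧
    ∀ i j, i < j → S.lam i W < (S.lam i W₀ + S.lam j W₀) / 2 ∧
      (S.lam i W₀ + S.lam j W₀) / 2 < S.lam j W} with hVdef
  have hV : V ∈ 𝓝 W₀ := by
    filter_upwards [hsn, eventually_all.2 hV', eventually_lam_separated hW₀Ω]
      with W h1 h2 h3 using ⟨h1, h2, h3⟩
  have hVΩ : V ⊆ S.Ω := fun W hW => hΦ_source hW.1
  have hcurve : ∀ j, S.IsWaveCurve j V δ (χ j) (s j) := fun j =>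
    (hcurve' j).mono (fun W hW => hW.2.1 j) (hδle j)
  have hent : ∀ j, S.GenuinelyNonlinear j → ∀ W ∈ V, ∀ e ∈ Ioo (-δ) 0, ∀ η q,
      S.IsEntropyPair η q → q (χ j e W) - q W ≤ s j e W * (η (χ j e W) - η W) :=
    fun j hj W hW e he => hent' j hj W (hW.2.1 j) e ⟨(neg_le_neg (hδle j)).trans_lt he.1, he.2⟩
  have hy₀ : ∀ j, y j (0, W₀) = W₀ := by
    intro j
    -- The limit is along the full neighbourhood filter, which includes the point itself, so it is
    -- also the value there.
    have h1 : τ j (0, W₀) = 0 := eq_of_tendsto_nhds (hτ j)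
    rw [(hyχ j).self_of_nhds, h1]
    exact (hcurve j).zero W₀ (mem_of_mem_nhds hV)
  refine ⟨χ, s, V, δ, hV, hVΩ, hδ, hcurve, ?_⟩
  obtain ⟨b, hb⟩ := h_transversal
  have hΦd : HasStrictFDerivAt Φ (fderiv ℝ Φ W₀) W₀ :=
    (hΦ.contDiffAt hsn).hasStrictFDerivAt one_ne_zero
  let P : State m →L[ℝ] (Fin p → ℝ) :=
    ContinuousLinearMap.pi fun i : Fin p => EuclideanSpace.proj (Fin.castLE hp i)
  have hstates := eventually_exists_successive_states (p := p)
    (y := fun j => y (Fin.castLE hp j)) (r := fun j => S.R (Fin.castLE hp j) W₀) (W₀ := W₀)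
    (fun j => hy _) (fun j => hy₀ _) (Ψ := fun X => P (Φ X)) (Ψ' := P.comp (fderiv ℝ Φ W₀))
    (P.hasStrictFDerivAt.comp W₀ hΦd)
    (by ext i; exact hW₀.2 (Fin.castLE hp i) i.isLt)
    (fun a => by
      obtain ⟨t, ht⟩ := exists_fderiv_sum_eq hp (surjective_fderiv_chart Φ hΦ hΦ_symm hW₀s)
        h_tang hb a
      exact ⟨t, funext ht⟩)
    -- Parameters are confined to where y coincides with χ ∘ τ and the resulting strength is
    -- admissible.
    (N := fun j => {z | y (Fin.castLE hp j) z = χ (Fin.castLE hp j) (τ (Fin.castLE hp j) z) z.2 ∧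
      τ (Fin.castLE hp j) z ∈ Ioo (-δ) δ})
    (fun j => (hyχ _).and ((hτ _).eventually (Ioo_mem_nhds (neg_lt_zero.2 hδ) hδ))) hV
  refine ⟨_, inter_mem hsn hstates, inter_subset_left, ?_⟩
  rintro Wl ⟨_, t, w, hw0, hwsucc, hN, hwV, hΨ⟩
  set ε : Fin p → ℝ := fun j => τ (Fin.castLE hp j) (t j, w j.castSucc) with hε
  have hεδ : ∀ j, ε j ∈ Ioo (-δ) δ := fun j => (hN j).2
  have hstep : ∀ j : Fin p, w j.succ = χ (Fin.castLE hp j) (ε j) (w j.castSucc) := fun j =>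
    (hwsucc j).trans (hN j).1
  have hlast : w (Fin.last p) ∈ boundaryManifold Φ p :=
    ⟨(hwV _).1, fun i hi => congrFun hΨ ⟨i, hi⟩⟩
  choose C hC hCfan using fun j : Fin p => (hcurve (Fin.castLE hp j)).exists_isElementaryWave
    (h_fields _) (hent _) (hwV j.castSucc) (hεδ j)
  simp only [← hstep] at hC hCfan
  have hord : ∀ i j : Fin p, i < j →
      S.speedMax (Fin.castLE hp i) (ε i) (s (Fin.castLE hp i) (ε i) (w i.castSucc)) (w i.succ) <
      S.speedMin (Fin.castLE hp j) (ε j) (s (Fin.castLE hp j) (ε j) (w j.castSucc))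
        (w j.castSucc) := by
    intro i j hij
    have hij' : Fin.castLE hp i < Fin.castLE hp j := hij
    have h1 := (hcurve (Fin.castLE hp i)).speedMax_lt (hwV i.castSucc) (hεδ i)
      ((hwV i.castSucc).2.2 _ _ hij').1 (by rw [← hstep]; exact ((hwV i.succ).2.2 _ _ hij').1)
    have h2 := (hcurve (Fin.castLE hp j)).lt_speedMin (hwV j.castSucc) (hεδ j)
      ((hwV j.castSucc).2.2 _ _ hij').2 (by rw [← hstep]; exact ((hwV j.succ).2.2 _ _ hij').2)
    rw [← hstep] at h1
    exact h1.trans h2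
  -- The quotient x / t takes the value 0 at t = 0, so the initial datum is prescribed separately.
  refine ⟨ε, w, superposition w C, fun x t => if 0 < t then superposition w C (x / t) else
      if 0 < x then w (Fin.last p) else w 0, hεδ, hwV, hw0, hstep, hlast, ?_, ?_, ?_, ?_⟩
  · refine ⟨fun j => (hC j).le, hord, fun i ξ h1 h2 => superposition_const hC i h1 h2,
      fun j ξ hξ => ?_⟩
    rw [(superposition_eq hC (k := j) (fun i hi => (hord i j hi).trans hξ.1)
      fun i hi => (hξ.2.trans (hord j i hi)).le).1, hCfan j ξ hξ]
  · intro x t ht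
    exact if_pos ht
  · intro x hx
    simp [hx]
  · refine ⟨isEntropySolution_superposition hC hord fun i => hVΩ (hwV i), fun x hx => ?_,
      fun x hx => ?_⟩
    · simp [hx.not_gt, hw0]
    · simpa [hx] using hlast
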